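/- Let $N\subseteq B(\mathcal H_0)$ be a von Neumann algebra with a faithful normal semifinite tracial weight $\tau\colon N_+\to[0,\infty]$; that is, $\tau$ is additive and positively homogeneous, $\tau(x^*x)=\tau(xx^*)$ for all $x\in N$, $\tau(x)=0$ only for $x=0$, $\tau(\sup_i x_i)=\sup_i\tau(x_i)$ for every bounded increasing net in $N_+$, and every non-zero $x\in N_+$ dominates a non-zero $y\in N_+$ with $\tau(y)<\infty$. Let $L^2(N,\tau)$ be the completion of $\{x\in N:\tau(x^*x)<\infty\}$ for the inner product $\langle x,y\rangle=\tau(y^*x)$, on which $N$ acts by left multiplication, and let $J_\tau$ be the conjugate linear isometry of $L^2(N,\tau)$ extending $x\mapsto x^*$. A left $(N,\tau)$-module is a Hilbert space $\mathcal H$ with a normal unital $*$-homomorphism $\pi\colon N\to B(\mathcal H)$. A standard intertwiner for $(\mathcal H,\pi)$ is an isometry $v\colon\mathcal H\to L^2(N,\tau)\otimes\mathcal K$, where $\mathcal K=\ell^2(I)$ for some set $I$, such that $v\pi(x)=(x\otimes1)v$ for all $x\in N$. Here $L^2(N,\tau)\otimes \ell^2(I)=\bigoplus_{i\in I}L^2(N,\tau)$,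 $J_\tau\otimes 1$ is $J_\tau$ applied in each coordinate, $N\bar\otimes B(\ell^2(I))$ consists of the bounded operators all of whose matrix entries lie in $N$, and $(\tau\otimes\mathrm{Tr})(T)=\sum_{i\in I}\tau(T_{ii})$ for positive $T\in N\bar\otimes B(\ell^2(I))$. The Murray--von Neumann dimension of $(\mathcal H,\pi)$ is $$\dim_{(N,\tau)}(\mathcal H,\pi):=(\tau\otimes\mathrm{Tr})\big[(J_\tau\otimes1)vv^*(J_\tau\otimes1)\big]$$ for any standard intertwiner $v$, and Petersen's dimension is $$\dim'_{(N,\tau)}(\mathcal H,\pi):=\sup\{\tau(p)\dim_{(pNp,\tau_p)}(\pi(p)\mathcal H,\pi|_{pNp}) : p\in N\text{ a projection with }\tau(p)<\infty\},$$ where $\tau_p=\tau(p)^{-1}\tau(p\,\cdot\,p)$ on $pNp$ (the term for $p=0$ is $0$). Then, for every left $(N,\tau)$-module $(\mathcal H,\pi)$, standard intertwiners exist; for every standard intertwiner $v$ the operator $(J_\tau\otimes1)vv^*(J_\tau\otimes1)$ belongs to $N\bar\otimes B(\ell^2(I))$ and its value under $\tau\otimes\mathrm{Tr}$ is the same number $\dim_{(N,\tau)}(\mathcal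 H,\pi)\in[0,\infty]$; and $$\dim'_{(N,\tau)}(\mathcal H,\pi)=\dim_{(N,\tau)}(\mathcal H,\pi).$$ -/

import Mathlib

open scoped ENNReal NNReal

universe u₀ u w

noncomputable section

namespace VNDim

/-! ### Tracial weights on a von Neumann algebra -/

section Weights

variable {H₀ : Type u₀} [NormedAddCommGroup H₀] [InnerProductSpace ℂ H₀] [CompleteSpace H₀]

/-- The elements of the von Neumann algebra `N`, as a unital `*`-algebra ordered by the
Loewner order of operators. -/
abbrev Elem (N : VonNeumannAlgebra H₀) : Type u₀ := N.toStarSubalgebra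

/-- A tracial weight `τ : N₊ → [0,∞]`. It is represented by a function on all of `N`, of which only
the values on the positive cone `N₊` carry information (and are ever used below). -/
structure TracialWeight (N : VonNeumannAlgebra H₀) where
  toFun : Elem N → ℝ≥0∞
  add_of_nonneg : ∀ x y : Elem N, 0 ≤ x → 0 ≤ y → toFun (x + y) = toFun x + toFun y
  smul_of_nonneg : ∀ (c : ℝ≥0) (x : Elem N), 0 ≤ x → toFun (((c : ℝ) : ℂ) • x) = c * toFun x
  tracial : ∀ x : Elem N, toFun (star x * x) = toFun (x * star x)

variable {N : VonNeumannAlgebra H₀}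

namespace TracialWeight

instance : CoeFun (TracialWeight N) fun _ => Elem N → ℝ≥0∞ := ⟨TracialWeight.toFun⟩

/-- `τ(x) = 0` for `x ∈ N₊` only if `x = 0`. -/
def IsFaithful (τ : TracialWeight N) : Prop := ∀ x : Elem N, 0 ≤ x → τ x = 0 → x = 0

/-- `τ(sup D) = sup τ(D)` for every bounded upward directed family `D` in `N₊`. -/
def IsNormal (τ : TracialWeight N) : Prop :=
  ∀ D : Set (Elem N), (∀ d ∈ D, 0 ≤ d) → D.Nonempty → DirectedOn (· ≤ ·) D →
    ∀ x : Elem N, IsLUB D x → τ x = ⨆ d ∈ D, τ d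

/-- Semifiniteness of a trace: every non-zero positive element dominates a non-zero positive element
of finite trace. -/
def IsSemifinite (τ : TracialWeight N) : Prop :=
  ∀ x : Elem N, 0 ≤ x → x ≠ 0 → ∃ y : Elem N, 0 ≤ y ∧ y ≤ x ∧ y ≠ 0 ∧ τ y < ∞

end TracialWeight

theorem star_mul_self_nonneg' (x : Elem N) : 0 ≤ star x * x := by
  change (0 : H₀ →L[ℂ] H₀) ≤ star (x : H₀ →L[ℂ] H₀) * (x : H₀ →L[ℂ] H₀)
  exact star_mul_self_nonneg _

theorem add_nonneg' {x y : Elem N} (hx : 0 ≤ x) (hy : 0 ≤ y) : 0 ≤ x + y := by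
  have hx' : (0 : H₀ →L[ℂ] H₀) ≤ x := hx
  have hy' : (0 : H₀ →L[ℂ] H₀) ≤ y := hy
  change (0 : H₀ →L[ℂ] H₀) ≤ (x : H₀ →L[ℂ] H₀) + (y : H₀ →L[ℂ] H₀)
  exact add_nonneg hx' hy'

theorem sub_nonneg' {x y : Elem N} (h : x ≤ y) : 0 ≤ y - x := by
  have h' : (x : H₀ →L[ℂ] H₀) ≤ y := h
  change (0 : H₀ →L[ℂ] H₀) ≤ (y : H₀ →L[ℂ] H₀) - (x : H₀ →L[ℂ] H₀)
  exact sub_nonneg.2 h'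

theorem smul_nonneg' (c : ℝ≥0) {x : Elem N} (hx : 0 ≤ x) : 0 ≤ ((c : ℝ) : ℂ) • x := by
  have hx' : (0 : H₀ →L[ℂ] H₀) ≤ x := hx
  change (0 : H₀ →L[ℂ] H₀) ≤ ((c : ℝ) : ℂ) • (x : H₀ →L[ℂ] H₀)
  rw [ContinuousLinearMap.nonneg_iff_isPositive] at hx' ⊢
  exact hx'.smul_of_nonneg (by exact_mod_cast c.2)

/-- `y* x* x y ≤ ‖x‖² y* y`. -/
theorem conj_le (x y : Elem N) :
    star (x * y) * (x * y) ≤ (((‖x‖₊ ^ 2 : ℝ≥0) : ℝ) : ℂ) • (star y * y) := by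
  change star ((x : H₀ →L[ℂ] H₀) * y) * ((x : H₀ →L[ℂ] H₀) * y) ≤
    (((‖x‖₊ ^ 2 : ℝ≥0) : ℝ) : ℂ) • (star (y : H₀ →L[ℂ] H₀) * y)
  have h := CStarAlgebra.star_left_conjugate_le_norm_smul (a := (y : H₀ →L[ℂ] H₀))
    (b := star (x : H₀ →L[ℂ] H₀) * x)
  rw [CStarRing.norm_star_mul_self] at h
  have e : (((‖x‖₊ ^ 2 : ℝ≥0) : ℝ) : ℂ) • (star (y : H₀ →L[ℂ] H₀) * y) =
      (‖(x : H₀ →L[ℂ] H₀)‖ * ‖(x : H₀ →L[ℂ] H₀)‖) • (star (y : H₀ →L[ℂ] H₀) * y) := by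
    rw [Complex.coe_smul]; congr 1; simp [sq]
  rw [e]
  simpa [mul_assoc] using h

namespace TracialWeight

variable (τ : TracialWeight N)

theorem mono {x y : Elem N} (hx : 0 ≤ x) (h : x ≤ y) : τ x ≤ τ y := by
  have := τ.add_of_nonneg x (y - x) hx (sub_nonneg' h)
  rw [add_sub_cancel] at this
  rw [this]; exact le_self_add

theorem sq_smul (c : ℂ) (x : Elem N) :
    τ (star (c • x) * (c • x)) = (‖c‖₊ ^ 2 : ℝ≥0) * τ (star x * x) := by
  rw [← τ.smul_of_nonneg _ _ (star_mul_self_nonneg' x)]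
  congr 1
  rw [star_smul, smul_mul_smul_comm]
  congr 1
  simp [← Complex.normSq_eq_conj_mul_self, Complex.normSq_eq_norm_sq]

theorem sq_add_le (x y : Elem N) :
    τ (star (x + y) * (x + y)) ≤ 2 * (τ (star x * x) + τ (star y * y)) := by
  have h1 := τ.add_of_nonneg (star (x + y) * (x + y)) (star (x - y) * (x - y))
    (star_mul_self_nonneg' _) (star_mul_self_nonneg' _)
  have h2 := τ.smul_of_nonneg 2 (star x * x + star y * y)
    (add_nonneg' (star_mul_self_nonneg' _) (star_mul_self_nonneg' _))
  rw [τ.add_of_nonneg _ _ (star_mul_self_nonneg' _) (star_mul_self_nonneg' _)] at h2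
  have e : star (x + y) * (x + y) + star (x - y) * (x - y) =
      (((2 : ℝ≥0) : ℝ) : ℂ) • (star x * x + star y * y) := by
    simp only [star_add, star_sub, NNReal.coe_ofNat, Complex.ofReal_ofNat, two_smul]
    noncomm_ring
  rw [e, h2] at h1
  rw [show ((2 : ℝ≥0) : ℝ≥0∞) = 2 from rfl] at h1
  rw [h1]; exact le_self_add

/-! ### The Hilbert space `L²(N,τ)` -/

/-- The left ideal `{x ∈ N : τ(x*x) < ∞}`. -/
def sqrtDom : Submodule ℂ (Elem N) where
  carrier := {x | τ (star x * x) < ∞}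
  add_mem' {x y} hx hy := by
    refine (τ.sq_add_le x y).trans_lt ?_
    exact ENNReal.mul_lt_top (by simp) (ENNReal.add_lt_top.2 ⟨hx, hy⟩)
  zero_mem' := by
    have h := τ.sq_smul 0 0
    rw [zero_smul] at h
    change τ (star 0 * 0) < ∞
    rw [h]
    simp
  smul_mem' c x hx := by
    simp only [Set.mem_ofPred_eq, τ.sq_smul] at hx ⊢
    exact ENNReal.mul_lt_top (by simp) hx

/-- The left ideal `{x ∈ N : τ(x*x) < ∞}`, to be equipped with the inner product of `τ` (rather than
with the operator norm). -/
def PreL2 : Type u₀ := τ.sqrtDom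

instance : AddCommGroup τ.PreL2 := inferInstanceAs (AddCommGroup τ.sqrtDom)
instance : Module ℂ τ.PreL2 := inferInstanceAs (Module ℂ τ.sqrtDom)

/-- The inclusion of `{x ∈ N : τ(x*x) < ∞}` into `N`. -/
def PreL2.val : τ.PreL2 →ₗ[ℂ] Elem N := τ.sqrtDom.subtype

/-- An element of `N` with `τ(x*x) < ∞`, as a vector. -/
def PreL2.mk (x : Elem N) (hx : τ (star x * x) < ∞) : τ.PreL2 := (⟨x, hx⟩ : τ.sqrtDom)

variable {τ} in
theorem PreL2.ext {x y : τ.PreL2} (h : PreL2.val τ x = PreL2.val τ y) : x = y := Subtype.ext h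

@[simp] theorem PreL2.val_mk (x : Elem N) (hx : τ (star x * x) < ∞) :
    PreL2.val τ (PreL2.mk τ x hx) = x := rfl

theorem PreL2.lt_top (x : τ.PreL2) : τ (star (PreL2.val τ x) * PreL2.val τ x) < ∞ := x.2

/-- The quadratic form `x ↦ τ(x*x) ∈ [0,∞)`. -/
def quad (x : τ.PreL2) : ℝ := (τ (star (PreL2.val τ x) * PreL2.val τ x)).toReal

/-- `Re τ(x*y)`, by polarization. -/
def reInner (x y : τ.PreL2) : ℝ := (τ.quad (x + y) - τ.quad (x - y)) / 4

theorem quad_nonneg (x : τ.PreL2) : 0 ≤ τ.quad x := ENNReal.toReal_nonneg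

theorem quad_smul (c : ℂ) (x : τ.PreL2) : τ.quad (c • x) = ‖c‖ ^ 2 * τ.quad x := by
  rw [quad, map_smul, τ.sq_smul, ENNReal.toReal_mul]
  simp [quad]

theorem quad_neg (x : τ.PreL2) : τ.quad (-x) = τ.quad x := by
  simpa using τ.quad_smul (-1) x

theorem quad_zero : τ.quad 0 = 0 := by
  simpa using τ.quad_smul 0 0

theorem toReal_add {a b : Elem N} (ha : 0 ≤ a) (hb : 0 ≤ b) (ha' : τ a < ∞) (hb' : τ b < ∞) :
    (τ (a + b)).toReal = (τ a).toReal + (τ b).toReal ∧ τ (a + b) < ∞ := by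
  rw [τ.add_of_nonneg a b ha hb]
  exact ⟨ENNReal.toReal_add ha'.ne hb'.ne, ENNReal.add_lt_top.2 ⟨ha', hb'⟩⟩

theorem quad_add_three (a b c : τ.PreL2) :
    (τ (star (PreL2.val τ a) * PreL2.val τ a + star (PreL2.val τ b) * PreL2.val τ b +
      star (PreL2.val τ c) * PreL2.val τ c)).toReal = τ.quad a + τ.quad b + τ.quad c := by
  have h1 := τ.toReal_add (star_mul_self_nonneg' (PreL2.val τ a))
    (star_mul_self_nonneg' (PreL2.val τ b)) (PreL2.lt_top τ a) (PreL2.lt_top τ b)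
  have h2 := τ.toReal_add (add_nonneg' (star_mul_self_nonneg' (PreL2.val τ a))
    (star_mul_self_nonneg' (PreL2.val τ b))) (star_mul_self_nonneg' (PreL2.val τ c)) h1.2
    (PreL2.lt_top τ c)
  rw [h2.1, h1.1]; rfl

theorem reInner_add (x₁ x₂ y : τ.PreL2) :
    τ.reInner (x₁ + x₂) y = τ.reInner x₁ y + τ.reInner x₂ y := by
  have h1 := τ.quad_add_three (x₁ + x₂ + y) (x₁ - y) (x₂ - y)
  have h2 := τ.quad_add_three (x₁ + x₂ - y) (x₁ + y) (x₂ + y)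
  have e : ∀ a b c : Elem N, star (a + b + c) * (a + b + c) + star (a - c) * (a - c) +
      star (b - c) * (b - c) = star (a + b - c) * (a + b - c) + star (a + c) * (a + c) +
      star (b + c) * (b + c) := by
    intro a b c
    simp only [star_add, star_sub]
    noncomm_ring
  simp only [map_add, map_sub] at h1 h2
  rw [e, h2] at h1
  simp only [reInner]
  linarith

theorem reInner_comm (x y : τ.PreL2) : τ.reInner x y = τ.reInner y x := by
  rw [reInner, reInner, add_comm y x, ← τ.quad_neg (y - x), neg_sub]

theorem reInner_neg (x y : τ.PreL2) : τ.reInner (-x) y = -τ.reInner x y := by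
  have h1 := τ.quad_neg (x - y)
  have h2 := τ.quad_neg (x + y)
  rw [neg_sub, sub_eq_neg_add] at h1
  rw [neg_add, ← sub_eq_add_neg] at h2
  rw [reInner, reInner, h1, h2]; ring

theorem reInner_I_I (x y : τ.PreL2) :
    τ.reInner (Complex.I • x) (Complex.I • y) = τ.reInner x y := by
  simp [reInner, ← smul_add, ← smul_sub, τ.quad_smul]

theorem reInner_smul_nnreal (c : ℝ≥0) (x y : τ.PreL2) :
    τ.reInner (((c : ℝ) : ℂ) • x) y = c * τ.reInner x y := by
  have key : ∀ a b : τ.PreL2, (τ (star (PreL2.val τ a) * PreL2.val τ a +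
      ((c : ℝ) : ℂ) • (star (PreL2.val τ b) * PreL2.val τ b))).toReal =
      τ.quad a + c * τ.quad b := by
    intro a b
    have hs := τ.smul_of_nonneg c _ (star_mul_self_nonneg' (PreL2.val τ b))
    rw [(τ.toReal_add (star_mul_self_nonneg' _) (smul_nonneg' c (star_mul_self_nonneg' _))
      (PreL2.lt_top τ a) (by rw [hs]; exact ENNReal.mul_lt_top (by simp) (PreL2.lt_top τ b))).1, hs]
    simp [quad]
  have h1 := key (((c : ℝ) : ℂ) • x + y) (x - y)
  have h2 := key (((c : ℝ) : ℂ) • x - y) (x + y)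
  have e : ∀ a b : Elem N, star (((c : ℝ) : ℂ) • a + b) * (((c : ℝ) : ℂ) • a + b) +
      ((c : ℝ) : ℂ) • (star (a - b) * (a - b)) =
      star (((c : ℝ) : ℂ) • a - b) * (((c : ℝ) : ℂ) • a - b) +
      ((c : ℝ) : ℂ) • (star (a + b) * (a + b)) := by
    intro a b
    have hc : star (((c : ℝ) : ℂ)) = ((c : ℝ) : ℂ) := by simp
    simp only [star_add, star_sub, star_smul, hc, mul_add, add_mul, mul_sub, sub_mul,
      smul_mul_assoc, mul_smul_comm, smul_add, smul_sub]
    abel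
  simp only [map_add, map_sub, map_smul] at h1 h2
  rw [e, h2] at h1
  simp only [reInner]
  linarith

theorem reInner_smul_real (c : ℝ) (x y : τ.PreL2) :
    τ.reInner ((c : ℂ) • x) y = c * τ.reInner x y := by
  rcases le_total 0 c with h | h
  · exact τ.reInner_smul_nnreal ⟨c, h⟩ x y
  · lift -c to ℝ≥0 using by linarith with d hd
    have hc : (c : ℂ) = -((d : ℝ) : ℂ) := by rw [hd]; simp
    rw [hc, neg_smul, τ.reInner_neg, τ.reInner_smul_nnreal, hd]
    ring

theorem polarization_eq (x y : τ.PreL2) :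
    (((τ.quad (y + x) - τ.quad (y - x) : ℝ) : ℂ) +
        Complex.I * (τ.quad (y + Complex.I • x) - τ.quad (y - Complex.I • x) : ℝ)) / 4 =
      (τ.reInner x y : ℂ) + Complex.I * τ.reInner (Complex.I • x) y := by
  rw [τ.reInner_comm x, τ.reInner_comm _ y, reInner, reInner]
  push_cast; ring

/-- The inner product `τ(x*y)` (conjugate linear in `x`), by polarization:
`x*y = ¼ ∑ₖ iᵏ (y + iᵏ x)* (y + iᵏ x)`. -/
abbrev preL2Core : PreInnerProductSpace.Core ℂ τ.PreL2 where
  inner x y := ((τ.quad (y + x) - τ.quad (y - x) : ℝ) +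
    Complex.I * (τ.quad (y + Complex.I • x) - τ.quad (y - Complex.I • x) : ℝ)) / 4
  conj_inner_symm x y := by
    simp only [polarization_eq]
    have h2 : τ.reInner (Complex.I • y) x = - τ.reInner (Complex.I • x) y := by
      rw [← τ.reInner_I_I, smul_smul, Complex.I_mul_I, neg_one_smul, τ.reInner_neg,
        τ.reInner_comm]
    rw [h2, τ.reInner_comm y x]
    simp
  re_inner_nonneg x := by
    have h2 : τ.quad (x + x) = 4 * τ.quad x := by
      rw [← two_smul ℂ x, τ.quad_smul]; norm_num
    have := τ.quad_nonneg x
    simp [h2, τ.quad_zero]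
    exact this
  add_left x y z := by
    simp only [polarization_eq]
    simp only [smul_add, τ.reInner_add]
    push_cast; ring
  smul_left x y r := by
    simp only [polarization_eq]
    have h1 : r • x = (r.re : ℂ) • x + (r.im : ℂ) • (Complex.I • x) := by
      rw [smul_smul, ← add_smul, Complex.re_add_im]
    have h2 : Complex.I • r • x = (r.re : ℂ) • (Complex.I • x) + ((-r.im : ℝ) : ℂ) • x := by
      rw [smul_smul, smul_smul, ← add_smul]
      congr 1
      apply Complex.ext <;> simp
    rw [h2, h1, τ.reInner_add, τ.reInner_add, τ.reInner_smul_real, τ.reInner_smul_real,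
      τ.reInner_smul_real, τ.reInner_smul_real]
    apply Complex.ext <;> simp

instance : SeminormedAddCommGroup τ.PreL2 :=
  InnerProductSpace.Core.toSeminormedAddCommGroup (c := τ.preL2Core)
instance : InnerProductSpace ℂ τ.PreL2 := InnerProductSpace.ofCore τ.preL2Core

/-- `‖x‖² = τ(x*x)` in `L²(N,τ)`. -/
theorem norm_sq_preL2 (x : τ.PreL2) : ‖x‖ ^ 2 = τ.quad x := by
  rw [← inner_self_eq_norm_sq (𝕜 := ℂ)]
  change (((τ.quad (x + x) - τ.quad (x - x) : ℝ) +
    Complex.I * (τ.quad (x + Complex.I • x) - τ.quad (x - Complex.I • x) : ℝ)) / 4 : ℂ).re = _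
  have h2 : τ.quad (x + x) = 4 * τ.quad x := by
    rw [← two_smul ℂ x, τ.quad_smul]; norm_num
  have h3 : τ.quad (x + Complex.I • x) = τ.quad (x - Complex.I • x) := by
    have : x + Complex.I • x = Complex.I • (x - Complex.I • x) := by
      rw [smul_sub, smul_smul, Complex.I_mul_I, neg_one_smul, sub_neg_eq_add, add_comm]
    rw [this, τ.quad_smul]; simp
  simp [h2, h3, τ.quad_zero]

/-- The Hilbert space `L²(N,τ)`: the completion of `{x ∈ N : τ(x*x) < ∞}`. -/
abbrev L2 : Type u₀ := UniformSpace.Completion τ.PreL2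

theorem mul_mem_dom (x : Elem N) (y : τ.PreL2) :
    τ (star (x * PreL2.val τ y) * (x * PreL2.val τ y)) ≤
      (‖x‖₊ ^ 2 : ℝ≥0) * τ (star (PreL2.val τ y) * PreL2.val τ y) := by
  rw [← τ.smul_of_nonneg _ _ (star_mul_self_nonneg' _)]
  exact τ.mono (star_mul_self_nonneg' _) (conj_le _ _)

/-- Left multiplication `y ↦ x y` on `{y ∈ N : τ(y*y) < ∞}`. -/
def preLmul (x : Elem N) : τ.PreL2 →L[ℂ] τ.PreL2 :=
  LinearMap.mkContinuous
    { toFun := fun y => PreL2.mk τ (x * PreL2.val τ y) ((τ.mul_mem_dom x y).trans_lt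
        (ENNReal.mul_lt_top (by simp) (PreL2.lt_top τ y)))
      map_add' := fun a b => PreL2.ext (by simp [mul_add])
      map_smul' := fun c a => PreL2.ext (by simp) }
    ‖x‖ fun y => by
      rw [← sq_le_sq₀ (norm_nonneg _) (by positivity), mul_pow, norm_sq_preL2, norm_sq_preL2]
      have h := ENNReal.toReal_mono
        (ENNReal.mul_lt_top (by simp) (PreL2.lt_top τ y)).ne (τ.mul_mem_dom x y)
      simpa [quad] using h

/-- The representation `π_τ(x) y = x y` of `N` on `L²(N,τ)`. -/
def lmul (x : Elem N) : τ.L2 →L[ℂ] τ.L2 := (τ.preLmul x).completion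

/-- The conjugation `x ↦ x*` on `{x ∈ N : τ(x*x) < ∞}`. -/
def preJ : τ.PreL2 →L⋆[ℂ] τ.PreL2 :=
  LinearMap.mkContinuous
    { toFun := fun y => PreL2.mk τ (star (PreL2.val τ y)) (by
        rw [star_star, ← τ.tracial]; exact PreL2.lt_top τ y)
      map_add' := fun a b => PreL2.ext (by simp)
      map_smul' := fun c a => PreL2.ext (by simp) }
    1 fun y => by
      rw [one_mul, ← sq_le_sq₀ (norm_nonneg _) (norm_nonneg _), norm_sq_preL2, norm_sq_preL2]
      simp [quad, ← τ.tracial]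

/-- The modular conjugation `J_τ` of `L²(N,τ)`: the continuous extension of `x ↦ x*`, which is
isometric because `τ` is tracial. -/
def J : τ.L2 →L⋆[ℂ] τ.L2 := τ.preJ.completion

theorem norm_J_le (ξ : τ.L2) : ‖τ.J ξ‖ ≤ ‖ξ‖ := by
  induction ξ using UniformSpace.Completion.induction_on with
  | hp => exact isClosed_le (by fun_prop) (by fun_prop)
  | ih y =>
    rw [J, ContinuousLinearMap.completion_apply_coe, UniformSpace.Completion.norm_coe,
      UniformSpace.Completion.norm_coe]
    simpa using LinearMap.mkContinuous_norm_le _ zero_le_one _ |> (τ.preJ).le_of_opNorm_le (x := y)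

/-! ### The amplification `L²(N,τ) ⊗ ℓ²(ι)` and the trace `τ ⊗ Tr` -/

/-- The Hilbert space `L²(N,τ) ⊗ ℓ²(ι)`, realized as the `ℓ²`-direct sum of copies of `L²(N,τ)`
indexed by `ι`. -/
abbrev Amp (ι : Type w) : Type (max u₀ w) := lp (fun _ : ι => τ.L2) 2

variable {ι : Type w}

/-- The operator `T ⊗ 1` on `L²(N,τ) ⊗ ℓ²(ι)`. -/
def amplify (ι : Type w) (T : τ.L2 →L[ℂ] τ.L2) : τ.Amp ι →L[ℂ] τ.Amp ι :=
  lp.mapCLM 2 (fun _ => T) (norm_nonneg T) (fun _ => le_rfl)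

/-- The conjugate linear operator `J_τ ⊗ 1` on `L²(N,τ) ⊗ ℓ²(ι)`, i.e. `J_τ` applied in each
coordinate. -/
def ampJ (ι : Type w) : τ.Amp ι →L⋆[ℂ] τ.Amp ι :=
  LinearMap.mkContinuous
    { toFun := fun f => ⟨fun i => τ.J (f i), (lp.memℓp f).norm.mono
        (fun i => by simpa using τ.norm_J_le (f i)) |>.of_norm⟩
      map_add' := fun f g => by ext i; exact map_add τ.J (f i) (g i)
      map_smul' := fun c f => by ext i; exact map_smulₛₗ τ.J c (f i) }
    1 fun f => by
      rw [one_mul]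
      exact lp.norm_mono (by simp) fun i => τ.norm_J_le (f i)

open Classical in
/-- The isometry `ξ ↦ ξ ⊗ δᵢ` from `L²(N,τ)` to `L²(N,τ) ⊗ ℓ²(ι)`. -/
def coordEmb (i : ι) : τ.L2 →L[ℂ] τ.Amp ι :=
  lp.singleContinuousLinearMap ℂ (fun _ : ι => τ.L2) 2 i

/-- The matrix entry `T_{ij}`, an operator on `L²(N,τ)`, of an operator `T` on
`L²(N,τ) ⊗ ℓ²(ι)`. -/
def matrixEntry (T : τ.Amp ι →L[ℂ] τ.Amp ι) (i j : ι) : τ.L2 →L[ℂ] τ.L2 :=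
  (ContinuousLinearMap.adjoint (τ.coordEmb i)).comp (T.comp (τ.coordEmb j))

/-- `T` belongs to `N ⊗̄ B(ℓ²(ι))`, where `N` acts on `L²(N,τ)` by `π_τ`: all its matrix entries lie
in `π_τ(N)`. -/
def MemTensor (T : τ.Amp ι →L[ℂ] τ.Amp ι) : Prop :=
  ∀ i j, τ.matrixEntry T i j ∈ Set.range τ.lmul

/-- `τ` transported to `π_τ(N)₊`: the value at `π_τ(x)`, `x ∈ N₊`, is `τ(x)`. (For faithful
semifinite `τ` such an `x` is unique. The value is `∞` off `π_τ(N₊)`.) -/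
def opTrace (T : τ.L2 →L[ℂ] τ.L2) : ℝ≥0∞ :=
  ⨅ (x : Elem N) (_ : 0 ≤ x) (_ : τ.lmul x = T), τ x

/-- `(τ ⊗ Tr)(T) = ∑ᵢ τ(Tᵢᵢ)` for positive `T` in `N ⊗̄ B(ℓ²(ι))`. -/
def tensorTrace (T : τ.Amp ι →L[ℂ] τ.Amp ι) : ℝ≥0∞ :=
  ∑' i, τ.opTrace (τ.matrixEntry T i i)

end TracialWeight

/-! ### Modules and their dimension -/

variable {H : Type u} [NormedAddCommGroup H] [InnerProductSpace ℂ H] [CompleteSpace H]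

/-- A unital `*`-homomorphism `π : N → B(H)` is normal if `π(sup D) = sup π(D)` for every bounded
upward directed family `D` in `N₊`. -/
def IsNormalRep (π : Elem N →⋆ₐ[ℂ] (H →L[ℂ] H)) : Prop :=
  ∀ D : Set (Elem N), (∀ d ∈ D, 0 ≤ d) → D.Nonempty → DirectedOn (· ≤ ·) D →
    ∀ x : Elem N, IsLUB D x → IsLUB (π '' D) (π x)

namespace TracialWeight

variable (τ : TracialWeight N) {ι : Type w}

/-- An isometry `v : H → L²(N,τ) ⊗ ℓ²(ι)` is a standard intertwiner for `(H,π)` if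
`v π(x) = (x ⊗ 1) v` for all `x ∈ N`. -/
def IsStandardIntertwiner (π : Elem N →⋆ₐ[ℂ] (H →L[ℂ] H)) (v : H →ₗᵢ[ℂ] τ.Amp ι) : Prop :=
  ∀ x : Elem N, v.toContinuousLinearMap.comp (π x) =
    (τ.amplify ι (τ.lmul x)).comp v.toContinuousLinearMap

/-- The operator `(J_τ ⊗ 1) v v* (J_τ ⊗ 1)`. -/
def conjRangeProj (v : H →ₗᵢ[ℂ] τ.Amp ι) : τ.Amp ι →L[ℂ] τ.Amp ι :=
  (τ.ampJ ι).comp ((v.toContinuousLinearMap.comp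
    (ContinuousLinearMap.adjoint v.toContinuousLinearMap)).comp (τ.ampJ ι))

/-- The Murray--von Neumann dimension `dim_{(N,τ)}(H,π) = (τ ⊗ Tr)[(J_τ ⊗ 1) v v* (J_τ ⊗ 1)]`, for
any standard intertwiner `v`. The value does not depend on `v`, which is why it may be written
as an infimum over all `v`. -/
def dim (π : Elem N →⋆ₐ[ℂ] (H →L[ℂ] H)) : ℝ≥0∞ :=
  ⨅ (ι : Type u) (v : H →ₗᵢ[ℂ] τ.Amp ι) (_ : τ.IsStandardIntertwiner π v),
    τ.tensorTrace (τ.conjRangeProj v)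

end TracialWeight

end Weights

/-! ### Corners -/

section Corners

/-- The orthogonal projections in `B(H)`. -/
abbrev StarProj (H : Type u) [NormedAddCommGroup H] [InnerProductSpace ℂ H] [CompleteSpace H] :
    Type u := {e : H →L[ℂ] H // IsStarProjection e}

variable {H : Type u} [NormedAddCommGroup H] [InnerProductSpace ℂ H] [CompleteSpace H]

namespace StarProj

variable (e : StarProj H)

/-- The closed subspace `eH`. -/
def space : Submodule ℂ H := LinearMap.range (e.1 : H →ₗ[ℂ] H)

theorem mem_space_iff {ξ : H} : ξ ∈ e.space ↔ e.1 ξ = ξ := by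
  constructor
  · rintro ⟨η, rfl⟩
    exact congrArg (fun T : H →L[ℂ] H => T η) e.2.isIdempotentElem
  · intro h
    exact ⟨ξ, h⟩

instance : CompleteSpace e.space := by
  have : IsClosed (e.space : Set H) := by
    have h : (e.space : Set H) = {ξ | e.1 ξ = ξ} := Set.ext fun ξ => e.mem_space_iff
    rw [h]
    exact isClosed_eq (by fun_prop) continuous_id
  exact this.completeSpace_coe

/-- The inclusion `eH → H`. -/
def incl : e.space →L[ℂ] H := e.space.subtypeL

/-- The orthogonal projection `H → eH`, i.e. the adjoint of the inclusion. -/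
def proj : H →L[ℂ] e.space := ContinuousLinearMap.adjoint e.incl

theorem proj_apply (ξ : H) : (e.proj ξ : H) = e.1 ξ := by
  have h : e.proj ξ = ⟨e.1 ξ, ⟨ξ, rfl⟩⟩ := by
    refine ext_inner_left ℂ fun η => ?_
    rw [proj, ContinuousLinearMap.adjoint_inner_right, Submodule.coe_inner]
    change inner ℂ (η : H) ξ = inner ℂ (η : H) (e.1 ξ)
    have hη : e.1 η = η := e.mem_space_iff.1 η.2
    have hs := ContinuousLinearMap.adjoint_inner_right e.1 (η : H) ξ
    rw [← ContinuousLinearMap.star_eq_adjoint, e.2.isSelfAdjoint.star_eq, hη] at hs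
    exact hs.symm
  rw [h]

theorem incl_proj : e.incl ∘L e.proj = e.1 := by
  ext ξ; exact e.proj_apply ξ

theorem proj_incl : e.proj ∘L e.incl = 1 := by
  ext ξ
  change (e.proj (ξ : H) : H) = ξ
  rw [proj_apply]; exact e.mem_space_iff.1 ξ.2

theorem proj_incl_apply (ξ : e.space) : e.proj (e.incl ξ) = ξ :=
  congrArg (fun T : e.space →L[ℂ] e.space => T ξ) e.proj_incl

theorem incl_proj_apply (ξ : H) : e.incl (e.proj ξ) = e.1 ξ := e.proj_apply ξ

/-- The extension of an operator on `eH` to `H` by `0` on the orthogonal complement of `eH`;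
this identifies `B(eH)` with `e B(H) e`. -/
def extend (y : e.space →L[ℂ] e.space) : H →L[ℂ] H := e.incl ∘L y ∘L e.proj

/-- The compression of an operator on `H` to `eH`. -/
def compress (x : H →L[ℂ] H) : e.space →L[ℂ] e.space := e.proj ∘L x ∘L e.incl

theorem extend_add (y z : e.space →L[ℂ] e.space) :
    e.extend (y + z) = e.extend y + e.extend z := by
  ext; simp [extend]

theorem extend_smul (c : ℂ) (y : e.space →L[ℂ] e.space) :
    e.extend (c • y) = c • e.extend y := by
  ext; simp [extend]

theorem extend_mul (y z : e.space →L[ℂ] e.space) :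
    e.extend (y * z) = e.extend y * e.extend z := by
  ext; simp [extend, proj_incl_apply]

theorem extend_one : e.extend 1 = e.1 := e.incl_proj

theorem extend_star (y : e.space →L[ℂ] e.space) : e.extend (star y) = star (e.extend y) := by
  simp only [extend, proj, ContinuousLinearMap.star_eq_adjoint, ContinuousLinearMap.adjoint_comp,
    ContinuousLinearMap.adjoint_adjoint, ContinuousLinearMap.comp_assoc]

theorem extend_nonneg {y : e.space →L[ℂ] e.space} (hy : 0 ≤ y) : 0 ≤ e.extend y := by
  rw [ContinuousLinearMap.nonneg_iff_isPositive] at hy ⊢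
  exact hy.conj_adjoint e.incl

theorem mul_extend (y : e.space →L[ℂ] e.space) : e.1 * e.extend y = e.extend y := by
  rw [← e.extend_one, ← e.extend_mul, one_mul]

theorem extend_mul' (y : e.space →L[ℂ] e.space) : e.extend y * e.1 = e.extend y := by
  rw [← e.extend_one, ← e.extend_mul, mul_one]

end StarProj

variable {H₀ : Type u₀} [NormedAddCommGroup H₀] [InnerProductSpace ℂ H₀] [CompleteSpace H₀]

/-- The projections of `N`. -/
abbrev Proj (N : VonNeumannAlgebra H₀) : Type u₀ := {p : Elem N // IsStarProjection p}

variable {N : VonNeumannAlgebra H₀}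

/-- A projection of `N ⊆ B(H₀)`, as a projection of `B(H₀)`. -/
def Proj.op (p : Proj N) : StarProj H₀ :=
  ⟨p.1.1, ⟨congrArg Subtype.val p.2.isIdempotentElem, congrArg Subtype.val p.2.isSelfAdjoint⟩⟩

theorem Proj.op_mem (p : Proj N) : p.op.1 ∈ N := p.1.2

/-- The image of a projection of `N` under a representation. -/
def Proj.map (p : Proj N) (π : Elem N →⋆ₐ[ℂ] (H →L[ℂ] H)) : StarProj H :=
  ⟨π p.1, ⟨by rw [IsIdempotentElem, ← map_mul, p.2.isIdempotentElem],
    by rw [IsSelfAdjoint, ← map_star, p.2.isSelfAdjoint.star_eq]⟩⟩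

/-- The corner `pNp` as a von Neumann algebra on `pH₀`: those operators on `pH₀` whose extension
by zero belongs to `N`. -/
def corner (p : Proj N) : VonNeumannAlgebra p.op.space where
  carrier := {y | p.op.extend y ∈ N}
  mul_mem' {y z} hy hz := by
    simp only [Set.mem_ofPred_eq, p.op.extend_mul] at *
    exact mul_mem hy hz
  one_mem' := by
    simp only [Set.mem_ofPred_eq, p.op.extend_one]
    exact p.op_mem
  add_mem' {y z} hy hz := by
    simp only [Set.mem_ofPred_eq, p.op.extend_add] at *
    exact add_mem hy hz
  zero_mem' := by
    have : p.op.extend 0 = 0 := by ext; simp [StarProj.extend]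
    simp only [Set.mem_ofPred_eq, this]
    exact zero_mem N
  algebraMap_mem' c := by
    simp only [Set.mem_ofPred_eq, Algebra.algebraMap_eq_smul_one, p.op.extend_smul, p.op.extend_one]
    exact N.toStarSubalgebra.smul_mem p.op_mem c
  star_mem' {y} hy := by
    simp only [Set.mem_ofPred_eq, p.op.extend_star] at *
    exact star_mem hy
  centralizer_centralizer' := by
    refine Set.Subset.antisymm ?_ Set.subset_centralizer_centralizer
    intro y hy
    change p.op.extend y ∈ (N : Set (H₀ →L[ℂ] H₀))
    rw [← N.centralizer_centralizer]
    intro t ht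
    have hp : p.op.1 * t = t * p.op.1 := ht _ p.op_mem
    have hc : p.op.compress t ∈ Set.centralizer {y | p.op.extend y ∈ N} := by
      intro z hz
      have h := ht _ hz
      ext ξ
      have h' := congrArg (fun T : H₀ →L[ℂ] H₀ => p.op.proj (T (p.op.incl ξ))) h
      simp only [StarProj.extend, mul_apply_eq_comp, ContinuousLinearMap.comp_apply,
        StarProj.proj_incl_apply] at h'
      simp only [StarProj.compress, mul_apply_eq_comp, ContinuousLinearMap.comp_apply]
      rw [h']
    have hyt := hy _ hc
    have hp' : ∀ ξ, p.op.1 (t ξ) = t (p.op.1 ξ) := fun ξ =>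
      congrArg (fun T : H₀ →L[ℂ] H₀ => T ξ) hp
    have hpj : ∀ ξ, p.op.proj (p.op.1 ξ) = p.op.proj ξ := fun ξ => by
      rw [← p.op.incl_proj_apply, p.op.proj_incl_apply]
    ext ξ
    have h' := congrArg (fun T => p.op.incl (T (p.op.proj ξ))) hyt
    simp only [StarProj.compress, mul_apply_eq_comp, ContinuousLinearMap.comp_apply,
      StarProj.incl_proj_apply] at h'
    simp only [StarProj.extend, mul_apply_eq_comp, ContinuousLinearMap.comp_apply]
    rw [hp', ← p.op.incl_proj_apply, p.op.proj_incl_apply, ← hp', hpj] at h'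
    exact h'

/-- The inclusion `pNp ⊆ N`. -/
def cornerIncl (p : Proj N) (y : Elem (corner p)) : Elem N := ⟨p.op.extend y.1, y.2⟩

theorem cornerIncl_add (p : Proj N) (y z : Elem (corner p)) :
    cornerIncl p (y + z) = cornerIncl p y + cornerIncl p z := Subtype.ext (p.op.extend_add _ _)

theorem cornerIncl_smul (p : Proj N) (c : ℂ) (y : Elem (corner p)) :
    cornerIncl p (c • y) = c • cornerIncl p y := Subtype.ext (p.op.extend_smul _ _)

theorem cornerIncl_mul (p : Proj N) (y z : Elem (corner p)) :
    cornerIncl p (y * z) = cornerIncl p y * cornerIncl p z := Subtype.ext (p.op.extend_mul _ _)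

theorem cornerIncl_star (p : Proj N) (y : Elem (corner p)) :
    cornerIncl p (star y) = star (cornerIncl p y) := Subtype.ext (p.op.extend_star _)

theorem cornerIncl_one (p : Proj N) : cornerIncl p 1 = p.1 := Subtype.ext p.op.extend_one

theorem cornerIncl_nonneg (p : Proj N) {y : Elem (corner p)} (hy : 0 ≤ y) :
    0 ≤ cornerIncl p y := p.op.extend_nonneg hy

/-- The normalized trace `τ_p = τ(p)⁻¹ τ(p · p)` on `pNp`. -/
def TracialWeight.cornerWeight (τ : TracialWeight N) (p : Proj N) : TracialWeight (corner p) where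
  toFun y := (τ p.1)⁻¹ * τ (cornerIncl p y)
  add_of_nonneg y z hy hz := by
    rw [cornerIncl_add, τ.add_of_nonneg _ _ (cornerIncl_nonneg p hy) (cornerIncl_nonneg p hz), mul_add]
  smul_of_nonneg c y hy := by
    rw [cornerIncl_smul, τ.smul_of_nonneg _ _ (cornerIncl_nonneg p hy), mul_left_comm]
  tracial y := by
    rw [cornerIncl_mul, cornerIncl_mul, cornerIncl_star, τ.tracial]

/-- The representation of `pNp` on `π(p)H` obtained by restricting `π`. -/
def cornerRep (π : Elem N →⋆ₐ[ℂ] (H →L[ℂ] H)) (p : Proj N) :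
    Elem (corner p) →⋆ₐ[ℂ] ((p.map π).space →L[ℂ] (p.map π).space) where
  toFun y := (p.map π).compress (π (cornerIncl p y))
  map_one' := by
    rw [cornerIncl_one]
    ext ξ
    change ((p.map π).proj ((p.map π).1 ξ) : H) = ξ
    rw [StarProj.proj_apply, (p.map π).mem_space_iff.1 ξ.2, (p.map π).mem_space_iff.1 ξ.2]
  map_mul' y z := by
    have h : cornerIncl p z = p.1 * cornerIncl p z := by
      rw [← cornerIncl_one, ← cornerIncl_mul, one_mul]
    have h' : cornerIncl p y * p.1 = cornerIncl p y := by
      rw [← cornerIncl_one, ← cornerIncl_mul, mul_one]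
    rw [cornerIncl_mul, map_mul]
    ext ξ
    simp only [StarProj.compress, mul_apply_eq_comp, ContinuousLinearMap.comp_apply,
      StarProj.incl_proj_apply]
    conv_lhs => rw [← h', map_mul]
    rfl
  map_zero' := by
    have h : cornerIncl p 0 = 0 := by simpa using cornerIncl_smul p 0 0
    rw [h, map_zero]
    ext; simp [StarProj.compress]
  map_add' y z := by
    rw [cornerIncl_add, map_add]
    ext; simp [StarProj.compress]
  commutes' c := by
    rw [Algebra.algebraMap_eq_smul_one, cornerIncl_smul, cornerIncl_one, map_smul]
    ext ξ
    change ((p.map π).proj (c • (p.map π).1 ξ) : H) = c • (ξ : H)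
    rw [StarProj.proj_apply, (p.map π).mem_space_iff.1 ξ.2, map_smul,
      (p.map π).mem_space_iff.1 ξ.2]
  map_star' y := by
    rw [cornerIncl_star, map_star]
    simp only [StarProj.compress, StarProj.proj, ContinuousLinearMap.star_eq_adjoint,
      ContinuousLinearMap.adjoint_comp, ContinuousLinearMap.adjoint_adjoint,
      ContinuousLinearMap.comp_assoc]

/-- Petersen's dimension
`dim'_{(N,τ)}(H,π) = sup {τ(p) dim_{(pNp,τ_p)}(π(p)H, π|_{pNp}) : p ∈ N a projection, τ(p) < ∞}`. -/
def TracialWeight.petersenDim (τ : TracialWeight N) (π : Elem N →⋆ₐ[ℂ] (H →L[ℂ] H)) : ℝ≥0∞ :=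
  ⨆ (p : Proj N) (_ : τ p.1 < ∞), τ p.1 * (τ.cornerWeight p).dim (cornerRep π p)

end Corners

end VNDim

end

noncomputable section

set_option linter.unusedSectionVars false

open Filter Topology

namespace VNDim

/-! ### Quadratic forms and suprema of directed families of operators -/

section QuadraticForms

variable {H : Type u} [NormedAddCommGroup H] [InnerProductSpace ℂ H] [CompleteSpace H]

/-! A standard intertwiner is the same thing as a family of intertwiners v_i : H → L²(N,τ) with ∑
v_i* v_i = 1, its coordinates (`isStandardIntertwiner_iff`, `isFrame_coord`,
`exists_isometry_of_isFrame`). With τ'(T) = τ(JTJ) on the positive part of the commutant of the left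
multiplications (`comTrace`), the dimension becomes ∑ τ'(v_i v_i*), and the whole argument is about
such frames.

Frames exist because a faithful normal representation locally dominates every vector functional of a
normal one (`exists_local_domination`). Domination produces non-zero intertwiners, polar
decomposition turns them into partial isometries, and Zorn's lemma exhausts H by their initial
spaces (`exists_frame`). The trace τ' is computed in N thanks to the commutation theorem: operators
commuting with the left multiplications commute with those commuting with the right ones
(`CommR.comp_comm`), and the left multiplications form their own bicommutant
(`IsFNS.exists_lmul_eq`). So JTJ is a left multiplication, and traciality, additivity and normality
pass from τ to τ'.

The engine is the exchange identity `IsFNS.tsum_comTrace_eq`. If ∑ c_i* c_i = Z, evaluating ∑_{i,j}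
τ'(v_j c_i* c_i v_j*) in both orders gives ∑_i τ'(c_i c_i*) = ∑_j τ'(v_j Z v_j*). For Z = 1 this is
independence of the intertwiner.

For a projection p of finite non-zero trace, a frame (b_i) of π(p)H over pNp lifts to intertwiners
c_i on H with τ'(c_i c_i*) = τ(p) τ_p'(b_i b_i*) and ∑ c_i* c_i = z_p, the projection onto
[π(N)π(p)H] (`exists_lift`, `hasSum_norm_sq_cyclicProj`). Hence the term of Petersen's supremum at p
is ∑_j τ'(v_j z_p v_j*) (`IsFNS.mul_dim_cornerRep`). It is at most the dimension because z_p ≤ 1.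
Semifiniteness provides an increasing net of such p with supremum 1 (`IsFNS.exists_monotone_proj`);
since π(p) ≤ z_p ≤ 1, the z_p increase to 1, and normality of τ' shows that the supremum is attained
in the limit. -/

/-- The real quadratic form `T ↦ Re ⟨Tξ, ξ⟩` as a real linear functional of the operator `T`. -/
def qf (ξ : H) : (H →L[ℂ] H) →ₗ[ℝ] ℝ where
  toFun T := (inner ℂ (T ξ) ξ).re
  map_add' S T := by simp
  map_smul' c T := by simp [inner_smul_left_eq_smul]

theorem qf_apply (ξ : H) (T : H →L[ℂ] H) : qf ξ T = (inner ℂ (T ξ) ξ).re := rfl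

theorem qf_nonneg {T : H →L[ℂ] H} (hT : 0 ≤ T) (ξ : H) : 0 ≤ qf ξ T :=
  ((ContinuousLinearMap.nonneg_iff_isPositive T).1 hT).re_inner_nonneg_left ξ

theorem qf_mono {S T : H →L[ℂ] H} (h : S ≤ T) (ξ : H) : qf ξ S ≤ qf ξ T := by
  have := qf_nonneg (sub_nonneg.2 h) ξ
  rw [map_sub] at this
  linarith

theorem qf_one (ξ : H) : qf ξ 1 = ‖ξ‖ ^ 2 := by
  simp [qf_apply, ← inner_self_eq_norm_sq (𝕜 := ℂ)]

theorem qf_star_mul_self (ξ : H) (T : H →L[ℂ] H) : qf ξ (star T * T) = ‖T ξ‖ ^ 2 := by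
  rw [qf_apply, ContinuousLinearMap.star_eq_adjoint, mul_apply_eq_comp,
    ContinuousLinearMap.adjoint_inner_left, ← inner_self_eq_norm_sq (𝕜 := ℂ)]
  rfl

theorem nonneg_of_qf_nonneg {T : H →L[ℂ] H} (hT : IsSelfAdjoint T) (h : ∀ ξ, 0 ≤ qf ξ T) :
    0 ≤ T := by
  rw [ContinuousLinearMap.nonneg_iff_isPositive]
  exact ⟨hT.isSymmetric, h⟩

theorem le_of_qf_le {S T : H →L[ℂ] H} (hS : IsSelfAdjoint S) (hT : IsSelfAdjoint T)
    (h : ∀ ξ, qf ξ S ≤ qf ξ T) : S ≤ T := by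
  rw [← sub_nonneg]
  exact nonneg_of_qf_nonneg (hT.sub hS) fun ξ => by rw [map_sub]; linarith [h ξ]

theorem eq_of_qf_eq {S T : H →L[ℂ] H} (hS : IsSelfAdjoint S) (hT : IsSelfAdjoint T)
    (h : ∀ ξ, qf ξ S = qf ξ T) : S = T :=
  le_antisymm (le_of_qf_le hS hT fun ξ => (h ξ).le) (le_of_qf_le hT hS fun ξ => (h ξ).ge)

/-- Writing T = B*B, the vector Tξ = B*(Bξ) has norm at most ‖B‖‖Bξ‖. This estimate upgrades
convergence of quadratic forms to strong convergence. -/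
theorem norm_sq_apply_le {T : H →L[ℂ] H} (hT : 0 ≤ T) (ξ : H) :
    ‖T ξ‖ ^ 2 ≤ ‖T‖ * qf ξ T := by
  obtain ⟨B, hB⟩ := CStarAlgebra.nonneg_iff_eq_star_mul_self.1 hT
  have h1 : T ξ = star B (B ξ) := by rw [hB]; rfl
  rw [hB, CStarRing.norm_star_mul_self, qf_star_mul_self, ← hB, h1, ← sq, ← mul_pow]
  gcongr
  simpa using (star B).le_opNorm (B ξ)

theorem norm_sub_le_of_mem_Icc {S T U : H →L[ℂ] H} (hS : 0 ≤ S) (hST : S ≤ T) (hTU : T ≤ U) :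
    ‖T - S‖ ≤ ‖U‖ := by
  apply CStarAlgebra.norm_le_norm_of_nonneg_of_le (sub_nonneg.2 hST)
  exact (sub_le_self _ hS).trans hTU

theorem isLUB_of_isLUB_qf {D : Set (H →L[ℂ] H)} (hD : ∀ d ∈ D, 0 ≤ d) (hne : D.Nonempty)
    {x : H →L[ℂ] H} (hx : 0 ≤ x) (h : ∀ ξ, IsLUB (qf ξ '' D) (qf ξ x)) : IsLUB D x := by
  constructor
  · intro d hd
    exact le_of_qf_le (hD d hd).isSelfAdjoint hx.isSelfAdjoint fun ξ => (h ξ).1 ⟨d, hd, rfl⟩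
  · intro u hu
    obtain ⟨d, hd⟩ := hne
    refine le_of_qf_le hx.isSelfAdjoint ((hD d hd).trans (hu hd)).isSelfAdjoint fun ξ => ?_
    refine (h ξ).2 ?_
    rintro _ ⟨e, he, rfl⟩
    exact qf_mono (hu he) ξ

/-- A bounded upward directed family of positive operators converges strongly. -/
theorem exists_strong_limit {D : Set (H →L[ℂ] H)} (hD : ∀ d ∈ D, 0 ≤ d) (hne : D.Nonempty)
    (hdir : DirectedOn (· ≤ ·) D) {u : H →L[ℂ] H} (hu : ∀ d ∈ D, d ≤ u) :
    ∃ x : H →L[ℂ] H, 0 ≤ x ∧ (∀ ξ, IsLUB (qf ξ '' D) (qf ξ x)) ∧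
      ∀ ξ, Tendsto (fun d : D => d.1 ξ) atTop (𝓝 (x ξ)) := by
  have : Nonempty D := hne.to_subtype
  have : IsDirectedOrder D := ⟨fun a b => by
    obtain ⟨c, hc, h1, h2⟩ := hdir a.1 a.2 b.1 b.2
    exact ⟨⟨c, hc⟩, h1, h2⟩⟩
  have hnorm : ∀ d ∈ D, ‖d‖ ≤ ‖u‖ := fun d hd =>
    CStarAlgebra.norm_le_norm_of_nonneg_of_le (hD d hd) (hu d hd)
  have hbdd : ∀ ξ, BddAbove (qf ξ '' D) := fun ξ => ⟨qf ξ u, by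
    rintro _ ⟨d, hd, rfl⟩; exact qf_mono (hu d hd) ξ⟩
  have hcauchy : ∀ ξ, Cauchy (map (fun d : D => d.1 ξ) atTop) := by
    intro ξ
    rw [Metric.cauchy_iff]
    refine ⟨inferInstance, fun ε hε => ?_⟩
    have hlub := isLUB_csSup (hne.image (qf ξ)) (hbdd ξ)
    set s := sSup (qf ξ '' D)
    -- The tolerance is chosen so that `norm_sq_apply_le`, together with ‖d - d₀‖ ≤ ‖u‖, yields ‖(d
    -- - d₀)ξ‖ < ε/2. The `+ 1` covers u = 0.
    have hδ : 0 < (ε / 2) ^ 2 / (‖u‖ + 1) := by positivity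
    obtain ⟨_, ⟨d₀, hd₀, rfl⟩, hlt⟩ :=
      (lt_isLUB_iff hlub).1 (show s - (ε / 2) ^ 2 / (‖u‖ + 1) < s by linarith)
    have key : ∀ d : D, d₀ ≤ d.1 → ‖d.1 ξ - d₀ ξ‖ < ε / 2 := by
      intro d hd
      have h1 := norm_sq_apply_le (sub_nonneg.2 hd) ξ
      have h2 := norm_sub_le_of_mem_Icc (hD d₀ hd₀) hd (hu _ d.2)
      have h3 : qf ξ d.1 ≤ s := hlub.1 ⟨_, d.2, rfl⟩
      have h4 : qf ξ (d.1 - d₀) < (ε / 2) ^ 2 / (‖u‖ + 1) := by rw [map_sub]; linarith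
      have h5 : ‖d.1 - d₀‖ * qf ξ (d.1 - d₀) < (ε / 2) ^ 2 := by
        calc ‖d.1 - d₀‖ * qf ξ (d.1 - d₀) ≤ ‖u‖ * qf ξ (d.1 - d₀) := by
              gcongr; exact qf_nonneg (sub_nonneg.2 hd) ξ
          _ ≤ (‖u‖ + 1) * qf ξ (d.1 - d₀) := by
              gcongr
              · exact qf_nonneg (sub_nonneg.2 hd) ξ
              · linarith
          _ < (‖u‖ + 1) * ((ε / 2) ^ 2 / (‖u‖ + 1)) := by gcongr
          _ = (ε / 2) ^ 2 := by field_simp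
      exact lt_of_pow_lt_pow_left₀ 2 (by positivity) (h1.trans_lt h5)
    refine ⟨(fun d : D => d.1 ξ) '' Set.Ici ⟨d₀, hd₀⟩, image_mem_map (Ici_mem_atTop _), ?_⟩
    rintro _ ⟨a, ha, rfl⟩ _ ⟨b, hb, rfl⟩
    have h1 := key a ha
    have h2 := key b hb
    rw [← dist_eq_norm] at h1 h2
    calc dist (a.1 ξ) (b.1 ξ) ≤ dist (a.1 ξ) (d₀ ξ) + dist (b.1 ξ) (d₀ ξ) :=
          dist_triangle_right _ _ _
      _ < ε := by linarith
  choose f hf using fun ξ => CompleteSpace.complete (hcauchy ξ)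
  have hf' : ∀ ξ, Tendsto (fun d : D => d.1 ξ) atTop (𝓝 (f ξ)) := hf
  let g : H →ₗ[ℂ] H := linearMapOfTendsto f (fun d : D => (d.1 : H →ₗ[ℂ] H))
    (tendsto_pi_nhds.2 hf')
  let x : H →L[ℂ] H := g.mkContinuous ‖u‖ fun ξ =>
    le_of_tendsto (hf' ξ).norm (Eventually.of_forall fun d =>
      (d.1.le_opNorm ξ).trans (by gcongr; exact hnorm _ d.2))
  have hx : ∀ ξ, Tendsto (fun d : D => d.1 ξ) atTop (𝓝 (x ξ)) := hf'
  have hq : ∀ ξ, Tendsto (fun d : D => qf ξ d.1) atTop (𝓝 (qf ξ x)) := fun ξ =>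
    (Complex.continuous_re.tendsto _).comp ((hx ξ).inner tendsto_const_nhds)
  have hlub : ∀ ξ, IsLUB (qf ξ '' D) (qf ξ x) := by
    intro ξ
    have := isLUB_of_tendsto_atTop (β := D) (fun a b h => qf_mono h ξ) (hq ξ)
    rwa [← Set.image_eq_range] at this
  refine ⟨x, ?_, hlub, hx⟩
  refine (ContinuousLinearMap.nonneg_iff_isPositive x).2 ⟨?_, fun ξ => ?_⟩
  · intro ξ η
    refine tendsto_nhds_unique ((hx ξ).inner tendsto_const_nhds)
      (Tendsto.congr (fun d => ?_) (tendsto_const_nhds.inner (hx η)))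
    exact ((hD _ d.2).isSelfAdjoint.isSymmetric ξ η).symm
  · exact ge_of_tendsto (hq ξ) (Eventually.of_forall fun d => qf_nonneg (hD _ d.2) ξ)

/-- The supremum of a directed family of positive operators is its weak limit. -/
theorem IsLUB.isLUB_qf {D : Set (H →L[ℂ] H)} (hD : ∀ d ∈ D, 0 ≤ d) (hne : D.Nonempty)
    (hdir : DirectedOn (· ≤ ·) D) {x : H →L[ℂ] H} (hx : IsLUB D x) (ξ : H) :
    IsLUB (qf ξ '' D) (qf ξ x) := by
  obtain ⟨y, hy, hlub, -⟩ := exists_strong_limit hD hne hdir hx.1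
  rw [hx.unique (isLUB_of_isLUB_qf hD hne hy hlub)]
  exact hlub ξ

end QuadraticForms

/-! ### Order properties of a von Neumann algebra and its normal representations -/

section Algebra

variable {H₀ : Type u₀} [NormedAddCommGroup H₀] [InnerProductSpace ℂ H₀] [CompleteSpace H₀]
  {N : VonNeumannAlgebra H₀}

/-- The bicommutant property, in the form used to recognise square roots, strong limits and
compressions as elements of N. -/
theorem mem_of_commute {y : H₀ →L[ℂ] H₀}
    (h : ∀ t : H₀ →L[ℂ] H₀, (∀ z ∈ N, z * t = t * z) → t * y = y * t) : y ∈ N := by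
  change y ∈ (N : Set (H₀ →L[ℂ] H₀))
  rw [← N.centralizer_centralizer]
  exact fun t ht => h t fun z hz => ht z hz

theorem Elem.le_def {x y : Elem N} : x ≤ y ↔ (x : H₀ →L[ℂ] H₀) ≤ y := Iff.rfl

instance : IsOrderedAddMonoid (Elem N) where
  add_le_add_left a b h c := by
    have h' : (a : H₀ →L[ℂ] H₀) ≤ b := h
    change (a : H₀ →L[ℂ] H₀) + c ≤ (b : H₀ →L[ℂ] H₀) + c
    exact add_le_add_left h' _

theorem Elem.isSelfAdjoint {x : Elem N} (hx : 0 ≤ x) : star x = x :=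
  Subtype.ext (IsSelfAdjoint.of_nonneg (show (0 : H₀ →L[ℂ] H₀) ≤ x from hx)).star_eq

/-- Positive elements of `N` have positive square roots in `N`. -/
theorem Elem.exists_sqrt {x : Elem N} (hx : 0 ≤ x) : ∃ s : Elem N, 0 ≤ s ∧ s * s = x := by
  have hx' : (0 : H₀ →L[ℂ] H₀) ≤ x := hx
  refine ⟨⟨CFC.sqrt (x : H₀ →L[ℂ] H₀), mem_of_commute fun t ht => ?_⟩, ?_, ?_⟩
  -- The square root comes from the functional calculus of x, so it commutes with whatever commutes
  -- with x.
  · exact (((Commute.cfcₙ_nnreal (show Commute (x : H₀ →L[ℂ] H₀) t from ht _ x.2)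
      NNReal.sqrt))).eq.symm
  · exact CFC.sqrt_nonneg (x : H₀ →L[ℂ] H₀)
  · exact Subtype.ext (CFC.sqrt_mul_sqrt_self _ hx')

theorem Elem.exists_eq_star_mul_self {x : Elem N} (hx : 0 ≤ x) :
    ∃ s : Elem N, x = star s * s := by
  obtain ⟨s, hs, h⟩ := Elem.exists_sqrt hx
  exact ⟨s, by rw [Elem.isSelfAdjoint hs, h]⟩

theorem conj_nonneg {x : Elem N} (hx : 0 ≤ x) (y : Elem N) : 0 ≤ star y * x * y := by
  obtain ⟨s, rfl⟩ := Elem.exists_eq_star_mul_self hx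
  have := star_mul_self_nonneg' (s * y)
  rwa [star_mul, mul_assoc, ← mul_assoc (star s), ← mul_assoc (star y)] at this

theorem conj_mono {x z : Elem N} (h : x ≤ z) (y : Elem N) :
    star y * x * y ≤ star y * z * y := by
  have := conj_nonneg (sub_nonneg' h) y
  rwa [mul_sub, sub_mul, sub_nonneg] at this

/-- A bounded directed family in `N₊` has a supremum in `N`, which is a weak limit. -/
theorem Elem.exists_isLUB {D : Set (Elem N)} (hD : ∀ d ∈ D, 0 ≤ d) (hne : D.Nonempty)
    (hdir : DirectedOn (· ≤ ·) D) {u : Elem N} (hu : ∀ d ∈ D, d ≤ u) :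
    ∃ x : Elem N, 0 ≤ x ∧ IsLUB D x ∧
      ∀ ξ, IsLUB ((fun d : Elem N => qf ξ (d : H₀ →L[ℂ] H₀)) '' D) (qf ξ (x : H₀ →L[ℂ] H₀)) := by
  have hD' : ∀ d ∈ Subtype.val '' D, (0 : H₀ →L[ℂ] H₀) ≤ d := by
    rintro _ ⟨d, hd, rfl⟩; exact hD d hd
  have hdir' : DirectedOn (· ≤ ·) (Subtype.val '' D) := by
    rintro _ ⟨a, ha, rfl⟩ _ ⟨b, hb, rfl⟩
    obtain ⟨c, hc, h1, h2⟩ := hdir a ha b hb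
    exact ⟨c, ⟨c, hc, rfl⟩, h1, h2⟩
  obtain ⟨x, hx, hq, hlim⟩ := exists_strong_limit hD' (hne.image _) hdir' (u := u.1) (by
    rintro _ ⟨d, hd, rfl⟩; exact hu d hd)
  have : Nonempty (Subtype.val '' D) := (hne.image _).to_subtype
  have : IsDirectedOrder (Subtype.val '' D) := ⟨fun a b => by
    obtain ⟨c, hc, h1, h2⟩ := hdir' a.1 a.2 b.1 b.2
    exact ⟨⟨c, hc⟩, h1, h2⟩⟩
  -- Commuting with a fixed t survives strong limits, so the limit stays in the bicommutant.
  have hxN : x ∈ N := mem_of_commute fun t ht => by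
    ext ξ
    refine tendsto_nhds_unique ((t.continuous.tendsto _).comp (hlim ξ))
      ((hlim (t ξ)).congr fun d => ?_)
    obtain ⟨d', -, hd'⟩ := d.2
    exact congrArg (fun T : H₀ →L[ℂ] H₀ => T ξ) (ht d.1 (hd' ▸ d'.2))
  have hlub := isLUB_of_isLUB_qf hD' (hne.image _) hx hq
  refine ⟨⟨x, hxN⟩, hx, ⟨fun d hd => hlub.1 ⟨d, hd, rfl⟩, fun u hu => ?_⟩, fun ξ => ?_⟩
  · refine hlub.2 ?_
    rintro _ ⟨d, hd, rfl⟩; exact hu hd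
  · have := hq ξ
    rwa [Set.image_image] at this

theorem Elem.isLUB_qf {D : Set (Elem N)} (hD : ∀ d ∈ D, 0 ≤ d) (hne : D.Nonempty)
    (hdir : DirectedOn (· ≤ ·) D) {x : Elem N} (hx : IsLUB D x) (ξ : H₀) :
    IsLUB ((fun d : Elem N => qf ξ (d : H₀ →L[ℂ] H₀)) '' D) (qf ξ (x : H₀ →L[ℂ] H₀)) := by
  obtain ⟨y, -, hy, h⟩ := Elem.exists_isLUB hD hne hdir hx.1
  rw [hx.unique hy]; exact h ξ

theorem Elem.isLUB_of_isLUB_qf {D : Set (Elem N)} (hD : ∀ d ∈ D, 0 ≤ d) (hne : D.Nonempty)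
    {x : Elem N} (hx : 0 ≤ x)
    (h : ∀ ξ, IsLUB ((fun d : Elem N => qf ξ (d : H₀ →L[ℂ] H₀)) '' D)
      (qf ξ (x : H₀ →L[ℂ] H₀))) : IsLUB D x := by
  have hlub := VNDim.isLUB_of_isLUB_qf (D := Subtype.val '' D) (x := x.1)
    (by rintro _ ⟨d, hd, rfl⟩; exact hD d hd) (hne.image _) hx
    (fun ξ => by rw [Set.image_image]; exact h ξ)
  exact ⟨fun d hd => hlub.1 ⟨d, hd, rfl⟩, fun u hu => hlub.2 (by
    rintro _ ⟨d, hd, rfl⟩; exact hu hd)⟩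

variable {H : Type u} [NormedAddCommGroup H] [InnerProductSpace ℂ H] [CompleteSpace H]
  {π : Elem N →⋆ₐ[ℂ] (H →L[ℂ] H)}

theorem rep_nonneg (π : Elem N →⋆ₐ[ℂ] (H →L[ℂ] H)) {x : Elem N} (hx : 0 ≤ x) : 0 ≤ π x := by
  obtain ⟨s, rfl⟩ := Elem.exists_eq_star_mul_self hx
  rw [map_mul, map_star]
  exact star_mul_self_nonneg _

theorem rep_mono (π : Elem N →⋆ₐ[ℂ] (H →L[ℂ] H)) {x y : Elem N} (h : x ≤ y) : π x ≤ π y := by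
  have := rep_nonneg π (sub_nonneg' h)
  rwa [map_sub, sub_nonneg] at this

theorem qf_rep_star_mul_self (π : Elem N →⋆ₐ[ℂ] (H →L[ℂ] H)) (ξ : H) (x : Elem N) :
    qf ξ (π (star x * x)) = ‖π x ξ‖ ^ 2 := by
  rw [map_mul, map_star, qf_star_mul_self]

/-- Normality speaks of suprema in the order of B(H). Such suprema are weak limits, so normality
becomes a statement about each vector functional separately, which is the form used later. -/
theorem IsNormalRep.isLUB_qf (hπ : IsNormalRep π) {D : Set (Elem N)} (hD : ∀ d ∈ D, 0 ≤ d)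
    (hne : D.Nonempty) (hdir : DirectedOn (· ≤ ·) D) {x : Elem N} (hx : IsLUB D x) (ξ : H) :
    IsLUB ((fun d => qf ξ (π d)) '' D) (qf ξ (π x)) := by
  have := VNDim.IsLUB.isLUB_qf (D := π '' D)
    (by rintro _ ⟨d, hd, rfl⟩; exact rep_nonneg π (hD d hd))
    (hne.image _) (by
      rintro _ ⟨a, ha, rfl⟩ _ ⟨b, hb, rfl⟩
      obtain ⟨c, hc, h1, h2⟩ := hdir a ha b hb
      exact ⟨π c, ⟨c, hc, rfl⟩, rep_mono π h1, rep_mono π h2⟩) (hπ D hD hne hdir x hx) ξ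
  rwa [Set.image_image] at this

theorem isNormalRep_of_isLUB_qf (h : ∀ D : Set (Elem N), (∀ d ∈ D, 0 ≤ d) → D.Nonempty →
    DirectedOn (· ≤ ·) D → ∀ x : Elem N, IsLUB D x → ∀ ξ : H,
      IsLUB ((fun d => qf ξ (π d)) '' D) (qf ξ (π x))) : IsNormalRep π := by
  intro D hD hne hdir x hx
  obtain ⟨d, hd⟩ := id hne
  refine isLUB_of_isLUB_qf ?_ (hne.image _) (rep_nonneg π ((hD d hd).trans (hx.1 hd)))
    fun ξ => ?_
  · rintro _ ⟨d, hd, rfl⟩; exact rep_nonneg π (hD d hd)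
  · rw [Set.image_image]; exact h D hD hne hdir x hx ξ

end Algebra

end VNDim

namespace VNDim

/-! ### Comparison of normal vector functionals -/

section Comparison

variable {H₀ : Type u₀} [NormedAddCommGroup H₀] [InnerProductSpace ℂ H₀] [CompleteSpace H₀]
  {N : VonNeumannAlgebra H₀}
  {H₁ : Type*} [NormedAddCommGroup H₁] [InnerProductSpace ℂ H₁] [CompleteSpace H₁]
  {H₂ : Type*} [NormedAddCommGroup H₂] [InnerProductSpace ℂ H₂] [CompleteSpace H₂]
  {π₁ : Elem N →⋆ₐ[ℂ] (H₁ →L[ℂ] H₁)} {π₂ : Elem N →⋆ₐ[ℂ] (H₂ →L[ℂ] H₂)}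

theorem qf_smul_vector (c : ℂ) (ξ : H₁) (T : H₁ →L[ℂ] H₁) :
    qf (c • ξ) T = ‖c‖ ^ 2 * qf ξ T := by
  rw [qf_apply, qf_apply, map_smul, inner_smul_left, inner_smul_right, ← mul_assoc,
    ← Complex.normSq_eq_conj_mul_self, Complex.re_ofReal_mul, Complex.normSq_eq_norm_sq]

theorem qf_complex_smul (c : ℝ) (ξ : H₁) (T : H₁ →L[ℂ] H₁) :
    qf ξ ((c : ℂ) • T) = c * qf ξ T := by
  simp [qf_apply]

/-- A one-sided Hahn decomposition for two positive functionals, by Zorn's lemma. Normality of π₁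
keeps the inequality valid at the supremum of a chain, since the right-hand side only grows. A
positive z below e - m violating the strict inequality could be added to m, against maximality. -/
theorem exists_maximal_dominated (h₁ : IsNormalRep π₁) (ζ : H₁) (ξ : H₂)
    {e : Elem N} (he : 0 ≤ e) :
    ∃ m : Elem N, 0 ≤ m ∧ m ≤ e ∧ qf ζ (π₁ m) ≤ qf ξ (π₂ m) ∧
      ∀ z : Elem N, 0 ≤ z → z ≤ e - m → z ≠ 0 → qf ξ (π₂ z) < qf ζ (π₁ z) := by
  obtain ⟨m, -, hm⟩ := zorn_le_nonempty₀
    {m : Elem N | 0 ≤ m ∧ m ≤ e ∧ qf ζ (π₁ m) ≤ qf ξ (π₂ m)} (by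
      intro c hc hchain y hy
      have hpos : ∀ d ∈ c, 0 ≤ d := fun d hd => (hc hd).1
      obtain ⟨x, hx, hlub, -⟩ := Elem.exists_isLUB hpos ⟨y, hy⟩ hchain.directedOn
        (fun d hd => (hc hd).2.1)
      refine ⟨x, ⟨hx, hlub.2 fun d hd => (hc hd).2.1, ?_⟩, hlub.1⟩
      refine (h₁.isLUB_qf hpos ⟨y, hy⟩ hchain.directedOn hlub ζ).2 ?_
      rintro _ ⟨d, hd, rfl⟩
      exact (hc hd).2.2.trans (qf_mono (rep_mono π₂ (hlub.1 hd)) ξ)) 0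
    ⟨le_rfl, he, by simp⟩
  refine ⟨m, hm.prop.1, hm.prop.2.1, hm.prop.2.2, fun z hz hze hz0 => ?_⟩
  by_contra! hcon
  refine hz0 (le_antisymm ?_ hz)
  have h := hm.le_of_ge (y := m + z) ⟨add_nonneg hm.prop.1 hz, ?_, ?_⟩ (le_add_of_nonneg_right hz)
  · simpa using h
  · rw [le_sub_iff_add_le] at hze
    rwa [add_comm]
  · simp only [map_add]
    exact add_le_add hm.prop.2.2 hcon

/-- A faithful normal representation locally dominates every vector functional of a normal
representation. -/
theorem exists_local_domination (h₁ : IsNormalRep π₁) (hinj : Function.Injective π₁)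
    (h₂ : IsNormalRep π₂) {ξ : H₂} (hξ : ξ ≠ 0) :
    ∃ (ζ : H₁) (p : Elem N), π₂ p ξ ≠ 0 ∧ ∀ x, ‖π₂ (x * p) ξ‖ ≤ ‖π₁ (x * p) ζ‖ := by
  have h1 : (0 : Elem N) ≤ 1 := by simpa using star_mul_self_nonneg' (1 : Elem N)
  -- Comparison with the zero functional: ω_ξ vanishes on m and is strictly positive on non-zero
  -- positive elements below 1 - m, which plays the role of the support of ω_ξ.
  obtain ⟨m, hm, hm1, hmξ, hmz⟩ := exists_maximal_dominated h₂ (π₂ := π₂) ξ 0 h1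
  have hmξ' : qf ξ (π₂ m) ≤ 0 := by simpa [qf_apply] using hmξ
  have hmz' : ∀ z : Elem N, 0 ≤ z → z ≤ 1 - m → z ≠ 0 → 0 < qf ξ (π₂ z) := fun z h h' h'' => by
    simpa [qf_apply] using hmz z h h' h''
  have he : 0 ≤ 1 - m := sub_nonneg' hm1
  have he0 : 1 - m ≠ 0 := by
    intro h
    have : m = 1 := (sub_eq_zero.1 h).symm
    rw [this, map_one, qf_one] at hmξ'
    have : 0 < ‖ξ‖ ^ 2 := by positivity
    linarith
  obtain ⟨ζ₀, hζ₀⟩ : ∃ ζ₀, 0 < qf ζ₀ (π₁ (1 - m)) := by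
    by_contra! hcon
    refine he0 (hinj ?_)
    rw [map_zero]
    exact eq_of_qf_eq (rep_nonneg π₁ he).isSelfAdjoint (.zero _) fun ζ =>
      le_antisymm (by simpa using hcon ζ) (by simpa using qf_nonneg (rep_nonneg π₁ he) ζ)
  obtain ⟨ζ, hζ⟩ : ∃ ζ, qf ξ (π₂ (1 - m)) < qf ζ (π₁ (1 - m)) := by
    set a := qf ξ (π₂ (1 - m))
    set b := qf ζ₀ (π₁ (1 - m))
    have ha : 0 ≤ a := qf_nonneg (rep_nonneg π₂ he) ξ
    -- The rescaling makes the value of the functional at 1 - m equal to a + 1, which exceeds a.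
    refine ⟨((Real.sqrt ((a + 1) / b) : ℝ) : ℂ) • ζ₀, ?_⟩
    rw [qf_smul_vector, Complex.norm_real, Real.norm_eq_abs, sq_abs, Real.sq_sqrt (by positivity)]
    change a < (a + 1) / b * b
    rw [div_mul_cancel₀ _ hζ₀.ne']
    linarith
  -- Second decomposition, now of ω_ζ against ω_ξ below 1 - m. What remains, y, is non-zero since
  -- ω_ζ(1 - m) > ω_ξ(1 - m), and ω_ξ < ω_ζ on every non-zero positive element below y. The required
  -- p is the square root of y.
  obtain ⟨m', hm', hme, hmq, hmz2⟩ := exists_maximal_dominated h₁ (π₂ := π₂) ζ ξ he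
  set y := 1 - m - m' with hy
  have hy0 : 0 ≤ y := sub_nonneg' hme
  have hyne : y ≠ 0 := by
    intro h
    rw [hy] at h
    rw [← sub_eq_zero.1 h] at hmq
    exact absurd hmq (not_le.2 hζ)
  have hyξ : 0 < qf ξ (π₂ y) := hmz' y hy0 (sub_le_self _ hm') hyne
  obtain ⟨p, hp, hpy⟩ := Elem.exists_sqrt hy0
  have hps := Elem.isSelfAdjoint hp
  refine ⟨ζ, p, ?_, fun x => ?_⟩
  · intro h
    have hpy' : star p * p = y := by rw [hps, hpy]
    rw [← hpy', qf_rep_star_mul_self, h] at hyξ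
    simp at hyξ
  -- Since p*x*xp ≤ ‖x‖² y ≤ a y, the element a⁻¹ p*x*xp lies below y, where domination applies. The
  -- `+ 1` keeps a invertible when x = 0.
  · set a : ℝ≥0 := (‖x‖₊ + 1) ^ 2 with ha
    have ha0 : (0 : ℝ) < a := by positivity
    have hconj : star (x * p) * (x * p) ≤ ((a : ℝ) : ℂ) • y := by
      refine (conj_le x p).trans ?_
      have : ((a : ℝ) : ℂ) • y - (((‖x‖₊ ^ 2 : ℝ≥0) : ℝ) : ℂ) • (star p * p) =
          (((2 * ‖x‖₊ + 1 : ℝ≥0) : ℝ) : ℂ) • y := by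
        rw [hps, hpy, ← sub_smul, ha]; congr 1; push_cast; ring
      rw [← sub_nonneg, this]
      exact smul_nonneg' _ hy0
    set w := ((a⁻¹ : ℝ≥0) : ℝ) with hw
    set t := star (x * p) * (x * p) with ht
    have ht0 : 0 ≤ t := star_mul_self_nonneg' _
    have hle : (w : ℂ) • t ≤ y := by
      have := smul_nonneg' a⁻¹ (sub_nonneg' hconj)
      rw [smul_sub, smul_smul, sub_nonneg] at this
      refine this.trans_eq ?_
      rw [NNReal.coe_inv, ← Complex.ofReal_mul, inv_mul_cancel₀ ha0.ne']
      simp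
    have hw0 : 0 < w := by rw [hw]; positivity
    have hq : qf ξ (π₂ ((w : ℂ) • t)) ≤ qf ζ (π₁ ((w : ℂ) • t)) := by
      by_cases h0 : (w : ℂ) • t = 0
      · rw [h0]; simp
      · exact (hmz2 _ (smul_nonneg' a⁻¹ ht0) hle h0).le
    rw [map_smul π₂, map_smul π₁, qf_complex_smul, qf_complex_smul, ht, qf_rep_star_mul_self,
      qf_rep_star_mul_self] at hq
    exact (sq_le_sq₀ (norm_nonneg _) (norm_nonneg _)).1 (le_of_mul_le_mul_left hq hw0)

/-! ### Intertwiners -/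

/-- Bounded intertwiners of two representations. -/
def Intertwines (π₁ : Elem N →⋆ₐ[ℂ] (H₁ →L[ℂ] H₁)) (π₂ : Elem N →⋆ₐ[ℂ] (H₂ →L[ℂ] H₂))
    (T : H₁ →L[ℂ] H₂) : Prop := ∀ x, T.comp (π₁ x) = (π₂ x).comp T

theorem Intertwines.apply {T : H₁ →L[ℂ] H₂} (hT : Intertwines π₁ π₂ T) (x : Elem N) (ξ : H₁) :
    T (π₁ x ξ) = π₂ x (T ξ) := congrArg (fun S : H₁ →L[ℂ] H₂ => S ξ) (hT x)

theorem Intertwines.adjoint {T : H₁ →L[ℂ] H₂} (hT : Intertwines π₁ π₂ T) :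
    Intertwines π₂ π₁ (ContinuousLinearMap.adjoint T) := by
  intro x
  have h := congrArg ContinuousLinearMap.adjoint (hT (star x))
  rw [ContinuousLinearMap.adjoint_comp, ContinuousLinearMap.adjoint_comp, map_star π₁, map_star π₂,
    ContinuousLinearMap.star_eq_adjoint, ContinuousLinearMap.star_eq_adjoint,
    ContinuousLinearMap.adjoint_adjoint, ContinuousLinearMap.adjoint_adjoint] at h
  exact h.symm

theorem Intertwines.comp {H₃ : Type*} [NormedAddCommGroup H₃] [InnerProductSpace ℂ H₃]
    [CompleteSpace H₃] {π₃ : Elem N →⋆ₐ[ℂ] (H₃ →L[ℂ] H₃)} {T : H₂ →L[ℂ] H₃} {S : H₁ →L[ℂ] H₂}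
    (hT : Intertwines π₂ π₃ T) (hS : Intertwines π₁ π₂ S) : Intertwines π₁ π₃ (T.comp S) := by
  intro x
  rw [ContinuousLinearMap.comp_assoc, hS x, ← ContinuousLinearMap.comp_assoc, hT x,
    ContinuousLinearMap.comp_assoc]

theorem eq_of_eqOn_range_orthogonal {E : Type*} [AddCommGroup E] [Module ℂ E] {f : E →ₗ[ℂ] H₁}
    {S T : H₁ →L[ℂ] H₂} (h : ∀ e, S (f e) = T (f e))
    (h' : ∀ η ∈ (LinearMap.range f)ᗮ, S η = T η) : S = T := by
  ext η
  obtain ⟨a, ha, b, hb, rfl⟩ :=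
    (LinearMap.range f).topologicalClosure.exists_add_mem_mem_orthogonal η
  rw [Submodule.orthogonal_closure] at hb
  rw [map_add, map_add, h' b hb]
  congr 1
  have hcl : IsClosed {a | S a = T a} := isClosed_eq S.continuous T.continuous
  refine closure_minimal ?_ hcl ha
  rintro _ ⟨e, rfl⟩
  exact h e

/-- A densely defined contraction `f e ↦ g e` between equivariant maps extends to an intertwiner
vanishing on the orthogonal complement of the range of `f`. -/
theorem exists_intertwiner {E : Type*} [AddCommGroup E] [Module ℂ E] (f : E →ₗ[ℂ] H₁)
    (g : E →ₗ[ℂ] H₂) (hfg : ∀ e, ‖g e‖ ≤ ‖f e‖) (a : Elem N → E → E)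
    (hf : ∀ y e, f (a y e) = π₁ y (f e)) (hg : ∀ y e, g (a y e) = π₂ y (g e)) :
    ∃ T : H₁ →L[ℂ] H₂, Intertwines π₁ π₂ T ∧ (∀ e, T (f e) = g e) ∧
      (∀ η ∈ (LinearMap.range f)ᗮ, T η = 0) ∧
      ∀ η, T η ∈ (LinearMap.range g).topologicalClosure := by
  set K := (LinearMap.range f).topologicalClosure with hK
  let f' : E →ₗ[ℂ] K := f.codRestrict K fun e => subset_closure ⟨e, rfl⟩
  have hdense : DenseRange f' := by
    rw [DenseRange, Subtype.dense_iff]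
    intro x hx
    have : Subtype.val '' Set.range f' = LinearMap.range f := by
      rw [← Set.range_comp]; rfl
    exact (congrArg (x ∈ closure ·) this).mpr hx
  have hb : ∀ e, ‖g e‖ ≤ 1 * ‖f' e‖ := fun e => by rw [one_mul]; exact hfg e
  obtain ⟨T, hTdef⟩ : ∃ T : H₁ →L[ℂ] H₂, ∀ η, T η =
    g.extendOfNorm f' (K.orthogonalProjectionOnto η) :=
    ⟨(g.extendOfNorm f').comp K.orthogonalProjectionOnto, fun _ => rfl⟩
  have hTf : ∀ e, T (f e) = g e := fun e => by
    have : K.orthogonalProjectionOnto (f e) = f' e :=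
      K.orthogonalProjectionOnto_mem_subspace_eq_self (f' e)
    rw [hTdef, this, LinearMap.extendOfNorm_eq hdense ⟨1, hb⟩]
  have hT0 : ∀ η ∈ (LinearMap.range f)ᗮ, T η = 0 := fun η hη => by
    have : K.orthogonalProjectionOnto η = 0 :=
      K.orthogonalProjectionOnto_apply_of_mem_orthogonal
        (by rwa [hK, Submodule.orthogonal_closure])
    rw [hTdef, this, map_zero]
  refine ⟨T, fun y => eq_of_eqOn_range_orthogonal (f := f) (fun e => ?_) fun η hη => ?_, hTf, hT0,
    fun η => ?_⟩
  · rw [ContinuousLinearMap.comp_apply, ContinuousLinearMap.comp_apply, ← hf, hTf, hTf, hg]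
  · rw [ContinuousLinearMap.comp_apply, ContinuousLinearMap.comp_apply, hT0 η hη, map_zero]
    refine hT0 _ ?_
    -- The complement of the range is invariant because the range is invariant under the adjoint
    -- π₁(y*).
    rw [Submodule.mem_orthogonal] at hη ⊢
    rintro _ ⟨e, rfl⟩
    rw [← ContinuousLinearMap.adjoint_inner_left, ← ContinuousLinearMap.star_eq_adjoint,
      ← map_star, ← hf]
    exact hη _ ⟨_, rfl⟩
  · rw [hTdef]
    refine hdense.induction_on (p := fun k => g.extendOfNorm f' k ∈
      (LinearMap.range g).topologicalClosure) _ ?_ fun e => ?_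
    · exact (Submodule.isClosed_topologicalClosure _).preimage (g.extendOfNorm f').continuous
    · rw [LinearMap.extendOfNorm_eq hdense ⟨1, hb⟩]
      exact subset_closure ⟨e, rfl⟩

/-- Local domination says that π₁(xp)ζ ↦ π₂(xp)ξ is a contraction, hence extends to an intertwiner.
At x = 1 its value is π₂(p)ξ ≠ 0, and its range stays in M because M is closed, invariant and
contains ξ. -/
theorem exists_nonzero_intertwiner (h₁ : IsNormalRep π₁) (hinj : Function.Injective π₁)
    (h₂ : IsNormalRep π₂) {M : Submodule ℂ H₂} (hM : IsClosed (M : Set H₂))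
    (hinv : ∀ x, ∀ η ∈ M, π₂ x η ∈ M) {ξ : H₂} (hξM : ξ ∈ M) (hξ : ξ ≠ 0) :
    ∃ T : H₁ →L[ℂ] H₂, Intertwines π₁ π₂ T ∧ T ≠ 0 ∧ ∀ η, T η ∈ M := by
  obtain ⟨ζ, p, hp, hle⟩ := exists_local_domination h₁ hinj h₂ hξ
  let f : Elem N →ₗ[ℂ] H₁ :=
    { toFun := fun x => π₁ (x * p) ζ
      map_add' := fun x y => by simp [add_mul]
      map_smul' := fun c x => by simp }
  let g : Elem N →ₗ[ℂ] H₂ :=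
    { toFun := fun x => π₂ (x * p) ξ
      map_add' := fun x y => by simp [add_mul]
      map_smul' := fun c x => by simp }
  obtain ⟨T, hT, hTf, -, hTg⟩ := exists_intertwiner (π₁ := π₁) (π₂ := π₂) f g hle (fun y x => y * x)
    (fun y x => by simp [f]) (fun y x => by simp [g])
  refine ⟨T, hT, ?_, fun η => ?_⟩
  · rintro rfl
    refine hp ?_
    have := hTf 1
    simpa [g] using this.symm
  · refine (Submodule.topologicalClosure_minimal _ ?_ hM) (hTg η)
    rintro _ ⟨x, rfl⟩
    exact hinv _ _ hξM

/-! ### Frames of intertwiners -/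

/-- A Parseval frame of operators: `∑ᵢ uᵢ* uᵢ = 1` strongly. -/
def IsFrame {ι : Type*} (u : ι → H₁ →L[ℂ] H₂) : Prop :=
  ∀ ξ, HasSum (fun i => ‖u i ξ‖ ^ 2) (‖ξ‖ ^ 2)

/-- `K` is the initial space of a partial isometry intertwining `π₂` and `π₁`. -/
def IsInitialSpace (π₂ : Elem N →⋆ₐ[ℂ] (H₂ →L[ℂ] H₂)) (π₁ : Elem N →⋆ₐ[ℂ] (H₁ →L[ℂ] H₁))
    (K : Submodule ℂ H₂) (u : H₂ →L[ℂ] H₁) : Prop :=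
  Intertwines π₂ π₁ u ∧ (∀ ξ ∈ K, ‖u ξ‖ = ‖ξ‖) ∧ (∀ ξ ∈ Kᗮ, u ξ = 0) ∧ K ≠ ⊥ ∧
    IsClosed (K : Set H₂)

/-- Polar decomposition of an intertwiner T with range in M. Since h = (T*T)^{1/2} satisfies ‖hη‖ =
‖Tη‖, the map Tη ↦ hη extends to a partial isometry with initial space the closure of the range of
T. It intertwines because h commutes with π₁(N), as T*T does. -/
theorem exists_isInitialSpace (h₁ : IsNormalRep π₁) (hinj : Function.Injective π₁)
    (h₂ : IsNormalRep π₂) {M : Submodule ℂ H₂} (hM : IsClosed (M : Set H₂))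
    (hinv : ∀ x, ∀ η ∈ M, π₂ x η ∈ M) {ξ : H₂} (hξM : ξ ∈ M) (hξ : ξ ≠ 0) :
    ∃ K ≤ M, ∃ u, IsInitialSpace π₂ π₁ K u := by
  obtain ⟨T, hT, hT0, hTM⟩ := exists_nonzero_intertwiner h₁ hinj h₂ hM hinv hξM hξ
  set B : H₁ →L[ℂ] H₁ := (ContinuousLinearMap.adjoint T).comp T with hB
  have hBint : Intertwines π₁ π₁ B := hT.adjoint.comp hT
  have hBq : ∀ η, qf η B = ‖T η‖ ^ 2 := fun η => by
    rw [qf_apply, hB, ContinuousLinearMap.comp_apply, ContinuousLinearMap.adjoint_inner_left,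
      ← inner_self_eq_norm_sq (𝕜 := ℂ)]
    rfl
  have hB0 : 0 ≤ B := by
    refine nonneg_of_qf_nonneg ?_ fun η => by rw [hBq]; positivity
    rw [IsSelfAdjoint, hB, ContinuousLinearMap.star_eq_adjoint, ContinuousLinearMap.adjoint_comp,
      ContinuousLinearMap.adjoint_adjoint]
  set h := CFC.sqrt B with hh
  have hhint : Intertwines π₁ π₁ h := fun x =>
    (Commute.cfcₙ_nnreal (show Commute B (π₁ x) from hBint x) NNReal.sqrt).eq
  have hhn : ∀ η, ‖h η‖ = ‖T η‖ := fun η => by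
    have hs : star h * h = B := by
      rw [(IsSelfAdjoint.of_nonneg (CFC.sqrt_nonneg B)).star_eq]
      exact CFC.sqrt_mul_sqrt_self B hB0
    rw [← sq_eq_sq₀ (norm_nonneg _) (norm_nonneg _), ← hBq, ← hs, qf_star_mul_self]
  obtain ⟨u, hu, huT, hu0, -⟩ := exists_intertwiner (π₁ := π₂) (π₂ := π₁) (T : H₁ →ₗ[ℂ] H₂)
    (h : H₁ →ₗ[ℂ] H₁) (fun η => (hhn η).le) (fun y η => π₁ y η) (fun y η => hT.apply y η)
    (fun y η => hhint.apply y η)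
  refine ⟨(LinearMap.range (T : H₁ →ₗ[ℂ] H₂)).topologicalClosure, ?_, u, hu, ?_, ?_, ?_,
    Submodule.isClosed_topologicalClosure _⟩
  · refine Submodule.topologicalClosure_minimal _ ?_ hM
    rintro _ ⟨η, rfl⟩
    exact hTM η
  · intro η hη
    have hη' : η ∈ closure ((LinearMap.range (T : H₁ →ₗ[ℂ] H₂) : Submodule ℂ H₂) : Set H₂) := hη
    refine closure_minimal (t := {η | ‖u η‖ = ‖η‖}) ?_
      (isClosed_eq (by fun_prop) (by fun_prop)) hη'
    rintro _ ⟨η, rfl⟩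
    exact (congrArg norm (huT η)).trans (hhn η)
  · rw [Submodule.orthogonal_closure]
    exact hu0
  · intro hbot
    refine hT0 (ContinuousLinearMap.ext fun η => ?_)
    have : T η ∈ (LinearMap.range (T : H₁ →ₗ[ℂ] H₂)).topologicalClosure :=
      subset_closure ⟨η, rfl⟩
    rw [hbot] at this
    exact this

/-- Every normal representation embeds in a multiple of a given faithful normal one. -/
theorem exists_frame {H : Type u} [NormedAddCommGroup H] [InnerProductSpace ℂ H] [CompleteSpace H]
    {π : Elem N →⋆ₐ[ℂ] (H →L[ℂ] H)} (h₁ : IsNormalRep π₁) (hinj : Function.Injective π₁)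
    (hπ : IsNormalRep π) :
    ∃ (ι : Type u) (v : ι → H →L[ℂ] H₁), (∀ i, Intertwines π π₁ (v i)) ∧ IsFrame v := by
  -- A maximal family of pairwise orthogonal initial spaces. It serves as the index type of the
  -- frame, which therefore lives in the universe of H.
  obtain ⟨A, hA⟩ := zorn_subset
    {A : Set (Submodule ℂ H) | (∀ K ∈ A, ∃ u, IsInitialSpace π π₁ K u) ∧
      A.Pairwise fun K L => K ⟂ L} (by
    intro c hc hchain
    refine ⟨⋃₀ c, ⟨?_, ?_⟩, fun s hs => Set.subset_sUnion_of_mem hs⟩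
    · rintro K ⟨s, hs, hK⟩
      exact (hc hs).1 K hK
    · exact (Set.pairwise_sUnion hchain.directedOn).2 fun s hs => (hc hs).2)
  choose! u hu using hA.prop.1
  have hclosed : ∀ K ∈ A, IsClosed (K : Set H) := fun K hK => (hu K hK).2.2.2.2
  have hker : ∀ K ∈ A, ∀ ξ, u K ξ = 0 → ξ ∈ Kᗮ := by
    intro K hK ξ hξ
    have := (hclosed K hK).completeSpace_coe
    obtain ⟨a, ha, b, hb, rfl⟩ := K.exists_add_mem_mem_orthogonal ξ
    rw [map_add, (hu K hK).2.2.1 b hb, add_zero] at hξ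
    have := (hu K hK).2.1 a ha
    rw [hξ, norm_zero] at this
    rw [norm_eq_zero.1 this.symm, zero_add]
    exact hb
  have htriv : ∀ ξ, (∀ K ∈ A, u K ξ = 0) → ξ = 0 := by
    by_contra! hcon
    obtain ⟨ξ, hξ, hξ0⟩ := hcon
    let M : Submodule ℂ H := ⨅ K ∈ A, LinearMap.ker (u K : H →ₗ[ℂ] H₁)
    have hMmem : ∀ η, η ∈ M ↔ ∀ K ∈ A, u K η = 0 := fun η => by
      simp [M, Submodule.mem_iInf]
    have hMcl : IsClosed (M : Set H) := by
      have : (M : Set H) = ⋂ K ∈ A, {η | u K η = 0} := by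
        ext η; simp [hMmem]
      rw [this]
      exact isClosed_biInter fun K _ => isClosed_eq (u K).continuous continuous_const
    -- The common kernel of the chosen partial isometries is a closed submodule. If it is non-zero
    -- it contains a further initial space K', orthogonal to all members of A. Maximality puts K' in
    -- A, so K' is orthogonal to itself.
    obtain ⟨K', hK'M, u', hu'⟩ := exists_isInitialSpace h₁ hinj hπ hMcl (fun x η hη => by
      rw [hMmem] at hη ⊢
      intro K hK
      rw [(hu K hK).1.apply, hη K hK, map_zero]) ((hMmem ξ).2 hξ) hξ0
    have horth : ∀ K ∈ A, K' ⟂ K := fun K hK η hη => hker K hK η ((hMmem η).1 (hK'M hη) K hK)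
    have hmem : K' ∈ A := by
      refine hA.le_of_ge (y := insert K' A) ⟨?_, ?_⟩ (Set.subset_insert _ _) (Set.mem_insert _ _)
      · rintro K (rfl | hK)
        · exact ⟨u', hu'⟩
        · exact hA.prop.1 K hK
      · rw [Set.pairwise_insert]
        exact ⟨hA.prop.2, fun K hK _ => ⟨horth K hK, (horth K hK).symm⟩⟩
    exact hu'.2.2.2.1 (Submodule.isOrtho_self.1 (horth K' hmem))
  have hcomp : ∀ K : A, CompleteSpace K.1 := fun K => (hclosed K.1 K.2).completeSpace_coe
  have hfam : OrthogonalFamily ℂ (fun K : A => K.1) fun K => K.1.subtypeₗᵢ :=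
    OrthogonalFamily.of_pairwise fun K L hKL => hA.prop.2 K.2 L.2 (Subtype.coe_ne_coe.2 hKL)
  have hsum : IsHilbertSum ℂ (fun K : A => K.1) fun K => K.1.subtypeₗᵢ := by
    refine IsHilbertSum.mkInternal _ hfam (top_le_iff.2 ?_)
    rw [Submodule.topologicalClosure_eq_top_iff, Submodule.eq_bot_iff]
    intro ξ hξ
    refine htriv ξ fun K hK => (hu K hK).2.2.1 ξ ?_
    exact Submodule.orthogonal_le (le_iSup (fun K : A => K.1) ⟨K, hK⟩) hξ
  refine ⟨A, fun K => u K.1, fun K => (hu K.1 K.2).1, fun ξ => ?_⟩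
  set W := hsum.linearIsometryEquiv ξ with hW
  have hWξ : HasSum (fun K : A => (W K : H)) ξ := by
    have := hsum.hasSum_linearIsometryEquiv_symm W
    rwa [hW, LinearIsometryEquiv.symm_apply_apply] at this
  have hn := lp.hasSum_norm (p := 2) (by simp) W
  rw [hW, LinearIsometryEquiv.norm_map] at hn
  simp only [ENNReal.toReal_ofNat, Real.rpow_ofNat] at hn
  convert! hn using 2 with K
  -- The partial isometry of K kills the components of ξ in the other spaces and is isometric on the
  -- one in K, so the sum is Pythagoras for the decomposition of ξ.
  have h1 := (u K.1).hasSum hWξ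
  have h2 : HasSum (fun L : A => u K.1 (W L : H)) (u K.1 (W K : H)) := by
    refine hasSum_single K fun L hL => (hu K.1 K.2).2.2.1 _ ?_
    exact hA.prop.2 L.2 K.2 (Subtype.coe_ne_coe.2 hL) (W L).2
  rw [h1.unique h2, (hu K.1 K.2).2.1 _ (W K).2]
  rfl

end Comparison

end VNDim

namespace VNDim

variable {H₀ : Type u₀} [NormedAddCommGroup H₀] [InnerProductSpace ℂ H₀] [CompleteSpace H₀]
  {N : VonNeumannAlgebra H₀}

namespace TracialWeight

variable (τ : TracialWeight N)

/-! ### The standard representation on `L²(N,τ)` -/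

/-- The embedding of `{x : τ(x*x) < ∞}` into `L²(N,τ)`. -/
abbrev vec (a : τ.PreL2) : τ.L2 := (a : UniformSpace.Completion τ.PreL2)

variable {τ}

theorem denseRange_vec : DenseRange τ.vec := UniformSpace.Completion.denseRange_coe

theorem clm_ext {F : Type*} [NormedAddCommGroup F] [NormedSpace ℂ F] {S T : τ.L2 →L[ℂ] F}
    (h : ∀ a, S (τ.vec a) = T (τ.vec a)) : S = T :=
  ContinuousLinearMap.coeFn_injective
    (denseRange_vec.equalizer S.continuous T.continuous (funext h))

theorem eq_of_eq_vec {F : Type*} [TopologicalSpace F] [T2Space F] {f g : τ.L2 → F}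
    (hf : Continuous f) (hg : Continuous g) (h : ∀ a, f (τ.vec a) = g (τ.vec a)) (ξ : τ.L2) :
    f ξ = g ξ := congrFun (denseRange_vec.equalizer hf hg (funext h)) ξ

theorem eq_of_inner_vec {ξ η : τ.L2} (h : ∀ a, inner ℂ ξ (τ.vec a) = inner ℂ η (τ.vec a)) :
    ξ = η := by
  refine ext_inner_right ℂ fun ζ => ?_
  exact eq_of_eq_vec (f := fun ζ => inner ℂ ξ ζ) (g := fun ζ => inner ℂ η ζ)
    (by fun_prop) (by fun_prop) h ζ

theorem lmul_vec (x : Elem N) (a : τ.PreL2) : τ.lmul x (τ.vec a) = τ.vec (τ.preLmul x a) :=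
  ContinuousLinearMap.completion_apply_coe _ _

theorem J_vec (a : τ.PreL2) : τ.J (τ.vec a) = τ.vec (τ.preJ a) :=
  ContinuousLinearMap.completion_apply_coe _ _

@[simp] theorem val_preLmul (x : Elem N) (a : τ.PreL2) :
    PreL2.val τ (τ.preLmul x a) = x * PreL2.val τ a := rfl

@[simp] theorem val_preJ (a : τ.PreL2) : PreL2.val τ (τ.preJ a) = star (PreL2.val τ a) := rfl

theorem inner_eq_reInner (x y : τ.PreL2) :
    inner ℂ x y = (τ.reInner x y : ℂ) + Complex.I * τ.reInner (Complex.I • x) y :=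
  τ.polarization_eq x y

theorem norm_vec_sq (a : τ.PreL2) : ‖τ.vec a‖ ^ 2 = τ.quad a := by
  rw [UniformSpace.Completion.norm_coe, norm_sq_preL2]

theorem quad_add_quad (a b : τ.PreL2) :
    (τ (star (PreL2.val τ a) * PreL2.val τ a + star (PreL2.val τ b) * PreL2.val τ b)).toReal =
      τ.quad a + τ.quad b :=
  (τ.toReal_add (star_mul_self_nonneg' _) (star_mul_self_nonneg' _) a.2 b.2).1

/-- As τ is additive only on N₊, the adjoint relation is extracted from an identity between two sums
of squares in which the cross terms agree. -/
theorem reInner_preLmul (x : Elem N) (a b : τ.PreL2) :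
    τ.reInner (τ.preLmul x a) b = τ.reInner a (τ.preLmul (star x) b) := by
  have h1 := quad_add_quad (τ.preLmul x a + b) (a - τ.preLmul (star x) b)
  have h2 := quad_add_quad (τ.preLmul x a - b) (a + τ.preLmul (star x) b)
  simp only [map_add, map_sub, val_preLmul] at h1 h2
  have e : ∀ a b : Elem N, star (x * a + b) * (x * a + b) +
      star (a - star x * b) * (a - star x * b) =
      star (x * a - b) * (x * a - b) + star (a + star x * b) * (a + star x * b) := by
    intro a b
    simp only [star_add, star_sub, star_mul, star_star]
    noncomm_ring
  rw [e, h2] at h1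
  simp only [reInner]
  linarith

theorem inner_preLmul (x : Elem N) (a b : τ.PreL2) :
    inner ℂ (τ.preLmul x a) b = inner ℂ a (τ.preLmul (star x) b) := by
  rw [inner_eq_reInner, inner_eq_reInner, reInner_preLmul, ← map_smul, reInner_preLmul]

theorem adjoint_lmul (x : Elem N) :
    ContinuousLinearMap.adjoint (τ.lmul x) = τ.lmul (star x) := by
  refine clm_ext fun a => eq_of_inner_vec fun b => ?_
  rw [ContinuousLinearMap.adjoint_inner_left, lmul_vec, lmul_vec,
    UniformSpace.Completion.inner_coe, UniformSpace.Completion.inner_coe, inner_preLmul, star_star]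

variable (τ) in
/-- The representation of `N` on `L²(N,τ)` by left multiplication. -/
def lmulHom : Elem N →⋆ₐ[ℂ] (τ.L2 →L[ℂ] τ.L2) where
  toFun := τ.lmul
  map_one' := clm_ext fun a => by
    rw [lmul_vec]; exact congrArg τ.vec (PreL2.ext (by simp))
  map_mul' x y := clm_ext fun a => by
    rw [mul_apply_eq_comp, lmul_vec, lmul_vec, lmul_vec]
    exact congrArg τ.vec (PreL2.ext (by simp [mul_assoc]))
  map_zero' := clm_ext fun a => by
    rw [lmul_vec]
    have : τ.preLmul 0 a = 0 := PreL2.ext (by simp)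
    rw [this]; exact UniformSpace.Completion.coe_zero
  map_add' x y := clm_ext fun a => by
    rw [add_apply, lmul_vec, lmul_vec, lmul_vec]
    have : τ.preLmul (x + y) a = τ.preLmul x a + τ.preLmul y a := PreL2.ext (by simp [add_mul])
    rw [this]; exact UniformSpace.Completion.coe_add _ _
  commutes' c := clm_ext fun a => by
    rw [lmul_vec, Algebra.algebraMap_eq_smul_one, Algebra.algebraMap_eq_smul_one]
    have : τ.preLmul (c • 1) a = c • a := PreL2.ext (by simp)
    rw [this]; exact UniformSpace.Completion.coe_smul _ _
  map_star' x := by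
    rw [ContinuousLinearMap.star_eq_adjoint, adjoint_lmul]

theorem lmulHom_apply (x : Elem N) : τ.lmulHom x = τ.lmul x := rfl

theorem qf_vec_lmul {x : Elem N} (hx : 0 ≤ x) (a : τ.PreL2) :
    qf (τ.vec a) (τ.lmulHom x) = (τ (star (PreL2.val τ a) * x * PreL2.val τ a)).toReal := by
  obtain ⟨s, rfl⟩ := Elem.exists_eq_star_mul_self hx
  rw [qf_rep_star_mul_self, lmulHom_apply, lmul_vec, norm_vec_sq, quad, val_preLmul, star_mul]
  simp only [mul_assoc]

theorem conj_lt_top {x : Elem N} (hx : 0 ≤ x) (a : τ.PreL2) :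
    τ (star (PreL2.val τ a) * x * PreL2.val τ a) < ∞ := by
  obtain ⟨s, rfl⟩ := Elem.exists_eq_star_mul_self hx
  have := PreL2.lt_top τ (τ.preLmul s a)
  rw [val_preLmul, star_mul] at this
  simpa only [mul_assoc] using this

/-- An upper bound U has to be tested only on the dense set of vectors a ∈ N. There the vector
functional is x ↦ τ(a*xa); since x ↦ a*xa preserves suprema of directed families, normality of τ
applies. -/
theorem isNormalRep_lmulHom (hn : τ.IsNormal) : IsNormalRep τ.lmulHom := by
  intro D hD hne hdir x hx
  refine ⟨?_, fun U hU => ?_⟩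
  · rintro _ ⟨d, hd, rfl⟩; exact rep_mono _ (hx.1 hd)
  have hx0 : 0 ≤ x := by
    obtain ⟨d, hd⟩ := hne
    exact (hD d hd).trans (hx.1 hd)
  have hU0 : 0 ≤ U := by
    obtain ⟨d, hd⟩ := hne
    exact (rep_nonneg _ (hD d hd)).trans (hU ⟨d, hd, rfl⟩)
  refine le_of_qf_le (rep_nonneg _ hx0).isSelfAdjoint hU0.isSelfAdjoint fun ξ => ?_
  refine denseRange_vec.induction_on (p := fun ξ => qf ξ (τ.lmulHom x) ≤ qf ξ U) ξ ?_ fun a => ?_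
  · simp only [qf_apply]
    exact isClosed_le (by fun_prop) (by fun_prop)
  set b := PreL2.val τ a
  have hlub : IsLUB ((fun d => star b * d * b) '' D) (star b * x * b) := by
    refine Elem.isLUB_of_isLUB_qf ?_ (hne.image _) (conj_nonneg hx0 b) fun ξ => ?_
    · rintro _ ⟨d, hd, rfl⟩; exact conj_nonneg (hD d hd) b
    · have h := Elem.isLUB_qf hD hne hdir hx ((b : H₀ →L[ℂ] H₀) ξ)
      rw [Set.image_image]
      have e : ∀ d : Elem N, qf ((b : H₀ →L[ℂ] H₀) ξ) (d : H₀ →L[ℂ] H₀) =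
          qf ξ ((star b * d * b : Elem N) : H₀ →L[ℂ] H₀) := by
        intro d
        change _ = qf ξ (star (b : H₀ →L[ℂ] H₀) * (d : H₀ →L[ℂ] H₀) * (b : H₀ →L[ℂ] H₀))
        rw [qf_apply, qf_apply, ContinuousLinearMap.star_eq_adjoint, mul_apply_eq_comp,
          mul_apply_eq_comp, ContinuousLinearMap.adjoint_inner_left]
      simpa only [e] using h
  have hs := hn _ (by rintro _ ⟨d, hd, rfl⟩; exact conj_nonneg (hD d hd) b) (hne.image _) (by
    rintro _ ⟨d, hd, rfl⟩ _ ⟨e, he, rfl⟩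
    obtain ⟨f, hf, h1, h2⟩ := hdir d hd e he
    exact ⟨_, ⟨f, hf, rfl⟩, conj_mono h1 b, conj_mono h2 b⟩) _ hlub
  rw [qf_vec_lmul hx0, hs]
  refine ENNReal.toReal_le_of_le_ofReal (qf_nonneg hU0 _) (iSup₂_le ?_)
  rintro _ ⟨d, hd, rfl⟩
  rw [← ENNReal.ofReal_toReal (conj_lt_top (hD d hd) a).ne, ← qf_vec_lmul (hD d hd)]
  exact ENNReal.ofReal_le_ofReal (qf_mono (hU ⟨d, hd, rfl⟩) _)

/-- The square root of a positive element of finite trace, as a vector. -/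
theorem exists_sqrt_vec {y : Elem N} (hy : 0 ≤ y) (hτ : τ y < ∞) :
    ∃ a : τ.PreL2, 0 ≤ PreL2.val τ a ∧ PreL2.val τ a * PreL2.val τ a = y := by
  obtain ⟨s, hs, h⟩ := Elem.exists_sqrt hy
  exact ⟨PreL2.mk τ s (by rwa [Elem.isSelfAdjoint hs, h]), hs, h⟩

theorem Elem.star_mul_self_eq_zero {x : Elem N} (h : star x * x = 0) : x = 0 := by
  have h' : star (x : H₀ →L[ℂ] H₀) * (x : H₀ →L[ℂ] H₀) = 0 := congrArg Subtype.val h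
  exact Subtype.ext ((CStarRing.star_mul_self_eq_zero_iff _).1 h')

theorem vec_injective (hf : τ.IsFaithful) {a : τ.PreL2} (h : τ.vec a = 0) :
    PreL2.val τ a = 0 := by
  have h1 := norm_vec_sq a
  rw [h, norm_zero, quad, zero_pow two_ne_zero] at h1
  have h2 := (ENNReal.toReal_eq_zero_iff _).1 h1.symm
  exact Elem.star_mul_self_eq_zero
    (hf _ (star_mul_self_nonneg' _) (h2.resolve_right (PreL2.lt_top τ a).ne))

/-- If x acts by 0, so does any y ≤ x*x. Semifiniteness supplies such a y ≠ 0 of finite trace. The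
operator of √y applied to the vector √y is the vector of y, which then vanishes, against
faithfulness. -/
theorem lmulHom_injective (hf : τ.IsFaithful) (hs : τ.IsSemifinite) :
    Function.Injective τ.lmulHom := by
  rw [injective_iff_map_eq_zero]
  intro x hx
  by_contra hx0
  obtain ⟨y, hy, hyx, hy0, hyτ⟩ := hs (star x * x) (star_mul_self_nonneg' x)
    fun h => hx0 (Elem.star_mul_self_eq_zero h)
  obtain ⟨a, ha, hay⟩ := exists_sqrt_vec hy hyτ
  have hzero : τ.lmulHom y = 0 := by
    refine le_antisymm ((rep_mono _ hyx).trans_eq ?_) (rep_nonneg _ hy)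
    rw [map_mul, hx, mul_zero]
  have h2 : τ.lmulHom (PreL2.val τ a) (τ.vec a) = 0 := by
    have := qf_rep_star_mul_self τ.lmulHom (τ.vec a) (PreL2.val τ a)
    rw [Elem.isSelfAdjoint ha, hay, hzero, map_zero] at this
    simpa using this.symm
  rw [lmulHom_apply, lmul_vec] at h2
  have h3 := vec_injective hf h2
  rw [val_preLmul, hay] at h3
  exact hy0 h3

/-! ### The modular conjugation -/

theorem J_J (ξ : τ.L2) : τ.J (τ.J ξ) = ξ := by
  refine eq_of_eq_vec (f := fun ξ => τ.J (τ.J ξ)) (g := fun ξ => ξ)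
    (by fun_prop) (by fun_prop) (fun a => ?_) ξ
  rw [J_vec, J_vec]
  exact congrArg τ.vec (PreL2.ext (by simp))

theorem quad_preJ (a : τ.PreL2) : τ.quad (τ.preJ a) = τ.quad a := by
  simp [quad, ← τ.tracial]

theorem reInner_preJ (a b : τ.PreL2) : τ.reInner (τ.preJ a) (τ.preJ b) = τ.reInner a b := by
  rw [reInner, ← map_add, ← map_sub, quad_preJ, quad_preJ, reInner]

theorem inner_J_J (ξ η : τ.L2) : inner ℂ (τ.J ξ) (τ.J η) = inner ℂ η ξ := by
  refine eq_of_eq_vec (f := fun ξ => inner ℂ (τ.J ξ) (τ.J η))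
    (g := fun ξ => inner ℂ η ξ) (by fun_prop) (by fun_prop) (fun a => ?_) ξ
  refine eq_of_eq_vec (f := fun η => inner ℂ (τ.J (τ.vec a)) (τ.J η))
    (g := fun η => inner ℂ η (τ.vec a)) (by fun_prop) (by fun_prop) (fun b => ?_) η
  rw [J_vec, J_vec, UniformSpace.Completion.inner_coe, UniformSpace.Completion.inner_coe,
    ← inner_conj_symm b a, inner_eq_reInner, inner_eq_reInner]
  have h : Complex.I • τ.preJ a = τ.preJ (-(Complex.I • a)) := by
    rw [map_neg, map_smulₛₗ]; simp
  rw [h, reInner_preJ, reInner_preJ, τ.reInner_neg]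
  simp

theorem inner_J_left (ξ η : τ.L2) : inner ℂ (τ.J ξ) η = inner ℂ (τ.J η) ξ := by
  conv_lhs => rw [← J_J η]
  exact inner_J_J _ _

/-- Conjugation `T ↦ J T J` of operators on `L²(N,τ)`. -/
def conjOp (T : τ.L2 →L[ℂ] τ.L2) : τ.L2 →L[ℂ] τ.L2 := τ.J.comp (T.comp τ.J)

theorem conjOp_apply (T : τ.L2 →L[ℂ] τ.L2) (ξ : τ.L2) : conjOp T ξ = τ.J (T (τ.J ξ)) := rfl

theorem conjOp_conjOp (T : τ.L2 →L[ℂ] τ.L2) : conjOp (conjOp T) = T := by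
  ext ξ; simp [conjOp_apply, J_J]

theorem conjOp_comp (S T : τ.L2 →L[ℂ] τ.L2) : conjOp (S.comp T) = (conjOp S).comp (conjOp T) := by
  ext ξ; simp [conjOp_apply, J_J]

theorem conjOp_add (S T : τ.L2 →L[ℂ] τ.L2) : conjOp (S + T) = conjOp S + conjOp T := by
  ext ξ; simp [conjOp_apply]

theorem conjOp_zero : conjOp (0 : τ.L2 →L[ℂ] τ.L2) = 0 := by
  ext ξ; simp [conjOp_apply]

theorem adjoint_conjOp (T : τ.L2 →L[ℂ] τ.L2) :
    ContinuousLinearMap.adjoint (conjOp T) = conjOp (ContinuousLinearMap.adjoint T) := by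
  symm
  rw [ContinuousLinearMap.eq_adjoint_iff]
  intro ξ η
  rw [conjOp_apply, conjOp_apply, inner_J_left, ContinuousLinearMap.adjoint_inner_right,
    ← inner_J_J, J_J]

theorem qf_conjOp (T : τ.L2 →L[ℂ] τ.L2) (ξ : τ.L2) : qf ξ (conjOp T) = qf (τ.J ξ) T := by
  rw [qf_apply, qf_apply, conjOp_apply, inner_J_left]
  exact inner_re_symm (𝕜 := ℂ) _ _

theorem conjOp_nonneg {T : τ.L2 →L[ℂ] τ.L2} (hT : 0 ≤ T) : 0 ≤ conjOp T := by
  refine nonneg_of_qf_nonneg ?_ fun ξ => by rw [qf_conjOp]; exact qf_nonneg hT _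
  have h := hT.isSelfAdjoint.star_eq
  rw [ContinuousLinearMap.star_eq_adjoint] at h
  rw [IsSelfAdjoint, ContinuousLinearMap.star_eq_adjoint, adjoint_conjOp, h]

/-- Right multiplication by `x`. -/
def rmul (x : Elem N) : τ.L2 →L[ℂ] τ.L2 := conjOp (τ.lmul (star x))

/-- The product ab is both the left multiplication of b by a and the right multiplication of a by b.
This is how operators commuting with one side are made to act on a single factor. -/
theorem lmul_val_vec (a b : τ.PreL2) :
    τ.lmul (PreL2.val τ a) (τ.vec b) = rmul (PreL2.val τ b) (τ.vec a) := by
  rw [rmul, conjOp_apply, J_vec, lmul_vec, lmul_vec, J_vec]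
  exact congrArg τ.vec (PreL2.ext (by simp))

theorem adjoint_rmul (x : Elem N) :
    ContinuousLinearMap.adjoint (rmul (τ := τ) x) = rmul (star x) := by
  rw [rmul, adjoint_conjOp, adjoint_lmul, rmul]

theorem lmul_rmul_comm (x y : Elem N) (ξ : τ.L2) :
    τ.lmul x (rmul y ξ) = rmul y (τ.lmul x ξ) := by
  suffices h : (τ.lmul x).comp (rmul y) = (rmul y).comp (τ.lmul x) from
    congrArg (fun T : τ.L2 →L[ℂ] τ.L2 => T ξ) h
  refine clm_ext fun a => ?_
  simp only [ContinuousLinearMap.comp_apply, rmul, conjOp_apply, J_vec, lmul_vec]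
  exact congrArg τ.vec (PreL2.ext (by simp [mul_assoc]))

theorem inner_lmul_rmul (x y : Elem N) (ξ η : τ.L2) :
    inner ℂ (τ.lmul x ξ) (rmul y η) = inner ℂ (rmul (star y) ξ) (τ.lmul (star x) η) := by
  rw [← adjoint_rmul, ContinuousLinearMap.adjoint_inner_left, ← lmul_rmul_comm, ← adjoint_lmul,
    ContinuousLinearMap.adjoint_inner_right]

/-! ### Commutants of the left and right multiplications. -/

/-- Commutation with the left multiplications. -/
def CommL (T : τ.L2 →L[ℂ] τ.L2) : Prop := Intertwines τ.lmulHom τ.lmulHom T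

/-- Commutation with the right multiplications. -/
def CommR (S : τ.L2 →L[ℂ] τ.L2) : Prop := ∀ x ξ, S (rmul x ξ) = rmul x (S ξ)

theorem CommR.adjoint {S : τ.L2 →L[ℂ] τ.L2} (hS : CommR S) :
    CommR (ContinuousLinearMap.adjoint S) := by
  intro x ξ
  refine ext_inner_right ℂ fun η => ?_
  rw [ContinuousLinearMap.adjoint_inner_left, ← star_star x, ← adjoint_rmul,
    ContinuousLinearMap.adjoint_inner_left, ContinuousLinearMap.adjoint_inner_left, ← hS,
    ContinuousLinearMap.adjoint_inner_left]

theorem CommL.commR_conjOp {T : τ.L2 →L[ℂ] τ.L2} (hT : CommL T) : CommR (conjOp T) := by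
  intro x ξ
  simp only [rmul, conjOp_apply, J_J]
  exact congrArg τ.J (hT.apply (star x) _)

/-- A vector annihilated by all left multiplications of finite trace vanishes. -/
theorem eq_zero_of_lmul_eq_zero (hn : τ.IsNormal) (hs : τ.IsSemifinite) {ξ : τ.L2}
    (h : ∀ a : τ.PreL2, τ.lmul (PreL2.val τ a) ξ = 0) : ξ = 0 := by
  have hN := isNormalRep_lmulHom hn
  have h1 : (0 : Elem N) ≤ 1 := by simpa using star_mul_self_nonneg' (1 : Elem N)
  -- Take m maximal below 1 with ω_ξ(m) ≤ 0. If m ≠ 1, some non-zero y ≤ 1 - m has finite trace;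
  -- writing y = a² with a square-integrable, the hypothesis gives ω_ξ(y) = 0, against maximality.
  -- So m = 1 and ‖ξ‖² ≤ 0.
  obtain ⟨m, hm, hm1, hmq, hmax⟩ := exists_maximal_dominated hN (π₂ := τ.lmulHom) ξ 0 h1
  have hmq' : qf ξ (τ.lmulHom m) ≤ 0 := by simpa [qf_apply] using hmq
  have hm0 : m = 1 := by
    by_contra hne
    obtain ⟨y, hy, hym, hy0, hyτ⟩ := hs (1 - m) (sub_nonneg' hm1)
      fun h => hne (sub_eq_zero.1 h).symm
    have := hmax y hy hym hy0
    obtain ⟨a, ha, hay⟩ := exists_sqrt_vec hy hyτ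
    rw [← hay, map_mul, qf_apply, qf_apply, mul_apply_eq_comp, mul_apply_eq_comp] at this
    simp [lmulHom_apply, h] at this
  rw [hm0, map_one, qf_one] at hmq'
  have : ‖ξ‖ ^ 2 = 0 := le_antisymm hmq' (by positivity)
  simpa using this

/-- For S a left multiplication by s this reads a*s*c = (c*sa)*. In general, testing against the
vector of x ∈ N turns left multiplications into right ones, which S passes through. -/
theorem J_lmul_adjoint {S : τ.L2 →L[ℂ] τ.L2} (hS : CommR S) (a c : τ.PreL2) :
    τ.lmul (star (PreL2.val τ a)) (ContinuousLinearMap.adjoint S (τ.vec c)) =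
      τ.J (τ.lmul (star (PreL2.val τ c)) (S (τ.vec a))) := by
  refine eq_of_inner_vec fun x => ?_
  rw [← adjoint_lmul, ContinuousLinearMap.adjoint_inner_left,
    ContinuousLinearMap.adjoint_inner_left, lmul_val_vec, hS, ← star_star (PreL2.val τ x),
    ← adjoint_rmul, ContinuousLinearMap.adjoint_inner_right, ← val_preJ, ← lmul_val_vec,
    inner_J_left, ← adjoint_lmul, ContinuousLinearMap.adjoint_inner_right, J_vec]

/-- The commutation theorem: the commutants of the left and of the right multiplications commute
with each other. -/
theorem CommR.comp_comm (hn : τ.IsNormal) (hs : τ.IsSemifinite) {S T : τ.L2 →L[ℂ] τ.L2}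
    (hS : CommR S) (hT : CommL T) : S.comp T = T.comp S := by
  -- The mirror image of `J_lmul_adjoint`, obtained by applying it to J T* J, which commutes with
  -- the right multiplications.
  have hT' : ∀ b d : τ.PreL2, rmul (star (PreL2.val τ d)) (T (τ.vec b)) =
      τ.J (rmul (star (PreL2.val τ b)) (ContinuousLinearMap.adjoint T (τ.vec d))) := by
    intro b d
    have h := J_lmul_adjoint (CommL.commR_conjOp (T := ContinuousLinearMap.adjoint T) hT.adjoint)
      (τ.preJ d) (τ.preJ b)
    rw [adjoint_conjOp, ContinuousLinearMap.adjoint_adjoint, conjOp_apply, conjOp_apply, J_vec,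
      J_vec, val_preJ, val_preJ, star_star, star_star] at h
    have e : ∀ a : τ.PreL2, τ.preJ (τ.preJ a) = a := fun a => PreL2.ext (by simp)
    rw [e, e] at h
    rw [rmul, rmul, conjOp_apply, conjOp_apply, star_star, star_star, J_J, h, J_J]
  -- On a product ab, S acts on the factor a and T on the factor b, and the adjoints act likewise on
  -- cd. The matrix coefficients of ST and TS between such products are therefore equal.
  have key : ∀ a b c d : τ.PreL2,
      inner ℂ (S (T (τ.lmul (PreL2.val τ a) (τ.vec b)))) (τ.lmul (PreL2.val τ c) (τ.vec d)) =
      inner ℂ (T (S (τ.lmul (PreL2.val τ a) (τ.vec b)))) (τ.lmul (PreL2.val τ c) (τ.vec d)) := by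
    intro a b c d
    have l1 : S (τ.lmul (PreL2.val τ a) (τ.vec b)) = rmul (PreL2.val τ b) (S (τ.vec a)) := by
      rw [lmul_val_vec, hS]
    have l2 : ContinuousLinearMap.adjoint S (τ.lmul (PreL2.val τ c) (τ.vec d)) =
        rmul (PreL2.val τ d) (ContinuousLinearMap.adjoint S (τ.vec c)) := by
      rw [lmul_val_vec, hS.adjoint]
    have l3 : T (τ.lmul (PreL2.val τ a) (τ.vec b)) = τ.lmul (PreL2.val τ a) (T (τ.vec b)) :=
      hT.apply _ _
    have l4 : ContinuousLinearMap.adjoint T (τ.lmul (PreL2.val τ c) (τ.vec d)) =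
        τ.lmul (PreL2.val τ c) (ContinuousLinearMap.adjoint T (τ.vec d)) :=
      hT.adjoint.apply _ _
    calc _ = inner ℂ (τ.lmul (PreL2.val τ a) (T (τ.vec b)))
          (rmul (PreL2.val τ d) (ContinuousLinearMap.adjoint S (τ.vec c))) := by
          rw [← ContinuousLinearMap.adjoint_inner_right, l2, l3]
      _ = inner ℂ (rmul (star (PreL2.val τ d)) (T (τ.vec b)))
          (τ.lmul (star (PreL2.val τ a)) (ContinuousLinearMap.adjoint S (τ.vec c))) := by
          rw [inner_lmul_rmul]
      _ = inner ℂ (τ.lmul (star (PreL2.val τ c)) (S (τ.vec a)))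
          (rmul (star (PreL2.val τ b)) (ContinuousLinearMap.adjoint T (τ.vec d))) := by
          rw [J_lmul_adjoint hS, hT', inner_J_J]
      _ = inner ℂ (rmul (PreL2.val τ b) (S (τ.vec a)))
          (τ.lmul (PreL2.val τ c) (ContinuousLinearMap.adjoint T (τ.vec d))) := by
          rw [inner_lmul_rmul, star_star, star_star]
      _ = _ := by
          rw [← ContinuousLinearMap.adjoint_inner_right T, l4, l1]
  set D := S.comp T - T.comp S with hD
  -- Products need not be visibly dense, so density is replaced by `eq_zero_of_lmul_eq_zero`, used
  -- once for the values of D and once for those of D*.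
  have h1 : ∀ a b : τ.PreL2, D (τ.lmul (PreL2.val τ a) (τ.vec b)) = 0 := by
    intro a b
    refine eq_zero_of_lmul_eq_zero hn hs fun c => eq_of_inner_vec fun d => ?_
    have := key a b (τ.preJ c) d
    rw [← sub_eq_zero, ← inner_sub_left, val_preJ, ← adjoint_lmul,
      ContinuousLinearMap.adjoint_inner_right] at this
    rw [inner_zero_left]
    exact this
  have h2 : ∀ a : τ.PreL2, D.comp (τ.lmul (PreL2.val τ a)) = 0 := fun a => clm_ext fun b => h1 a b
  have h3 : ContinuousLinearMap.adjoint D = 0 := by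
    ext ξ
    refine eq_zero_of_lmul_eq_zero hn hs fun a => ?_
    have := congrArg ContinuousLinearMap.adjoint (h2 (τ.preJ a))
    rw [ContinuousLinearMap.adjoint_comp, adjoint_lmul, val_preJ, star_star, map_zero] at this
    exact congrArg (fun T : τ.L2 →L[ℂ] τ.L2 => T ξ) this
  have h4 : D = 0 := by
    rw [← ContinuousLinearMap.adjoint_adjoint D, h3, map_zero]
  exact sub_eq_zero.1 h4

end TracialWeight

end VNDim

namespace VNDim

variable {H₀ : Type u₀} [NormedAddCommGroup H₀] [InnerProductSpace ℂ H₀] [CompleteSpace H₀]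
  {N : VonNeumannAlgebra H₀}

namespace TracialWeight

variable {τ : TracialWeight N}

/-! ### Coordinates in the amplification -/

section Coordinates

variable {ι : Type w}

variable (τ) in
/-- The `i`-th coordinate of a vector of `L²(N,τ) ⊗ ℓ²(ι)`. -/
def coord (i : ι) : τ.Amp ι →L[ℂ] τ.L2 := ContinuousLinearMap.adjoint (τ.coordEmb i)

theorem coord_apply (i : ι) (f : τ.Amp ι) : τ.coord i f = f i := by
  classical
  refine ext_inner_left ℂ fun η => ?_
  rw [coord, ContinuousLinearMap.adjoint_inner_right]
  exact lp.inner_single_left (G := fun _ : ι => τ.L2) (𝕜 := ℂ) i η f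

theorem adjoint_coord (i : ι) : ContinuousLinearMap.adjoint (τ.coord i) = τ.coordEmb i :=
  ContinuousLinearMap.adjoint_adjoint _

theorem ext_coord {f g : τ.Amp ι} (h : ∀ i, τ.coord i f = τ.coord i g) : f = g := by
  ext i
  simpa only [coord_apply] using h i

theorem clm_ext_coordEmb {F : Type*} [NormedAddCommGroup F] [NormedSpace ℂ F]
    {S T : τ.Amp ι →L[ℂ] F} (h : ∀ i η, S (τ.coordEmb i η) = T (τ.coordEmb i η)) : S = T := by
  classical
  refine lp.ext_continuousLinearMap (by simp) fun i => ContinuousLinearMap.ext fun η => ?_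
  exact h i η

theorem coord_coordEmb_self (i : ι) (η : τ.L2) : τ.coord i (τ.coordEmb i η) = η := by
  classical
  rw [coord_apply]
  exact lp.single_apply_self (E := fun _ : ι => τ.L2) 2 i η

theorem coord_coordEmb_of_ne {i j : ι} (h : i ≠ j) (η : τ.L2) :
    τ.coord i (τ.coordEmb j η) = 0 := by
  classical
  rw [coord_apply]
  exact lp.single_apply_ne (E := fun _ : ι => τ.L2) 2 j η h

theorem coord_amplify (T : τ.L2 →L[ℂ] τ.L2) (i : ι) (f : τ.Amp ι) :
    τ.coord i (τ.amplify ι T f) = T (τ.coord i f) := by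
  rw [coord_apply, coord_apply]; rfl

theorem coord_ampJ (i : ι) (f : τ.Amp ι) : τ.coord i (τ.ampJ ι f) = τ.J (τ.coord i f) := by
  rw [coord_apply, coord_apply]; rfl

theorem amplify_coordEmb (T : τ.L2 →L[ℂ] τ.L2) (j : ι) (η : τ.L2) :
    τ.amplify ι T (τ.coordEmb j η) = τ.coordEmb j (T η) := by
  refine ext_coord fun i => ?_
  rw [coord_amplify]
  by_cases h : i = j
  · subst h; rw [coord_coordEmb_self, coord_coordEmb_self]
  · rw [coord_coordEmb_of_ne h, coord_coordEmb_of_ne h, map_zero]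

theorem ampJ_coordEmb (j : ι) (η : τ.L2) :
    τ.ampJ ι (τ.coordEmb j η) = τ.coordEmb j (τ.J η) := by
  refine ext_coord fun i => ?_
  rw [coord_ampJ]
  by_cases h : i = j
  · subst h; rw [coord_coordEmb_self, coord_coordEmb_self]
  · rw [coord_coordEmb_of_ne h, coord_coordEmb_of_ne h, map_zero]

theorem hasSum_norm_coord (f : τ.Amp ι) :
    HasSum (fun i => ‖τ.coord i f‖ ^ 2) (‖f‖ ^ 2) := by
  have hn := lp.hasSum_norm (p := 2) (by simp) f
  simp only [ENNReal.toReal_ofNat, Real.rpow_ofNat] at hn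
  simpa only [coord_apply] using hn

end Coordinates

/-! ### Standard intertwiners as frames of intertwiners into L²(N,τ). -/

section Frames

variable {ι : Type w} {H : Type u} [NormedAddCommGroup H] [InnerProductSpace ℂ H] [CompleteSpace H]
  {π : Elem N →⋆ₐ[ℂ] (H →L[ℂ] H)}

/-- The isometry into `L²(N,τ) ⊗ ℓ²(ι)` whose coordinates are a given frame. -/
theorem exists_isometry_of_isFrame {v : ι → H →L[ℂ] τ.L2} (hv : IsFrame v) :
    ∃ V : H →ₗᵢ[ℂ] τ.Amp ι, ∀ i, (τ.coord i).comp V.toContinuousLinearMap = v i := by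
  let V : H →ₗ[ℂ] τ.Amp ι :=
    { toFun := fun ξ => ⟨fun i => v i ξ, memℓp_gen (by simpa using (hv ξ).summable)⟩
      map_add' := fun ξ η => by ext i; exact map_add (v i) ξ η
      map_smul' := fun c ξ => by ext i; exact map_smul (v i) c ξ }
  have hV : ∀ ξ i, τ.coord i (V ξ) = v i ξ := fun ξ i => by rw [coord_apply]; rfl
  refine ⟨⟨V, fun ξ => ?_⟩, fun i => ContinuousLinearMap.ext fun ξ => hV ξ i⟩
  rw [← sq_eq_sq₀ (norm_nonneg _) (norm_nonneg _)]
  refine (hasSum_norm_coord (V ξ)).unique ?_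
  simpa only [hV] using hv ξ

theorem isFrame_coord (V : H →ₗᵢ[ℂ] τ.Amp ι) :
    IsFrame fun i => (τ.coord i).comp V.toContinuousLinearMap := fun ξ => by
  simpa using hasSum_norm_coord (V ξ)

theorem isStandardIntertwiner_iff (V : H →ₗᵢ[ℂ] τ.Amp ι) : τ.IsStandardIntertwiner π V ↔
    ∀ i, Intertwines π τ.lmulHom ((τ.coord i).comp V.toContinuousLinearMap) := by
  constructor
  · intro h i x
    rw [ContinuousLinearMap.comp_assoc, h x]
    ext1 ξ
    exact coord_amplify _ _ _
  · intro h x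
    ext1 ξ
    refine ext_coord fun i => ?_
    rw [ContinuousLinearMap.comp_apply (τ.amplify ι _), coord_amplify]
    exact (h i).apply x ξ

/-- J ⊗ 1 acts coordinatewise, so it passes through the coordinate maps and conjugates every matrix
entry separately. -/
theorem matrixEntry_conjRangeProj (V : H →ₗᵢ[ℂ] τ.Amp ι) (i j : ι) :
    τ.matrixEntry (τ.conjRangeProj V) i j =
      conjOp (((τ.coord i).comp V.toContinuousLinearMap).comp
        (ContinuousLinearMap.adjoint ((τ.coord j).comp V.toContinuousLinearMap))) := by
  ext1 η
  rw [ContinuousLinearMap.adjoint_comp, adjoint_coord]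
  change τ.coord i (τ.ampJ ι (V (ContinuousLinearMap.adjoint V.toContinuousLinearMap
    (τ.ampJ ι (τ.coordEmb j η))))) = _
  rw [coord_ampJ, ampJ_coordEmb]
  rfl

end Frames

/-! ### The commutation theorem -/

/-- The faithfulness, normality and semifiniteness of a tracial weight. -/
structure IsFNS (τ : TracialWeight N) : Prop where
  faithful : τ.IsFaithful
  normal : τ.IsNormal
  semifinite : τ.IsSemifinite

theorem isNormalRep_subtype : IsNormalRep N.toStarSubalgebra.subtype :=
  isNormalRep_of_isLUB_qf fun _ hD hne hdir _ hx ξ => Elem.isLUB_qf hD hne hdir hx ξ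

theorem injective_subtype : Function.Injective N.toStarSubalgebra.subtype :=
  Subtype.val_injective

theorem IsFNS.isNormalRep (h : τ.IsFNS) : IsNormalRep τ.lmulHom := isNormalRep_lmulHom h.normal

theorem IsFNS.injective (h : τ.IsFNS) : Function.Injective τ.lmulHom :=
  lmulHom_injective h.faithful h.semifinite

/-- Every operator in the bicommutant of the left multiplications is a left multiplication. -/
theorem IsFNS.exists_lmul_eq (h : τ.IsFNS) {S : τ.L2 →L[ℂ] τ.L2}
    (hS : ∀ T, CommL T → S.comp T = T.comp S) : ∃ z, τ.lmul z = S := by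
  -- The bicommutant property is known only on H₀, so H₀ is embedded in a multiple of L²(N,τ) and
  -- the operator S ⊗ 1 is compressed back to H₀.
  obtain ⟨ι, v, hv, hfr⟩ := exists_frame h.isNormalRep h.injective (isNormalRep_subtype (N := N))
  obtain ⟨V', hV⟩ := exists_isometry_of_isFrame hfr
  set V := V'.toContinuousLinearMap with hVdef
  have hVV : (ContinuousLinearMap.adjoint V).comp V = 1 := by
    rw [← ContinuousLinearMap.norm_map_iff_adjoint_comp_self]
    exact V'.norm_map
  have hVV' : ∀ ξ, ContinuousLinearMap.adjoint V (V ξ) = ξ := fun ξ =>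
    congrArg (fun T : H₀ →L[ℂ] H₀ => T ξ) hVV
  have hadj : ∀ j η, ContinuousLinearMap.adjoint V (τ.coordEmb j η) =
      ContinuousLinearMap.adjoint (v j) η := fun j η => by
    rw [← hV, ContinuousLinearMap.adjoint_comp, adjoint_coord]; rfl
  have hVi : ∀ i ξ, τ.coord i (V ξ) = v i ξ := fun i ξ =>
    congrArg (fun T : H₀ →L[ℂ] τ.L2 => T ξ) (hV i)
  have hcomm : ∀ u : H₀ →L[ℂ] τ.L2, Intertwines N.toStarSubalgebra.subtype τ.lmulHom u →
      ∀ j η, S (u (ContinuousLinearMap.adjoint (v j) η)) =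
        u (ContinuousLinearMap.adjoint (v j) (S η)) := fun u hu j η =>
    congrArg (fun T : τ.L2 →L[ℂ] τ.L2 => T η) (hS _ (hu.comp (hv j).adjoint))
  -- For t in the commutant of N, the entries v_i t v_j* of V t V* commute with the left
  -- multiplications, hence with S; so V t V* commutes with S ⊗ 1. This places V*(S ⊗ 1)V in N.
  have hW : ∀ t : H₀ →L[ℂ] H₀, (∀ z ∈ N, z * t = t * z) → ∀ f,
      V (t (ContinuousLinearMap.adjoint V (τ.amplify ι S f))) =
        τ.amplify ι S (V (t (ContinuousLinearMap.adjoint V f))) := by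
    intro t ht f
    have ht' : Intertwines N.toStarSubalgebra.subtype N.toStarSubalgebra.subtype t :=
      fun x => (ht x x.2).symm
    suffices hsuff : (V.comp (t.comp (ContinuousLinearMap.adjoint V))).comp (τ.amplify ι S) =
        (τ.amplify ι S).comp (V.comp (t.comp (ContinuousLinearMap.adjoint V))) from
      congrArg (fun T : τ.Amp ι →L[ℂ] τ.Amp ι => T f) hsuff
    refine clm_ext_coordEmb fun j η => ext_coord fun i => ?_
    simp only [ContinuousLinearMap.comp_apply]
    rw [coord_amplify, amplify_coordEmb, hadj, hadj, hVi, hVi]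
    exact (hcomm _ ((hv i).comp ht') j η).symm
  set z₀ : H₀ →L[ℂ] H₀ := (ContinuousLinearMap.adjoint V).comp ((τ.amplify ι S).comp V) with hz₀
  have hz₀N : z₀ ∈ N := mem_of_commute fun t ht => by
    ext ξ
    change t (ContinuousLinearMap.adjoint V (τ.amplify ι S (V ξ))) =
      ContinuousLinearMap.adjoint V (τ.amplify ι S (V (t ξ)))
    rw [← hVV' (t _), hW t ht, hVV']
  set z : Elem N := ⟨z₀, hz₀N⟩ with hz
  set D := S - τ.lmulHom z with hD
  -- For t = 1, VV* commutes with S ⊗ 1, so V z₀ = (S ⊗ 1)V. Comparing coordinates shows that S and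
  -- left multiplication by z agree on the range of each v_i.
  have hDv : ∀ i ξ, D (v i ξ) = 0 := by
    intro i ξ
    have h1 : V (z₀ ξ) = τ.amplify ι S (V ξ) := by
      have := hW 1 (fun _ _ => by rw [mul_one, one_mul]) (V ξ)
      rw [hVV'] at this
      exact this
    have h2 := congrArg (τ.coord i) h1
    rw [hVi, coord_amplify, hVi] at h2
    rw [hD, sub_apply, ← h2, ← (hv i).apply z ξ]
    exact sub_self _
  have hDu : ∀ u : H₀ →L[ℂ] τ.L2, Intertwines N.toStarSubalgebra.subtype τ.lmulHom u →
      D.comp u = 0 := by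
    intro u hu
    -- D commutes with each u v_j*, whence D u V* = u V*(D ⊗ 1); and D ⊗ 1 vanishes on the range of
    -- V.
    have h1 : (D.comp u).comp (ContinuousLinearMap.adjoint V) =
        (u.comp (ContinuousLinearMap.adjoint V)).comp (τ.amplify ι D) := by
      refine clm_ext_coordEmb fun j η => ?_
      simp only [ContinuousLinearMap.comp_apply]
      rw [amplify_coordEmb, hadj, hadj, hD, sub_apply, sub_apply, map_sub, map_sub, hcomm u hu,
        (hv j).adjoint.apply, hu.apply]
    ext1 ξ
    have h2 := congrArg (fun T : τ.Amp ι →L[ℂ] τ.L2 => T (V ξ)) h1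
    simp only [ContinuousLinearMap.comp_apply, hVV'] at h2
    have h3 : τ.amplify ι D (V ξ) = 0 := by
      refine ext_coord fun i => ?_
      rw [coord_amplify, hVi, hDv, map_zero]
    rw [h3, map_zero, map_zero] at h2
    exact h2
  have hDadj : ContinuousLinearMap.adjoint D = 0 := by
    ext1 ξ
    by_contra hne
    let M : Submodule ℂ τ.L2 := ⨅ u : {u : H₀ →L[ℂ] τ.L2 //
      Intertwines N.toStarSubalgebra.subtype τ.lmulHom u},
      LinearMap.ker (ContinuousLinearMap.adjoint u.1 : τ.L2 →ₗ[ℂ] H₀)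
    have hM : ∀ η, η ∈ M ↔ ∀ u : H₀ →L[ℂ] τ.L2,
        Intertwines N.toStarSubalgebra.subtype τ.lmulHom u → ContinuousLinearMap.adjoint u η = 0 :=
      fun η => by simp [M, Submodule.mem_iInf]
    have hMcl : IsClosed (M : Set τ.L2) := by
      have : (M : Set τ.L2) = ⋂ u : {u : H₀ →L[ℂ] τ.L2 //
          Intertwines N.toStarSubalgebra.subtype τ.lmulHom u},
          {η | ContinuousLinearMap.adjoint u.1 η = 0} := by
        ext η; simp [hM]
      rw [this]
      exact isClosed_iInter fun u =>
        isClosed_eq (ContinuousLinearMap.adjoint u.1).continuous continuous_const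
    -- The roles are now exchanged: the faithful identity representation on H₀ would produce a
    -- non-zero intertwiner T into the submodule annihilated by all u*. Taking u = T gives T*T = 0.
    obtain ⟨T, hT, hT0, hTM⟩ := exists_nonzero_intertwiner (isNormalRep_subtype (N := N))
      injective_subtype h.isNormalRep hMcl (fun x η hη => by
        rw [hM] at hη ⊢
        intro u hu
        rw [hu.adjoint.apply, hη u hu, map_zero])
      ((hM (ContinuousLinearMap.adjoint D ξ)).2 fun u hu => by
        have := congrArg ContinuousLinearMap.adjoint (hDu u hu)
        rw [ContinuousLinearMap.adjoint_comp, map_zero] at this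
        exact congrArg (fun T : τ.L2 →L[ℂ] H₀ => T ξ) this) hne
    refine hT0 (ContinuousLinearMap.ext fun ζ => ?_)
    have h1 := (hM _).1 (hTM ζ) T hT
    have h2 := ContinuousLinearMap.adjoint_inner_left T ζ (T ζ)
    rw [h1, inner_zero_left] at h2
    exact inner_self_eq_zero.1 h2.symm
  refine ⟨z, (sub_eq_zero.1 ?_).symm⟩
  change D = 0
  rw [← ContinuousLinearMap.adjoint_adjoint D, hDadj, map_zero]

theorem IsFNS.exists_lmul_eq_conjOp (h : τ.IsFNS) {T : τ.L2 →L[ℂ] τ.L2} (hT : CommL T) :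
    ∃ z, τ.lmul z = conjOp T :=
  h.exists_lmul_eq fun _ hS => hT.commR_conjOp.comp_comm h.normal h.semifinite hS

/-- The left representation reflects positivity. -/
theorem IsFNS.nonneg_of_lmul_nonneg (h : τ.IsFNS) {x : Elem N} (hx : 0 ≤ τ.lmulHom x) :
    0 ≤ x := by
  obtain ⟨b, hb⟩ := h.exists_lmul_eq (S := CFC.sqrt (τ.lmulHom x)) fun T hT =>
    (Commute.cfcₙ_nnreal (show Commute (τ.lmulHom x) T from (hT x).symm) NNReal.sqrt).eq
  change τ.lmulHom b = _ at hb
  have hx' : x = star b * b := h.injective (by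
    rw [map_mul, map_star, hb, (IsSelfAdjoint.of_nonneg (CFC.sqrt_nonneg (τ.lmulHom x))).star_eq,
      CFC.sqrt_mul_sqrt_self _ hx])
  rw [hx']
  exact star_mul_self_nonneg' b

theorem IsFNS.le_of_lmul_le (h : τ.IsFNS) {x y : Elem N} (hxy : τ.lmulHom x ≤ τ.lmulHom y) :
    x ≤ y := by
  rw [← sub_nonneg]
  exact h.nonneg_of_lmul_nonneg (by rwa [map_sub, sub_nonneg])

/-! ### The trace on the commutant -/

/-- Injectivity of the left representation leaves a single candidate in the infimum defining
`opTrace`. -/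
theorem IsFNS.opTrace_lmul (h : τ.IsFNS) {x : Elem N} (hx : 0 ≤ x) :
    τ.opTrace (τ.lmul x) = τ x := by
  refine le_antisymm (iInf₂_le_of_le x hx (iInf_le _ rfl)) ?_
  refine le_iInf₂ fun y _ => le_iInf fun hxy => ?_
  rw [h.injective hxy]

/-- The trace `T ↦ τ(J T J)` on the positive part of the commutant of the left multiplications. -/
def comTrace (T : τ.L2 →L[ℂ] τ.L2) : ℝ≥0∞ := τ.opTrace (conjOp T)

theorem IsFNS.exists_comTrace_eq (h : τ.IsFNS) {T : τ.L2 →L[ℂ] τ.L2} (hT : CommL T)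
    (hT0 : 0 ≤ T) : ∃ z, 0 ≤ z ∧ τ.lmulHom z = conjOp T ∧ comTrace T = τ z := by
  obtain ⟨z, hz⟩ := h.exists_lmul_eq_conjOp hT
  have hz0 : 0 ≤ z := h.nonneg_of_lmul_nonneg (by rw [lmulHom_apply, hz]; exact conjOp_nonneg hT0)
  exact ⟨z, hz0, hz, by rw [comTrace, ← hz, h.opTrace_lmul hz0]⟩

/-- Conjugation by J is multiplicative and respects adjoints, so TT* and T*T correspond to zz* and
z*z for one element z of N, where traciality of τ applies. -/
theorem IsFNS.comTrace_comp_adjoint (h : τ.IsFNS) {T : τ.L2 →L[ℂ] τ.L2} (hT : CommL T) :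
    comTrace (T.comp (ContinuousLinearMap.adjoint T)) =
      comTrace ((ContinuousLinearMap.adjoint T).comp T) := by
  obtain ⟨z, hz⟩ := h.exists_lmul_eq_conjOp hT
  have hz' : τ.lmulHom z = conjOp T := hz
  have hzs : τ.lmulHom (star z) = conjOp (ContinuousLinearMap.adjoint T) := by
    rw [← adjoint_conjOp, ← hz, adjoint_lmul, lmulHom_apply]
  have e1 : conjOp (T.comp (ContinuousLinearMap.adjoint T)) = τ.lmul (z * star z) := by
    rw [conjOp_comp, ← hz', ← hzs, ← lmulHom_apply, map_mul]; rfl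
  have e2 : conjOp ((ContinuousLinearMap.adjoint T).comp T) = τ.lmul (star z * z) := by
    rw [conjOp_comp, ← hz', ← hzs, ← lmulHom_apply, map_mul]; rfl
  have hp : 0 ≤ z * star z := by simpa using star_mul_self_nonneg' (star z)
  rw [comTrace, comTrace, e1, e2, h.opTrace_lmul hp,
    h.opTrace_lmul (star_mul_self_nonneg' _), τ.tracial]

theorem CommL.add {S T : τ.L2 →L[ℂ] τ.L2} (hS : CommL S) (hT : CommL T) : CommL (S + T) := by
  intro x
  rw [ContinuousLinearMap.add_comp, ContinuousLinearMap.comp_add, hS x, hT x]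

theorem CommL.zero : CommL (0 : τ.L2 →L[ℂ] τ.L2) := fun x => by
  rw [ContinuousLinearMap.zero_comp, ContinuousLinearMap.comp_zero]

theorem IsFNS.comTrace_add (h : τ.IsFNS) {S T : τ.L2 →L[ℂ] τ.L2} (hS : CommL S) (hS0 : 0 ≤ S)
    (hT : CommL T) (hT0 : 0 ≤ T) : comTrace (S + T) = comTrace S + comTrace T := by
  obtain ⟨y, hy, hyS, hy'⟩ := h.exists_comTrace_eq hS hS0
  obtain ⟨z, hz, hzT, hz'⟩ := h.exists_comTrace_eq hT hT0
  rw [hy', hz', ← τ.add_of_nonneg y z hy hz, comTrace, conjOp_add, ← hyS, ← hzT, ← map_add,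
    lmulHom_apply, h.opTrace_lmul (add_nonneg' hy hz)]

theorem IsFNS.comTrace_zero (h : τ.IsFNS) : comTrace (0 : τ.L2 →L[ℂ] τ.L2) = 0 := by
  have h0 : τ 0 = 0 := by simpa using τ.smul_of_nonneg 0 0 le_rfl
  rw [comTrace, conjOp_zero, ← map_zero τ.lmulHom, lmulHom_apply, h.opTrace_lmul le_rfl, h0]

theorem IsFNS.comTrace_mono (h : τ.IsFNS) {S T : τ.L2 →L[ℂ] τ.L2} (hS : CommL S) (hS0 : 0 ≤ S)
    (hT : CommL T) (hST : S ≤ T) : comTrace S ≤ comTrace T := by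
  obtain ⟨y, hy, hyS, hy'⟩ := h.exists_comTrace_eq hS hS0
  obtain ⟨z, hz, hzT, hz'⟩ := h.exists_comTrace_eq hT (hS0.trans hST)
  rw [hy', hz']
  refine τ.mono hy (h.le_of_lmul_le ?_)
  rw [hyS, hzT]
  refine le_of_qf_le (conjOp_nonneg hS0).isSelfAdjoint
    (conjOp_nonneg (hS0.trans hST)).isSelfAdjoint fun ξ => ?_
  rw [qf_conjOp, qf_conjOp]
  exact qf_mono hST _

-- Normality of the trace on the commutant. Conjugation by J replaces the form at ξ by the form at
-- Jξ, so increasing limits correspond to increasing limits in N. The supremum taken in N is the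
-- element representing the limit, by normality and injectivity of the left representation.
set_option maxHeartbeats 1000000 in
theorem IsFNS.comTrace_iSup (h : τ.IsFNS) {α : Type*} [Preorder α] [IsDirectedOrder α] [Nonempty α]
    {T : α → τ.L2 →L[ℂ] τ.L2} {T' : τ.L2 →L[ℂ] τ.L2} (hmono : Monotone T) (hT : ∀ i, CommL (T i))
    (hT0 : ∀ i, 0 ≤ T i) (hT' : CommL T') (hT0' : 0 ≤ T')
    (hlub : ∀ ξ, IsLUB (Set.range fun i => qf ξ (T i)) (qf ξ T')) :
    comTrace T' = ⨆ i, comTrace (T i) := by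
  obtain ⟨y, hyall⟩ := Classical.skolem.1 fun i => h.exists_comTrace_eq (hT i) (hT0 i)
  have hy := fun i => (hyall i).1
  have hyT := fun i => (hyall i).2.1
  have hy' := fun i => (hyall i).2.2
  obtain ⟨z, hz, hzT, hz'⟩ := h.exists_comTrace_eq hT' hT0'
  have hqy : ∀ i ξ, qf ξ (τ.lmulHom (y i)) = qf (τ.J ξ) (T i) := fun i ξ => by
    rw [hyT, qf_conjOp]
  have hqz : ∀ ξ, qf ξ (τ.lmulHom z) = qf (τ.J ξ) T' := fun ξ => by rw [hzT, qf_conjOp]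
  have hysa : ∀ i, IsSelfAdjoint (τ.lmulHom (y i)) := fun i => (rep_nonneg _ (hy i)).isSelfAdjoint
  have hzsa : IsSelfAdjoint (τ.lmulHom z) := (rep_nonneg _ hz).isSelfAdjoint
  have hymono : Monotone y := by
    intro i j hij
    refine h.le_of_lmul_le (le_of_qf_le (hysa i) (hysa j) fun ξ => ?_)
    rw [hqy, hqy]
    exact qf_mono (hmono hij) _
  have hyz : ∀ i, y i ≤ z := by
    intro i
    refine h.le_of_lmul_le (le_of_qf_le (hysa i) hzsa fun ξ => ?_)
    rw [hqy, hqz]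
    exact (hlub _).1 ⟨i, rfl⟩
  have hpos : ∀ d ∈ Set.range y, 0 ≤ d := by rintro _ ⟨i, rfl⟩; exact hy i
  have hdir : DirectedOn (· ≤ ·) (Set.range y) :=
    directedOn_range.2 hymono.directed_le
  obtain ⟨x, hx, hxlub, -⟩ := Elem.exists_isLUB hpos (Set.range_nonempty y) hdir (u := z) (by
    rintro _ ⟨i, rfl⟩; exact hyz i)
  have hxz : x = z := h.injective (eq_of_qf_eq (rep_nonneg _ hx).isSelfAdjoint
    hzsa fun ξ => by
      have h1 := h.isNormalRep.isLUB_qf hpos (Set.range_nonempty y) hdir hxlub ξ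
      rw [← Set.range_comp] at h1
      have h2 := hlub (τ.J ξ)
      simp only [← hqy, ← hqz] at h2
      exact h1.unique h2)
  rw [hz', h.normal _ hpos (Set.range_nonempty y) hdir z (hxz ▸ hxlub), iSup_range]
  exact iSup_congr fun i => (hy' i).symm

theorem IsFNS.comTrace_sum (h : τ.IsFNS) {α : Type*} {T : α → τ.L2 →L[ℂ] τ.L2}
    (hT : ∀ i, CommL (T i)) (hT0 : ∀ i, 0 ≤ T i) (s : Finset α) :
    CommL (∑ i ∈ s, T i) ∧ 0 ≤ ∑ i ∈ s, T i ∧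
      comTrace (∑ i ∈ s, T i) = ∑ i ∈ s, comTrace (T i) := by
  classical
  induction s using Finset.induction_on with
  | empty => simpa using ⟨CommL.zero, h.comTrace_zero⟩
  | insert a s ha ih =>
    rw [Finset.sum_insert ha, Finset.sum_insert ha]
    exact ⟨(hT a).add ih.1, add_nonneg (hT0 a) ih.2.1,
      by rw [h.comTrace_add (hT a) (hT0 a) ih.1 ih.2.1, ih.2.2]⟩

/-- The finite partial sums form an increasing net converging weakly to T', so countability of the
index set plays no role. -/
theorem IsFNS.comTrace_hasSum (h : τ.IsFNS) {α : Type*}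
    {T : α → τ.L2 →L[ℂ] τ.L2} {T' : τ.L2 →L[ℂ] τ.L2} (hT : ∀ i, CommL (T i))
    (hT0 : ∀ i, 0 ≤ T i) (hT' : CommL T') (hT0' : 0 ≤ T')
    (hsum : ∀ ξ, HasSum (fun i => qf ξ (T i)) (qf ξ T')) :
    comTrace T' = ∑' i, comTrace (T i) := by
  classical
  have hsum' : ∀ s : Finset α, _ := fun s => h.comTrace_sum hT hT0 s
  have hmono : Monotone fun s : Finset α => ∑ i ∈ s, T i := fun s t hst =>
    Finset.sum_le_sum_of_subset_of_nonneg hst fun i _ _ => hT0 i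
  rw [ENNReal.tsum_eq_iSup_sum, h.comTrace_iSup (T := fun s : Finset α => ∑ i ∈ s, T i)
    hmono (fun s => (hsum' s).1) (fun s => (hsum' s).2.1) hT' hT0' fun ξ => ?_]
  · exact iSup_congr fun s => (hsum' s).2.2
  · have h1 := hsum ξ
    refine isLUB_of_tendsto_atTop (fun s t hst => qf_mono (hmono hst) ξ) ?_
    simp only [map_sum]
    exact h1

/-! ### Independence of the frame -/

section Exchange

variable {H : Type u} [NormedAddCommGroup H] [InnerProductSpace ℂ H] [CompleteSpace H]
  {π : Elem N →⋆ₐ[ℂ] (H →L[ℂ] H)}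

theorem qf_conj {K : Type*} [NormedAddCommGroup K] [InnerProductSpace ℂ K] [CompleteSpace K]
    (v : H →L[ℂ] K) (Z : H →L[ℂ] H) (ξ : K) :
    qf ξ (v.comp (Z.comp (ContinuousLinearMap.adjoint v))) =
      qf (ContinuousLinearMap.adjoint v ξ) Z := by
  rw [qf_apply, qf_apply, ContinuousLinearMap.comp_apply, ContinuousLinearMap.comp_apply,
    ContinuousLinearMap.adjoint_inner_right]

theorem qf_comp_adjoint {K : Type*} [NormedAddCommGroup K] [InnerProductSpace ℂ K]
    [CompleteSpace K] (v : H →L[ℂ] K) (ξ : K) :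
    qf ξ (v.comp (ContinuousLinearMap.adjoint v)) = ‖ContinuousLinearMap.adjoint v ξ‖ ^ 2 := by
  rw [← qf_one, ← qf_conj]; rfl

theorem qf_adjoint_comp {K : Type*} [NormedAddCommGroup K] [InnerProductSpace ℂ K]
    [CompleteSpace K] (v : H →L[ℂ] K) (ξ : H) :
    qf ξ ((ContinuousLinearMap.adjoint v).comp v) = ‖v ξ‖ ^ 2 := by
  conv_lhs => rw [← ContinuousLinearMap.adjoint_adjoint v]
  rw [ContinuousLinearMap.adjoint_adjoint (ContinuousLinearMap.adjoint v)]
  rw [← ContinuousLinearMap.adjoint_adjoint v, ContinuousLinearMap.adjoint_adjoint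
    (ContinuousLinearMap.adjoint v), qf_comp_adjoint]

theorem comp_adjoint_nonneg {K : Type*} [NormedAddCommGroup K] [InnerProductSpace ℂ K]
    [CompleteSpace K] (v : H →L[ℂ] K) : 0 ≤ v.comp (ContinuousLinearMap.adjoint v) := by
  refine nonneg_of_qf_nonneg ?_ fun ξ => by rw [qf_comp_adjoint]; positivity
  rw [IsSelfAdjoint, ContinuousLinearMap.star_eq_adjoint, ContinuousLinearMap.adjoint_comp,
    ContinuousLinearMap.adjoint_adjoint]

theorem conj_comp_nonneg {K : Type*} [NormedAddCommGroup K] [InnerProductSpace ℂ K]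
    [CompleteSpace K] (v : H →L[ℂ] K) {Z : H →L[ℂ] H} (hZ : 0 ≤ Z) :
    0 ≤ v.comp (Z.comp (ContinuousLinearMap.adjoint v)) := by
  refine nonneg_of_qf_nonneg ?_ fun ξ => by rw [qf_conj]; exact qf_nonneg hZ _
  have := hZ.isSelfAdjoint.star_eq
  rw [ContinuousLinearMap.star_eq_adjoint] at this
  rw [IsSelfAdjoint, ContinuousLinearMap.star_eq_adjoint, ContinuousLinearMap.adjoint_comp,
    ContinuousLinearMap.adjoint_comp, ContinuousLinearMap.adjoint_adjoint, this]
  rfl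

/-- The total trace `∑ τ'(cᵢ cᵢ*)` of a family of intertwiners depends only on `Z = ∑ cᵢ* cᵢ`. -/
theorem IsFNS.tsum_comTrace_eq (h : τ.IsFNS) {κ ι : Type*} {v : κ → H →L[ℂ] τ.L2}
    (hv : ∀ j, Intertwines π τ.lmulHom (v j)) (hfr : IsFrame v) {c : ι → H →L[ℂ] τ.L2}
    (hc : ∀ i, Intertwines π τ.lmulHom (c i)) {Z : H →L[ℂ] H} (hZ : Intertwines π π Z)
    (hZ0 : 0 ≤ Z) (hsum : ∀ ξ, HasSum (fun i => ‖c i ξ‖ ^ 2) (qf ξ Z)) :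
    ∑' i, comTrace ((c i).comp (ContinuousLinearMap.adjoint (c i))) =
      ∑' j, comTrace ((v j).comp (Z.comp (ContinuousLinearMap.adjoint (v j)))) := by
  have hT : ∀ i j, CommL ((v j).comp (ContinuousLinearMap.adjoint (c i))) := fun i j =>
    (hv j).comp (hc i).adjoint
  have hTT : ∀ i j, CommL (((v j).comp (ContinuousLinearMap.adjoint (c i))).comp
      (ContinuousLinearMap.adjoint ((v j).comp (ContinuousLinearMap.adjoint (c i))))) := fun i j =>
    (hT i j).comp (hT i j).adjoint
  have hTT' : ∀ i j, CommL ((ContinuousLinearMap.adjoint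
      ((v j).comp (ContinuousLinearMap.adjoint (c i)))).comp
      ((v j).comp (ContinuousLinearMap.adjoint (c i)))) := fun i j =>
    (hT i j).adjoint.comp (hT i j)
  -- The relation ∑ v_j* v_j = 1 is inserted between c_i and c_i*.
  have h1 : ∀ i, comTrace ((c i).comp (ContinuousLinearMap.adjoint (c i))) =
      ∑' j, comTrace ((ContinuousLinearMap.adjoint
        ((v j).comp (ContinuousLinearMap.adjoint (c i)))).comp
        ((v j).comp (ContinuousLinearMap.adjoint (c i)))) := by
    intro i
    refine h.comTrace_hasSum (hTT' i) (fun j => ?_) ((hc i).comp (hc i).adjoint)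
      (comp_adjoint_nonneg _) fun ξ => ?_
    · have := comp_adjoint_nonneg
        (ContinuousLinearMap.adjoint ((v j).comp (ContinuousLinearMap.adjoint (c i))))
      rwa [ContinuousLinearMap.adjoint_adjoint] at this
    · simp only [qf_adjoint_comp, qf_comp_adjoint]
      exact hfr _
  -- Here Z is expanded as ∑ c_i* c_i. The two double sums differ, term by term, only by the order
  -- of v_j c_i* and its adjoint.
  have h2 : ∀ j, comTrace ((v j).comp (Z.comp (ContinuousLinearMap.adjoint (v j)))) =
      ∑' i, comTrace (((v j).comp (ContinuousLinearMap.adjoint (c i))).comp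
      (ContinuousLinearMap.adjoint ((v j).comp (ContinuousLinearMap.adjoint (c i))))) := by
    intro j
    refine h.comTrace_hasSum (fun i => hTT i j) (fun i => comp_adjoint_nonneg _)
      ((hv j).comp (hZ.comp (hv j).adjoint)) (conj_comp_nonneg _ hZ0) fun ξ => ?_
    rw [qf_conj]
    convert hsum (ContinuousLinearMap.adjoint (v j) ξ) using 2 with i
    rw [qf_comp_adjoint, ContinuousLinearMap.adjoint_comp, ContinuousLinearMap.adjoint_adjoint]
    rfl
  simp only [h1, h2]
  rw [ENNReal.tsum_comm]
  simp only [fun i j => h.comTrace_comp_adjoint (hT i j)]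

theorem intertwines_one : Intertwines π π 1 := fun _ => rfl

theorem IsFNS.tsum_comTrace_eq_of_isFrame (h : τ.IsFNS) {κ ι : Type*} {v : κ → H →L[ℂ] τ.L2}
    (hv : ∀ j, Intertwines π τ.lmulHom (v j)) (hfr : IsFrame v) {c : ι → H →L[ℂ] τ.L2}
    (hc : ∀ i, Intertwines π τ.lmulHom (c i)) (hcf : IsFrame c) :
    ∑' i, comTrace ((c i).comp (ContinuousLinearMap.adjoint (c i))) =
      ∑' j, comTrace ((v j).comp (ContinuousLinearMap.adjoint (v j))) := by
  have h1 : (0 : H →L[ℂ] H) ≤ 1 := by simp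
  rw [h.tsum_comTrace_eq hv hfr hc intertwines_one h1 fun ξ => by rw [qf_one]; exact hcf ξ]
  simp only [ContinuousLinearMap.one_def, ContinuousLinearMap.id_comp]

theorem tensorTrace_conjRangeProj {ι : Type w} (V : H →ₗᵢ[ℂ] τ.Amp ι) :
    τ.tensorTrace (τ.conjRangeProj V) =
      ∑' i, comTrace (((τ.coord i).comp V.toContinuousLinearMap).comp
        (ContinuousLinearMap.adjoint ((τ.coord i).comp V.toContinuousLinearMap))) :=
  tsum_congr fun i => by rw [matrixEntry_conjRangeProj]; rfl

theorem IsFNS.memTensor_conjRangeProj (h : τ.IsFNS) {ι : Type w} {V : H →ₗᵢ[ℂ] τ.Amp ι}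
    (hV : τ.IsStandardIntertwiner π V) : τ.MemTensor (τ.conjRangeProj V) := by
  intro i j
  rw [isStandardIntertwiner_iff] at hV
  rw [matrixEntry_conjRangeProj]
  exact h.exists_lmul_eq_conjOp ((hV i).comp (hV j).adjoint)

theorem IsFNS.exists_isStandardIntertwiner (h : τ.IsFNS) (hπ : IsNormalRep π) :
    ∃ (ι : Type u) (V : H →ₗᵢ[ℂ] τ.Amp ι), τ.IsStandardIntertwiner π V := by
  obtain ⟨ι, v, hv, hfr⟩ := exists_frame h.isNormalRep h.injective hπ
  obtain ⟨V, hV⟩ := exists_isometry_of_isFrame hfr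
  exact ⟨ι, V, (isStandardIntertwiner_iff V).2 fun i => by rw [hV]; exact hv i⟩

/-- The dimension may be computed from any frame. -/
theorem IsFNS.dim_eq (h : τ.IsFNS) (hπ : IsNormalRep π) {κ : Type*} {v : κ → H →L[ℂ] τ.L2}
    (hv : ∀ j, Intertwines π τ.lmulHom (v j)) (hfr : IsFrame v) :
    τ.dim π = ∑' j, comTrace ((v j).comp (ContinuousLinearMap.adjoint (v j))) := by
  obtain ⟨ι, V, hV⟩ := h.exists_isStandardIntertwiner hπ
  have key : ∀ (ι : Type u) (V : H →ₗᵢ[ℂ] τ.Amp ι), τ.IsStandardIntertwiner π V →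
      τ.tensorTrace (τ.conjRangeProj V) =
        ∑' j, comTrace ((v j).comp (ContinuousLinearMap.adjoint (v j))) := fun ι V hV => by
    rw [tensorTrace_conjRangeProj]
    exact h.tsum_comTrace_eq_of_isFrame hv hfr ((isStandardIntertwiner_iff V).1 hV)
      (isFrame_coord V)
  refine le_antisymm ?_ ?_
  · rw [← key ι V hV]
    exact iInf₂_le_of_le ι V (iInf_le _ hV)
  · exact le_iInf fun ι => le_iInf₂ fun V hV => (key ι V hV).ge

/-- The infimum defining `dim` uses index types from the universe of H; comparison through frames
covers index types from any universe. -/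
theorem IsFNS.dim_eq_tensorTrace (h : τ.IsFNS) (hπ : IsNormalRep π) {ι : Type w}
    {V : H →ₗᵢ[ℂ] τ.Amp ι} (hV : τ.IsStandardIntertwiner π V) :
    τ.dim π = τ.tensorTrace (τ.conjRangeProj V) := by
  rw [tensorTrace_conjRangeProj]
  exact h.dim_eq hπ ((isStandardIntertwiner_iff V).1 hV) (isFrame_coord V)

end Exchange

end TracialWeight

end VNDim

namespace VNDim

variable {H₀ : Type u₀} [NormedAddCommGroup H₀] [InnerProductSpace ℂ H₀] [CompleteSpace H₀]
  {N : VonNeumannAlgebra H₀}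
  {H : Type u} [NormedAddCommGroup H] [InnerProductSpace ℂ H] [CompleteSpace H]
  {π : Elem N →⋆ₐ[ℂ] (H →L[ℂ] H)}

/-! ### Corners of a von Neumann algebra and of its normal representations -/

section CornerAlgebra

theorem qf_extend (e : StarProj H) (ξ : H) (y : e.space →L[ℂ] e.space) :
    qf ξ (e.extend y) = qf (e.proj ξ) y := by
  rw [qf_apply, qf_apply, StarProj.extend, ContinuousLinearMap.comp_apply,
    ContinuousLinearMap.comp_apply, ← ContinuousLinearMap.adjoint_inner_right]
  rfl

theorem compress_extend (e : StarProj H) (y : e.space →L[ℂ] e.space) :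
    e.compress (e.extend y) = y := by
  ext1 ξ
  simp [StarProj.compress, StarProj.extend, StarProj.proj_incl_apply]

theorem extend_compress (e : StarProj H) (x : H →L[ℂ] H) :
    e.extend (e.compress x) = e.1 * x * e.1 := by
  ext1 ξ
  simp [StarProj.compress, StarProj.extend, StarProj.incl_proj_apply]

theorem cornerIncl_injective (p : Proj N) : Function.Injective (cornerIncl p) := by
  intro x y h
  have := congrArg (fun z : Elem N => p.op.compress z.1) h
  simp only [cornerIncl, compress_extend] at this
  exact Subtype.ext this

theorem cornerIncl_mono (p : Proj N) {x y : Elem (corner p)} (h : x ≤ y) :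
    cornerIncl p x ≤ cornerIncl p y := by
  have h1 := cornerIncl_nonneg p (sub_nonneg' h)
  have h2 := cornerIncl_add p (y - x) x
  rw [sub_add_cancel] at h2
  rw [h2]
  exact le_add_of_nonneg_left h1

theorem Proj.star_eq (p : Proj N) : star p.1 = p.1 := p.2.isSelfAdjoint.star_eq

theorem Proj.mul_self (p : Proj N) : p.1 * p.1 = p.1 := p.2.isIdempotentElem

theorem Proj.nonneg (p : Proj N) : 0 ≤ p.1 := by
  rw [← p.mul_self]
  nth_rw 1 [← p.star_eq]
  exact star_mul_self_nonneg' _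

theorem proj_mul_cornerIncl (p : Proj N) (y : Elem (corner p)) :
    p.1 * cornerIncl p y = cornerIncl p y := Subtype.ext (p.op.mul_extend y.1)

theorem cornerIncl_mul_proj (p : Proj N) (y : Elem (corner p)) :
    cornerIncl p y * p.1 = cornerIncl p y := Subtype.ext (p.op.extend_mul' y.1)

/-- The compression `x ↦ p x p` from `N` to `pNp`. -/
def cornerCompress (p : Proj N) (x : Elem N) : Elem (corner p) :=
  ⟨p.op.compress x.1, by
    change p.op.extend (p.op.compress x.1) ∈ N
    rw [extend_compress]
    exact mul_mem (mul_mem p.op_mem x.2) p.op_mem⟩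

theorem cornerIncl_cornerCompress (p : Proj N) (x : Elem N) :
    cornerIncl p (cornerCompress p x) = p.1 * x * p.1 :=
  Subtype.ext (extend_compress p.op x.1)

theorem cornerCompress_nonneg (p : Proj N) {x : Elem N} (hx : 0 ≤ x) :
    0 ≤ cornerCompress p x := by
  have hx' : (0 : H₀ →L[ℂ] H₀) ≤ x := hx
  change 0 ≤ p.op.compress x.1
  rw [ContinuousLinearMap.nonneg_iff_isPositive] at hx' ⊢
  exact hx'.adjoint_conj p.op.incl

/-- Suprema are weak limits, and the form at ξ of an operator extended by zero is its form at the
projection of ξ. Hence the inclusion of the corner is normal. -/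
theorem isLUB_cornerIncl (p : Proj N) {D : Set (Elem (corner p))} (hD : ∀ d ∈ D, 0 ≤ d)
    (hne : D.Nonempty) (hdir : DirectedOn (· ≤ ·) D) {x : Elem (corner p)} (hx : IsLUB D x) :
    IsLUB (cornerIncl p '' D) (cornerIncl p x) := by
  have hx0 : 0 ≤ x := by
    obtain ⟨d, hd⟩ := hne
    exact (hD d hd).trans (hx.1 hd)
  refine Elem.isLUB_of_isLUB_qf ?_ (hne.image _) (cornerIncl_nonneg p hx0) fun ξ => ?_
  · rintro _ ⟨d, hd, rfl⟩; exact cornerIncl_nonneg p (hD d hd)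
  · rw [Set.image_image]
    simpa only [cornerIncl, qf_extend] using Elem.isLUB_qf hD hne hdir hx (p.op.proj ξ)

theorem directedOn_cornerIncl (p : Proj N) {D : Set (Elem (corner p))}
    (hdir : DirectedOn (· ≤ ·) D) : DirectedOn (· ≤ ·) (cornerIncl p '' D) := by
  rintro _ ⟨a, ha, rfl⟩ _ ⟨b, hb, rfl⟩
  obtain ⟨c, hc, h1, h2⟩ := hdir a ha b hb
  exact ⟨_, ⟨c, hc, rfl⟩, cornerIncl_mono p h1, cornerIncl_mono p h2⟩

theorem qf_cornerRep (p : Proj N) (y : Elem (corner p)) (ξ : (p.map π).space) :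
    qf ξ (cornerRep π p y) = qf (ξ : H) (π (cornerIncl p y)) := by
  rw [qf_apply, qf_apply]
  change (inner ℂ ((p.map π).proj (π (cornerIncl p y) ((p.map π).incl ξ))) ξ).re = _
  rw [StarProj.proj, ContinuousLinearMap.adjoint_inner_left]
  rfl

theorem coe_cornerRep (p : Proj N) (y : Elem (corner p)) (ξ : (p.map π).space) :
    (cornerRep π p y ξ : H) = π (cornerIncl p y) ξ := by
  change ((p.map π).proj (π (cornerIncl p y) (ξ : H)) : H) = _
  rw [StarProj.proj_apply]
  change π p.1 (π (cornerIncl p y) (ξ : H)) = _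
  rw [← mul_apply_eq_comp, ← map_mul, proj_mul_cornerIncl]

theorem IsNormalRep.cornerRep (hπ : IsNormalRep π) (p : Proj N) :
    IsNormalRep (VNDim.cornerRep π p) :=
  isNormalRep_of_isLUB_qf fun D hD hne hdir x hx ξ => by
    have h := hπ.isLUB_qf (by rintro _ ⟨d, hd, rfl⟩; exact cornerIncl_nonneg p (hD d hd))
      (hne.image _) (directedOn_cornerIncl p hdir) (isLUB_cornerIncl p hD hne hdir hx) (ξ : H)
    rw [Set.image_image] at h
    simpa only [qf_cornerRep] using h

end CornerAlgebra

/-! ### The trace and the L²-space of a corner. -/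

namespace TracialWeight

variable {τ : TracialWeight N}

theorem cornerWeight_apply (p : Proj N) (y : Elem (corner p)) :
    τ.cornerWeight p y = (τ p.1)⁻¹ * τ (cornerIncl p y) := rfl

theorem IsFNS.cornerWeight (h : τ.IsFNS) (p : Proj N) (hp0 : τ p.1 ≠ 0) (hp : τ p.1 < ∞) :
    (τ.cornerWeight p).IsFNS where
  faithful y hy h0 := by
    rw [cornerWeight_apply, mul_eq_zero, ENNReal.inv_eq_zero] at h0
    have := h.faithful _ (cornerIncl_nonneg p hy) (h0.resolve_left hp.ne)
    refine cornerIncl_injective p (this.trans ?_)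
    simpa using (cornerIncl_smul p 0 0).symm
  normal D hD hne hdir x hx := by
    rw [cornerWeight_apply,
      h.normal _ (by rintro _ ⟨d, hd, rfl⟩; exact cornerIncl_nonneg p (hD d hd))
      (hne.image _) (directedOn_cornerIncl p hdir) _ (isLUB_cornerIncl p hD hne hdir hx),
      iSup_image]
    simp only [ENNReal.mul_iSup]
    rfl
  semifinite x hx hx0 := by
    -- The weight is finite on the corner, so x itself serves: in N, s*s ≤ ‖s‖² p.
    refine ⟨x, hx, le_rfl, hx0, ?_⟩
    rw [cornerWeight_apply]
    refine ENNReal.mul_lt_top (ENNReal.inv_lt_top.2 (pos_iff_ne_zero.2 hp0)) ?_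
    obtain ⟨s, rfl⟩ := Elem.exists_eq_star_mul_self hx
    have h1 := conj_le (cornerIncl p s) p.1
    rw [cornerIncl_mul_proj, p.star_eq, p.mul_self] at h1
    rw [cornerIncl_mul, cornerIncl_star]
    refine (τ.mono (star_mul_self_nonneg' _) h1).trans_lt ?_
    rw [τ.smul_of_nonneg _ _ p.nonneg]
    exact ENNReal.mul_lt_top (by simp) hp

theorem cornerIncl_lt_top {p : Proj N} (hp : τ p.1 < ∞) (x : (τ.cornerWeight p).PreL2) :
    τ (star (cornerIncl p (PreL2.val _ x)) * cornerIncl p (PreL2.val _ x)) < ∞ := by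
  have h := PreL2.lt_top _ x
  rw [cornerWeight_apply, cornerIncl_mul, cornerIncl_star] at h
  by_contra hcon
  rw [not_lt, top_le_iff] at hcon
  rw [hcon, ENNReal.mul_top (ENNReal.inv_ne_zero.2 hp.ne)] at h
  exact lt_irrefl _ h

/-- The inclusion of `{x ∈ pNp : τ(x*x) < ∞}` into `{x ∈ N : τ(x*x) < ∞}`. -/
def cornerVec {p : Proj N} (hp : τ p.1 < ∞) (x : (τ.cornerWeight p).PreL2) : τ.PreL2 :=
  PreL2.mk τ (cornerIncl p (PreL2.val _ x)) (cornerIncl_lt_top hp x)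

theorem quad_cornerVec {p : Proj N} (hp0 : τ p.1 ≠ 0) (hp : τ p.1 < ∞)
    (x : (τ.cornerWeight p).PreL2) :
    τ.quad (cornerVec hp x) = (τ p.1).toReal * (τ.cornerWeight p).quad x := by
  have ht : (τ p.1).toReal ≠ 0 := (ENNReal.toReal_pos hp0 hp.ne).ne'
  rw [quad, quad, cornerWeight_apply, ENNReal.toReal_mul, ENNReal.toReal_inv,
    mul_inv_cancel_left₀ ht, cornerIncl_mul, cornerIncl_star]
  rfl

/-- The isometric embedding `L²(pNp,τ_p) → L²(N,τ)`, `x ↦ τ(p)^{-1/2} x`. -/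
theorem exists_cornerEmbedding {p : Proj N} (hp0 : τ p.1 ≠ 0) (hp : τ p.1 < ∞) :
    ∃ U : (τ.cornerWeight p).L2 →ₗᵢ[ℂ] τ.L2, ∀ x,
      U (vec _ x) = ((Real.sqrt (τ p.1).toReal)⁻¹ : ℂ) • τ.vec (cornerVec hp x) := by
  have ht : 0 < (τ p.1).toReal := ENNReal.toReal_pos hp0 hp.ne
  let g : (τ.cornerWeight p).PreL2 →ₗ[ℂ] τ.L2 :=
    { toFun := fun x => ((Real.sqrt (τ p.1).toReal)⁻¹ : ℂ) • τ.vec (cornerVec hp x)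
      map_add' := fun x y => by
        have : cornerVec hp (x + y) = cornerVec hp x + cornerVec hp y :=
          PreL2.ext (by simp [cornerVec, cornerIncl_add])
        rw [this, ← smul_add]
        exact congrArg _ (UniformSpace.Completion.coe_add _ _)
      map_smul' := fun c x => by
        have : cornerVec hp (c • x) = c • cornerVec hp x :=
          PreL2.ext (by simp [cornerVec, cornerIncl_smul])
        rw [this, RingHom.id_apply, smul_comm c]
        exact congrArg _ (UniformSpace.Completion.coe_smul _ _) }
  let f : (τ.cornerWeight p).PreL2 →ₗ[ℂ] (τ.cornerWeight p).L2 :=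
    (UniformSpace.Completion.toComplL : (τ.cornerWeight p).PreL2 →L[ℂ] (τ.cornerWeight p).L2)
  have hgf : ∀ x, ‖g x‖ = ‖f x‖ := fun x => by
    change ‖((Real.sqrt (τ p.1).toReal)⁻¹ : ℂ) • τ.vec (cornerVec hp x)‖ = ‖vec _ x‖
    rw [← sq_eq_sq₀ (norm_nonneg _) (norm_nonneg _), norm_smul, mul_pow, norm_vec_sq, norm_vec_sq,
      quad_cornerVec hp0, norm_inv, Complex.norm_real, Real.norm_eq_abs, inv_pow, sq_abs,
      Real.sq_sqrt ht.le, inv_mul_cancel_left₀ ht.ne']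
  have hdense : DenseRange f := denseRange_vec
  have hb : ∀ x, ‖g x‖ ≤ 1 * ‖f x‖ := fun x => by rw [one_mul, hgf]
  have hU : ∀ x, g.extendOfNorm f (f x) = g x := fun x =>
    LinearMap.extendOfNorm_eq hdense ⟨1, hb⟩ x
  refine ⟨⟨(g.extendOfNorm f : (τ.cornerWeight p).L2 →ₗ[ℂ] τ.L2), fun ξ => ?_⟩, fun x => hU x⟩
  refine eq_of_eq_vec (f := fun ξ => ‖g.extendOfNorm f ξ‖) (g := fun ξ => ‖ξ‖) (by fun_prop)
    (by fun_prop) (fun x => ?_) ξ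
  exact (congrArg norm (hU x)).trans (hgf x)

/-! ### The central support of a projection in a representation -/

variable (π) in
/-- The closed submodule `[π(N) π(p) H]`. -/
def cyclicSpace (p : Proj N) : Submodule ℂ H :=
  (Submodule.span ℂ (Set.range fun q : Elem N × H => π q.1 (π p.1 q.2))).topologicalClosure

instance (p : Proj N) : CompleteSpace (cyclicSpace π p) :=
  (Submodule.isClosed_topologicalClosure _).completeSpace_coe

variable (π) in
/-- The projection onto `[π(N) π(p) H]`. -/
def cyclicProj (p : Proj N) : H →L[ℂ] H := (cyclicSpace π p).starProjection

theorem mem_cyclicSpace (p : Proj N) (x : Elem N) (ξ : H) : π x (π p.1 ξ) ∈ cyclicSpace π p :=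
  Submodule.le_topologicalClosure _ (Submodule.subset_span ⟨(x, ξ), rfl⟩)

theorem rep_mem_cyclicSpace (p : Proj N) (x : Elem N) {ξ : H} (hξ : ξ ∈ cyclicSpace π p) :
    π x ξ ∈ cyclicSpace π p := by
  have hle : cyclicSpace π p ≤ (cyclicSpace π p).comap (π x : H →ₗ[ℂ] H) := by
    refine Submodule.topologicalClosure_minimal _ (Submodule.span_le.2 ?_) ?_
    · rintro _ ⟨⟨y, η⟩, rfl⟩
      change π x (π y (π p.1 η)) ∈ cyclicSpace π p
      rw [← mul_apply_eq_comp, ← map_mul]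
      exact mem_cyclicSpace p _ _
    · exact IsClosed.preimage (π x).continuous
        (Submodule.isClosed_topologicalClosure (Submodule.span ℂ _))
  exact hle hξ

theorem rep_mem_cyclicSpace_orthogonal (p : Proj N) (x : Elem N) {ξ : H}
    (hξ : ξ ∈ (cyclicSpace π p)ᗮ) : π x ξ ∈ (cyclicSpace π p)ᗮ := by
  rw [Submodule.mem_orthogonal] at hξ ⊢
  intro η hη
  rw [← ContinuousLinearMap.adjoint_inner_left, ← ContinuousLinearMap.star_eq_adjoint, ← map_star]
  exact hξ _ (rep_mem_cyclicSpace p (star x) hη)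

/-- The space [π(N)π(p)H] is invariant and, N being closed under adjoints, so is its complement. -/
theorem intertwines_cyclicProj (p : Proj N) : Intertwines π π (cyclicProj π p) := by
  intro x
  ext1 ξ
  have h := (cyclicSpace π p).starProjection_apply_mem ξ
  have h' := (cyclicSpace π p).sub_starProjection_mem_orthogonal ξ
  have e : π x ξ = π x ((cyclicSpace π p).starProjection ξ) +
      π x (ξ - (cyclicSpace π p).starProjection ξ) := by rw [← map_add]; simp
  rw [ContinuousLinearMap.comp_apply, ContinuousLinearMap.comp_apply, cyclicProj, e, map_add,
    Submodule.starProjection_eq_self_iff.2 (rep_mem_cyclicSpace p x h),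
    (Submodule.starProjection_apply_eq_zero_iff _).2 (rep_mem_cyclicSpace_orthogonal p x h'),
    add_zero]

theorem qf_cyclicProj (p : Proj N) (ξ : H) : qf ξ (cyclicProj π p) = ‖cyclicProj π p ξ‖ ^ 2 := by
  have h : IsStarProjection (cyclicProj π p) := isStarProjection_starProjection
  rw [← qf_star_mul_self, h.isSelfAdjoint.star_eq, h.isIdempotentElem.eq]

theorem cyclicProj_nonneg (p : Proj N) : 0 ≤ cyclicProj π p :=
  (isStarProjection_starProjection (U := cyclicSpace π p)).nonneg

theorem cyclicProj_le_one (p : Proj N) : cyclicProj π p ≤ 1 :=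
  (isStarProjection_starProjection (U := cyclicSpace π p)).le_one

/-- The Bessel bound makes the c_i the coordinates of a contraction W, and the Parseval identity
holds exactly where ‖Wξ‖ = ‖ξ‖. This lets the identity pass from a dense subspace to its closure. -/
theorem isClosed_setOf_hasSum_norm_sq {ι : Type w} {c : ι → H →L[ℂ] τ.L2}
    (hc : ∀ (s : Finset ι) ξ, ∑ i ∈ s, ‖c i ξ‖ ^ 2 ≤ ‖ξ‖ ^ 2) :
    IsClosed {ξ | HasSum (fun i => ‖c i ξ‖ ^ 2) (‖ξ‖ ^ 2)} := by
  have hs : ∀ ξ, Summable fun i => ‖c i ξ‖ ^ 2 := fun ξ =>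
    summable_of_sum_le (fun i => by positivity) fun s => hc s ξ
  let V : H →ₗ[ℂ] τ.Amp ι :=
    { toFun := fun ξ => ⟨fun i => c i ξ, memℓp_gen (by simpa using hs ξ)⟩
      map_add' := fun ξ η => by ext i; exact map_add (c i) ξ η
      map_smul' := fun a ξ => by ext i; exact map_smul (c i) a ξ }
  have hV : ∀ ξ i, τ.coord i (V ξ) = c i ξ := fun ξ i => by rw [coord_apply]; rfl
  have hn : ∀ ξ, HasSum (fun i => ‖c i ξ‖ ^ 2) (‖V ξ‖ ^ 2) := fun ξ => by
    simpa only [hV] using hasSum_norm_coord (V ξ)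
  let W : H →L[ℂ] τ.Amp ι := V.mkContinuous 1 fun ξ => by
    rw [one_mul, ← sq_le_sq₀ (norm_nonneg _) (norm_nonneg _), ← (hn ξ).tsum_eq]
    exact (hs ξ).tsum_le_of_sum_le fun s => hc s ξ
  have : {ξ | HasSum (fun i => ‖c i ξ‖ ^ 2) (‖ξ‖ ^ 2)} = {ξ | ‖W ξ‖ = ‖ξ‖} := by
    ext ξ
    rw [Set.mem_ofPred_eq, Set.mem_ofPred_eq, ← sq_eq_sq₀ (norm_nonneg _) (norm_nonneg _)]
    exact ⟨fun h => (hn ξ).unique h, fun h => h ▸ hn ξ⟩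
  rw [this]
  exact isClosed_eq (by fun_prop) (by fun_prop)

theorem inner_rep_left {K : Type*} [NormedAddCommGroup K] [InnerProductSpace ℂ K]
    [CompleteSpace K] (π' : Elem N →⋆ₐ[ℂ] (K →L[ℂ] K)) (x : Elem N) (ξ η : K) :
    inner ℂ (π' x ξ) η = inner ℂ ξ (π' (star x) η) := by
  rw [map_star, ContinuousLinearMap.star_eq_adjoint, ContinuousLinearMap.adjoint_inner_right]

/-- Moving x to the other side and absorbing p reduces inner products of generators of [π(N)π(p)H]
to inner products of vectors of π(p)H, where the corner frame is available. It is used for the c_i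
and, with T = 1, for the limit. -/
theorem Intertwines.inner_rep_rep {K : Type*} [NormedAddCommGroup K] [InnerProductSpace ℂ K]
    [CompleteSpace K] {π' : Elem N →⋆ₐ[ℂ] (K →L[ℂ] K)} {T : H →L[ℂ] K} (hT : Intertwines π π' T)
    (p : Proj N) (x y : Elem N) (ξ η : H) :
    inner ℂ (T (π x (π p.1 ξ))) (T (π y (π p.1 η))) =
      inner ℂ (T (π p.1 ξ)) (T (π p.1 (π (star x * y * p.1) η))) := by
  have hz : T (π p.1 ξ) = π' p.1 (T (π p.1 ξ)) := by
    rw [← hT.apply, ← mul_apply_eq_comp (π p.1), ← map_mul, p.mul_self]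
  have e : π (star x * y * p.1) η = π (star x) (π y (π p.1 η)) := by
    rw [map_mul, map_mul]; rfl
  have h1 : ∀ ζ, inner ℂ (T (π p.1 ξ)) (T (π p.1 ζ)) = inner ℂ (T (π p.1 ξ)) (T ζ) := fun ζ => by
    have := inner_rep_left π' p.1 (T (π p.1 ξ)) (T ζ)
    rw [p.star_eq, ← hz] at this
    rw [this, hT.apply p.1 ζ]
  rw [h1, e, hT.apply (star x), hT.apply x, inner_rep_left]

/-- A family of intertwiners that vanishes on `[π(N)π(p)H]ᗮ` and is a frame on `π(p)H` is a frame on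
`[π(N)π(p)H]`. -/
theorem hasSum_norm_sq_cyclicProj {ι : Type w} (p : Proj N) {c : ι → H →L[ℂ] τ.L2}
    (hc : ∀ i, Intertwines π τ.lmulHom (c i)) (hc0 : ∀ i, ∀ ξ ∈ (cyclicSpace π p)ᗮ, c i ξ = 0)
    (hsum : ∀ ξ η, HasSum (fun i => inner ℂ (c i (π p.1 ξ)) (c i (π p.1 η)))
      (inner ℂ (π p.1 ξ) (π p.1 η))) (ξ : H) :
    HasSum (fun i => ‖c i ξ‖ ^ 2) (qf ξ (cyclicProj π p)) := by
  set G := Set.range fun q : Elem N × H => π q.1 (π p.1 q.2) with hG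
  have hgen : ∀ ξ ∈ G, ∀ η ∈ G, HasSum (fun i => inner ℂ (c i ξ) (c i η)) (inner ℂ ξ η) := by
    rintro _ ⟨⟨x, ξ⟩, rfl⟩ _ ⟨⟨y, η⟩, rfl⟩
    have h := hsum ξ (π (star x * y * p.1) η)
    simp only [fun i => (Intertwines.inner_rep_rep (hc i) p x y ξ η).symm] at h
    have h1 := Intertwines.inner_rep_rep (intertwines_one (π := π)) p x y ξ η
    rwa [show inner ℂ (π p.1 ξ) (π p.1 (π (star x * y * p.1) η)) =
      inner ℂ (π x (π p.1 ξ)) (π y (π p.1 η)) from h1.symm] at h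
  -- Inner products rather than norms are summed, because the former extend sesquilinearly from
  -- generators to their span.
  have hspan : ∀ ξ ∈ Submodule.span ℂ G, ∀ η ∈ Submodule.span ℂ G,
      HasSum (fun i => inner ℂ (c i ξ) (c i η)) (inner ℂ ξ η) := by
    intro ξ hξ η hη
    induction hξ, hη using Submodule.span_induction₂ with
    | mem_mem ξ η hξ hη => exact hgen ξ hξ η hη
    | zero_left η hη => simp
    | zero_right ξ hξ => simp
    | add_left x y z _ _ _ h1 h2 => simpa [inner_add_left] using h1.add h2
    | add_right x y z _ _ _ h1 h2 => simpa [inner_add_right] using h1.add h2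
    | smul_left r x y _ _ h1 =>
      simpa [inner_smul_left, mul_comm] using h1.mul_left (starRingEnd ℂ r)
    | smul_right r x y _ _ h1 => simpa [inner_smul_right] using h1.mul_left r
  have hnorm : ∀ ξ ∈ Submodule.span ℂ G, HasSum (fun i => ‖c i ξ‖ ^ 2) (‖ξ‖ ^ 2) := by
    intro ξ hξ
    have h := Complex.hasSum_re (hspan ξ hξ ξ hξ)
    have e1 : (inner ℂ ξ ξ).re = ‖ξ‖ ^ 2 := inner_self_eq_norm_sq (𝕜 := ℂ) ξ
    have e2 : ∀ i, (inner ℂ (c i ξ) (c i ξ)).re = ‖c i ξ‖ ^ 2 := fun i =>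
      inner_self_eq_norm_sq (𝕜 := ℂ) (c i ξ)
    simpa only [e1, e2] using h
  have hproj : ∀ i ξ, c i ξ = c i (cyclicProj π p ξ) := fun i ξ => by
    rw [← sub_eq_zero, ← map_sub]
    exact hc0 i _ ((cyclicSpace π p).sub_starProjection_mem_orthogonal ξ)
  have hmem : ∀ ξ, cyclicProj π p ξ ∈ cyclicSpace π p := fun ξ =>
    (cyclicSpace π p).starProjection_apply_mem ξ
  have hle : ∀ ξ, ‖cyclicProj π p ξ‖ ≤ ‖ξ‖ := fun ξ =>
    (cyclicSpace π p).norm_starProjection_apply_le ξ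
  have hbound : ∀ (s : Finset ι) ξ, ∑ i ∈ s, ‖c i ξ‖ ^ 2 ≤ ‖ξ‖ ^ 2 := by
    intro s ξ
    have hcl : IsClosed {ξ | ∑ i ∈ s, ‖c i ξ‖ ^ 2 ≤ ‖ξ‖ ^ 2} :=
      isClosed_le (by fun_prop) (by fun_prop)
    have h1 : ∑ i ∈ s, ‖c i (cyclicProj π p ξ)‖ ^ 2 ≤ ‖cyclicProj π p ξ‖ ^ 2 :=
      closure_minimal (fun ξ hξ =>
        sum_le_hasSum s (fun i _ => by positivity) (hnorm ξ hξ)) hcl (hmem ξ)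
    simp only [← hproj] at h1
    exact h1.trans (by gcongr; exact hle ξ)
  have h2 : HasSum (fun i => ‖c i (cyclicProj π p ξ)‖ ^ 2) (‖cyclicProj π p ξ‖ ^ 2) :=
    closure_minimal (fun ξ hξ => hnorm ξ hξ) (isClosed_setOf_hasSum_norm_sq hbound) (hmem ξ)
  simp only [← hproj] at h2
  rwa [qf_cyclicProj]

end TracialWeight

end VNDim

namespace VNDim

variable {H₀ : Type u₀} [NormedAddCommGroup H₀] [InnerProductSpace ℂ H₀] [CompleteSpace H₀]
  {N : VonNeumannAlgebra H₀}
  {H : Type u} [NormedAddCommGroup H] [InnerProductSpace ℂ H] [CompleteSpace H]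
  {π : Elem N →⋆ₐ[ℂ] (H →L[ℂ] H)}

namespace TracialWeight

variable {τ : TracialWeight N}

/-! ### Lifting intertwiners from a corner -/

/-- Right multiplication on `{x ∈ N : τ(x*x) < ∞}`. -/
def preRmul (x : Elem N) (a : τ.PreL2) : τ.PreL2 := τ.preJ (τ.preLmul (star x) (τ.preJ a))

@[simp] theorem val_preRmul (x : Elem N) (a : τ.PreL2) :
    PreL2.val τ (preRmul x a) = PreL2.val τ a * x := by
  simp [preRmul]

theorem rmul_vec (x : Elem N) (a : τ.PreL2) : rmul x (τ.vec a) = τ.vec (preRmul x a) := by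
  rw [rmul, conjOp_apply, J_vec, lmul_vec, J_vec]; rfl

theorem commL_rmul (x : Elem N) : CommL (rmul (τ := τ) x) := fun y =>
  ContinuousLinearMap.ext fun ξ => (lmul_rmul_comm y x ξ).symm

theorem cornerWeight_one {p : Proj N} (hp0 : τ p.1 ≠ 0) (hp : τ p.1 < ∞) :
    τ.cornerWeight p 1 = 1 := by
  rw [cornerWeight_apply, cornerIncl_one, ENNReal.inv_mul_cancel hp0 hp.ne]

/-- The unit of `pNp` as an element of finite trace. -/
def cornerUnit {p : Proj N} (hp0 : τ p.1 ≠ 0) (hp : τ p.1 < ∞) : (τ.cornerWeight p).PreL2 :=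
  PreL2.mk _ 1 (by rw [star_one, one_mul, cornerWeight_one hp0 hp]; exact ENNReal.one_lt_top)

/-- The adjoint of the embedding `L²(pNp,τ_p) → L²(N,τ)` is the compression. -/
theorem inner_cornerEmbedding {p : Proj N} (hp0 : τ p.1 ≠ 0) (hp : τ p.1 < ∞)
    {U : (τ.cornerWeight p).L2 →ₗᵢ[ℂ] τ.L2}
    (hU : ∀ x, U (vec _ x) = ((Real.sqrt (τ p.1).toReal)⁻¹ : ℂ) • τ.vec (cornerVec hp x))
    (β : (τ.cornerWeight p).L2) (a : τ.PreL2) :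
    inner ℂ (U β) (τ.vec a) = (Real.sqrt (τ p.1).toReal : ℂ) *
      inner ℂ β ((τ.cornerWeight p).lmul (cornerCompress p (PreL2.val τ a))
        (vec _ (cornerUnit hp0 hp))) := by
  have ht : (Real.sqrt (τ p.1).toReal : ℂ) ≠ 0 := by
    exact_mod_cast (Real.sqrt_pos.2 (ENNReal.toReal_pos hp0 hp.ne)).ne'
  refine eq_of_eq_vec (f := fun β => inner ℂ (U β) (τ.vec a))
    (g := fun β => (Real.sqrt (τ p.1).toReal : ℂ) *
      inner ℂ β ((τ.cornerWeight p).lmul (cornerCompress p (PreL2.val τ a))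
        (vec _ (cornerUnit hp0 hp)))) (by fun_prop) (by fun_prop) (fun x => ?_) β
  have e1 : cornerVec hp ((τ.cornerWeight p).preLmul (cornerCompress p (PreL2.val τ a))
      (cornerUnit hp0 hp)) = τ.preLmul p.1 (preRmul p.1 a) := PreL2.ext (by
    simp [cornerVec, cornerUnit, cornerIncl_cornerCompress, mul_assoc])
  -- A vector of the corner is fixed by p on both sides, so pairing it with a is pairing it with
  -- pap.
  have e2 : preRmul p.1 (τ.preLmul p.1 (cornerVec hp x)) = cornerVec hp x := PreL2.ext (by
    simp [cornerVec, proj_mul_cornerIncl, cornerIncl_mul_proj])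
  have e3 : inner ℂ (τ.vec (cornerVec hp x)) (τ.vec (τ.preLmul p.1 (preRmul p.1 a))) =
      inner ℂ (τ.vec (cornerVec hp x)) (τ.vec a) := by
    rw [← lmul_vec, ← rmul_vec]
    nth_rw 1 [← p.star_eq]
    rw [← adjoint_lmul, ContinuousLinearMap.adjoint_inner_right, lmul_vec]
    nth_rw 2 [← p.star_eq]
    rw [← adjoint_rmul, ContinuousLinearMap.adjoint_inner_right, rmul_vec, e2]
  rw [← U.inner_map_map, lmul_vec, hU, hU, e1, inner_smul_right, inner_smul_left,
    inner_smul_left, e3]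
  simp only [map_inv₀, Complex.conj_ofReal]
  field_simp

/-- The matrix coefficient of the adjoint of an intertwiner `b` at the unit of `N`, in terms of a
square root of `b b*`. -/
theorem qf_adjoint_unit {b : H →L[ℂ] τ.L2} (hb : Intertwines π τ.lmulHom b) {s : Elem N}
    (hs : star s = s)
    (hy : τ.lmulHom (s * s) = conjOp (b.comp (ContinuousLinearMap.adjoint b)))
    {Ω : τ.PreL2} (hΩ : PreL2.val τ Ω = 1) (x : Elem N) :
    qf (ContinuousLinearMap.adjoint b (τ.vec Ω)) (π x) =
      qf (τ.vec (τ.preLmul s Ω)) (τ.lmulHom x) := by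
  -- Conjugating the hypothesis by J shows bb* = R_s², with R_s the right multiplication by s; at
  -- the unit, R_s and left multiplication by s give the same vector.
  have hA : b.comp (ContinuousLinearMap.adjoint b) = (rmul s).comp (rmul s) := by
    rw [← conjOp_conjOp (b.comp _), ← hy, map_mul, rmul, hs, ← conjOp_comp]; rfl
  have hAΩ : rmul s (τ.vec Ω) = τ.vec (τ.preLmul s Ω) := by
    rw [rmul_vec]
    exact congrArg τ.vec (PreL2.ext (by simp [hΩ]))
  have h := congrArg (fun T : τ.L2 →L[ℂ] τ.L2 => T (τ.vec Ω)) hA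
  simp only [ContinuousLinearMap.comp_apply] at h
  rw [qf_apply, qf_apply, ← hb.adjoint.apply, ContinuousLinearMap.adjoint_inner_left, h, hAΩ]
  nth_rw 1 [← hs]
  rw [← adjoint_rmul, ContinuousLinearMap.adjoint_inner_right, lmulHom_apply, ← lmul_rmul_comm,
    hAΩ]

section Lift

variable {p : Proj N} (hp0 : τ p.1 ≠ 0) (hp : τ p.1 < ∞)
  {b : (p.map π).space →L[ℂ] (τ.cornerWeight p).L2}

/-- A matrix coefficient of a corner module, computed in `L²(N,τ)`. -/
theorem norm_sq_rep_cornerVec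
    (hb : Intertwines (cornerRep π p) (τ.cornerWeight p).lmulHom b) {s : Elem (corner p)}
    (hs : 0 ≤ s)
    (hy : (τ.cornerWeight p).lmulHom (s * s) =
      conjOp (b.comp (ContinuousLinearMap.adjoint b))) (a : τ.PreL2) :
    (τ p.1).toReal * ‖π (PreL2.val τ a)
      (ContinuousLinearMap.adjoint b (vec _ (cornerUnit hp0 hp)) : H)‖ ^ 2 =
      ‖rmul (cornerIncl p s) (τ.vec a)‖ ^ 2 := by
  have ht : (τ p.1).toReal ≠ 0 := (ENNReal.toReal_pos hp0 hp.ne).ne'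
  have h2 := qf_adjoint_unit hb (Elem.isSelfAdjoint hs) hy (Ω := cornerUnit hp0 hp) rfl
    -- With ζ = b*(1), which is fixed by p, ‖π(a)ζ‖² is the matrix coefficient of pa*ap at ζ. It
    -- equals τ_p(s pa*ap s) = τ(p)⁻¹ ‖as‖² in the norm of L²(N,τ).
    (cornerCompress p (star (PreL2.val τ a) * PreL2.val τ a))
  generalize ContinuousLinearMap.adjoint b (vec _ (cornerUnit hp0 hp)) = ζ at h2
  have hpζ : π p.1 (ζ : H) = ζ := (p.map π).mem_space_iff.1 ζ.2
  have h1 : ‖π (PreL2.val τ a) (ζ : H)‖ ^ 2 =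
      qf (ζ : H) (π (cornerIncl p (cornerCompress p (star (PreL2.val τ a) * PreL2.val τ a)))) := by
    have := qf_rep_star_mul_self π (ζ : H) (PreL2.val τ a * p.1)
    rw [map_mul π (PreL2.val τ a), mul_apply_eq_comp, hpζ] at this
    rw [← this, cornerIncl_cornerCompress, star_mul, p.star_eq]
    simp only [mul_assoc]
  have h3 : cornerIncl p s * (p.1 * (star (PreL2.val τ a) * PreL2.val τ a) * p.1) *
      cornerIncl p s = star (PreL2.val τ a * cornerIncl p s) *
        (PreL2.val τ a * cornerIncl p s) := by
    rw [star_mul, ← cornerIncl_star, Elem.isSelfAdjoint hs]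
    nth_rw 3 [← cornerIncl_mul_proj]
    nth_rw 4 [← proj_mul_cornerIncl]
    simp only [mul_assoc]
  rw [h1, ← qf_cornerRep, h2, qf_vec_lmul (cornerCompress_nonneg p (star_mul_self_nonneg' _)),
    cornerWeight_apply, ENNReal.toReal_mul, ENNReal.toReal_inv, mul_inv_cancel_left₀ ht, rmul_vec,
    norm_vec_sq, quad, val_preRmul, val_preLmul,
    show PreL2.val _ (cornerUnit hp0 hp) = 1 from rfl, mul_one, Elem.isSelfAdjoint hs,
    cornerIncl_mul, cornerIncl_mul, cornerIncl_cornerCompress, h3]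

end Lift

end TracialWeight

end VNDim

namespace VNDim

variable {H₀ : Type u₀} [NormedAddCommGroup H₀] [InnerProductSpace ℂ H₀] [CompleteSpace H₀]
  {N : VonNeumannAlgebra H₀}
  {H : Type u} [NormedAddCommGroup H] [InnerProductSpace ℂ H] [CompleteSpace H]
  {π : Elem N →⋆ₐ[ℂ] (H →L[ℂ] H)}

namespace TracialWeight

variable {τ : TracialWeight N}

theorem norm_J (ξ : τ.L2) : ‖τ.J ξ‖ = ‖ξ‖ :=
  le_antisymm (τ.norm_J_le ξ) (by simpa only [J_J] using τ.norm_J_le (τ.J ξ))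

section Lift

variable {p : Proj N}
  {b : (p.map π).space →L[ℂ] (τ.cornerWeight p).L2}

theorem rep_coe_mem_cyclicSpace (ζ : (p.map π).space) (x : Elem N) :
    π x (ζ : H) ∈ cyclicSpace π p := by
  have h : π p.1 (ζ : H) = ζ := (p.map π).mem_space_iff.1 ζ.2
  rw [← h]
  exact mem_cyclicSpace p x _

/-- The adjoint of the lift of an intertwiner `b` from the corner `pNp` to `N`. -/
theorem exists_lift_adjoint (hp0 : τ p.1 ≠ 0) (hp : τ p.1 < ∞) (h : τ.IsFNS)
    (hb : Intertwines (cornerRep π p) (τ.cornerWeight p).lmulHom b) :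
    ∃ T : τ.L2 →L[ℂ] H, Intertwines τ.lmulHom π T ∧
      (∀ a, T (τ.vec a) = (Real.sqrt (τ p.1).toReal : ℂ) • π (PreL2.val τ a)
        (ContinuousLinearMap.adjoint b (vec _ (cornerUnit hp0 hp)) : H)) ∧
      comTrace ((ContinuousLinearMap.adjoint T).comp T) =
        τ p.1 * comTrace (b.comp (ContinuousLinearMap.adjoint b)) := by
  obtain ⟨y, hy0, hy, hty⟩ := (h.cornerWeight p hp0 hp).exists_comTrace_eq
    (hb.comp hb.adjoint) (comp_adjoint_nonneg b)
  obtain ⟨s, hs, rfl⟩ := Elem.exists_sqrt hy0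
  have hS : star (cornerIncl p s) = cornerIncl p s := by
    rw [← cornerIncl_star, Elem.isSelfAdjoint hs]
  have key := norm_sq_rep_cornerVec hp0 hp hb hs hy
  set ζ : H := (ContinuousLinearMap.adjoint b (vec _ (cornerUnit hp0 hp)) : H)
  set S := cornerIncl p s
  let f : τ.PreL2 →ₗ[ℂ] τ.L2 :=
    { toFun := fun a => rmul S (τ.vec a)
      map_add' := fun x y => by
        rw [← map_add]; exact congrArg _ (UniformSpace.Completion.coe_add _ _)
      map_smul' := fun c x => by
        rw [RingHom.id_apply, ← map_smul (rmul S)]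
        exact congrArg _ (UniformSpace.Completion.coe_smul _ _) }
  let g : τ.PreL2 →ₗ[ℂ] H :=
    { toFun := fun a => (Real.sqrt (τ p.1).toReal : ℂ) • π (PreL2.val τ a) ζ
      map_add' := fun x y => by rw [map_add, map_add, ← smul_add]; rfl
      map_smul' := fun c x => by
        rw [RingHom.id_apply, map_smul, map_smul π, smul_comm c]; rfl }
  have hgf : ∀ a, ‖g a‖ = ‖f a‖ := fun a => by
    rw [← sq_eq_sq₀ (norm_nonneg _) (norm_nonneg _)]
    refine Eq.trans ?_ (key a)
    change ‖(Real.sqrt (τ p.1).toReal : ℂ) • π (PreL2.val τ a) ζ‖ ^ 2 = _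
    rw [norm_smul, mul_pow, Complex.norm_real, Real.norm_eq_abs, sq_abs,
      Real.sq_sqrt ENNReal.toReal_nonneg]
  -- By the norm identity, aS ↦ √τ(p) π(a)ζ is well defined and isometric. Composition with right
  -- multiplication by S defines the lift on all of L²(N,τ).
  obtain ⟨T, hT, hTf, -, -⟩ := exists_intertwiner (π₁ := τ.lmulHom) (π₂ := π) f g
    (fun a => (hgf a).le) (fun x a => τ.preLmul x a)
    (fun x a => by
      change rmul S (τ.vec (τ.preLmul x a)) = τ.lmul x (rmul S (τ.vec a))
      rw [lmul_rmul_comm, lmul_vec])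
    (fun x a => by
      change (Real.sqrt (τ p.1).toReal : ℂ) • π (x * PreL2.val τ a) ζ =
        π x ((Real.sqrt (τ p.1).toReal : ℂ) • π (PreL2.val τ a) ζ)
      rw [map_mul, map_smul]; rfl)
  have hTS : ∀ a, T (rmul S (τ.vec a)) = g a := hTf
  refine ⟨T.comp (rmul S), hT.comp (commL_rmul S), hTS, ?_⟩
  have hnorm : ∀ ξ, ‖T (rmul S ξ)‖ = ‖rmul S ξ‖ := fun ξ =>
    eq_of_eq_vec (f := fun ξ => ‖T (rmul S ξ)‖) (g := fun ξ => ‖rmul S ξ‖) (by fun_prop)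
      (by fun_prop) (fun a => by rw [hTS, hgf]; rfl) ξ
  -- T is isometric on the range of R_S, so T drops out and only R_S* R_S = J λ(s²) J remains, with
  -- λ the left representation. Its trace is τ(s²) = τ(p) τ_p(s²), while s² represents bb* in the
  -- corner.
  have hop : (ContinuousLinearMap.adjoint (T.comp (rmul S))).comp (T.comp (rmul S)) =
      conjOp (τ.lmulHom (cornerIncl p (s * s))) := by
    have h1 : cornerIncl p (s * s) = star S * S := by rw [hS, cornerIncl_mul]
    have hc := comp_adjoint_nonneg (ContinuousLinearMap.adjoint (T.comp (rmul S)))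
    rw [ContinuousLinearMap.adjoint_adjoint] at hc
    refine eq_of_qf_eq hc.isSelfAdjoint
      (conjOp_nonneg (rep_nonneg _ (cornerIncl_nonneg p hy0))).isSelfAdjoint
      fun ξ => ?_
    rw [qf_adjoint_comp, ContinuousLinearMap.comp_apply, hnorm, qf_conjOp, h1,
      qf_rep_star_mul_self, rmul, conjOp_apply, hS, norm_J]
    rfl
  rw [hop, comTrace, conjOp_conjOp, lmulHom_apply, h.opTrace_lmul (cornerIncl_nonneg p hy0), hty,
    cornerWeight_apply, ENNReal.mul_inv_cancel_left hp0 hp.ne]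

/-- Intertwiners of the corner module into `L²(pNp,τ_p)` extend to intertwiners of the module into
`L²(N,τ)`, with the appropriate rescaling of the trace. -/
theorem exists_lift (hp0 : τ p.1 ≠ 0) (hp : τ p.1 < ∞) (h : τ.IsFNS)
    (hb : Intertwines (cornerRep π p) (τ.cornerWeight p).lmulHom b) :
    ∃ c : H →L[ℂ] τ.L2, Intertwines π τ.lmulHom c ∧
      comTrace (c.comp (ContinuousLinearMap.adjoint c)) =
        τ p.1 * comTrace (b.comp (ContinuousLinearMap.adjoint b)) ∧
      (∀ ξ ∈ (cyclicSpace π p)ᗮ, c ξ = 0) ∧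
      ∀ ξ η : (p.map π).space, inner ℂ (c ξ) (c η) = inner ℂ (b ξ) (b η) := by
  obtain ⟨T, hT, hTa, htr⟩ := exists_lift_adjoint hp0 hp h hb
  obtain ⟨U, hU⟩ := exists_cornerEmbedding hp0 hp
  have hc : ∀ ξ a, inner ℂ (ContinuousLinearMap.adjoint T ξ) (τ.vec a) =
      (Real.sqrt (τ p.1).toReal : ℂ) * inner ℂ ξ (π (PreL2.val τ a)
        (ContinuousLinearMap.adjoint b (vec _ (cornerUnit hp0 hp)) : H)) := fun ξ a => by
    rw [ContinuousLinearMap.adjoint_inner_left, hTa, inner_smul_right]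
  -- On π(p)H the lift is b followed by the isometric embedding of L²(pNp,τ_p), which is why it
  -- preserves inner products there.
  have hcU : ∀ ξ : (p.map π).space, ContinuousLinearMap.adjoint T (ξ : H) = U (b ξ) := fun ξ => by
    refine eq_of_inner_vec fun a => ?_
    rw [hc, inner_cornerEmbedding hp0 hp hU, ← ContinuousLinearMap.adjoint_inner_right,
      ← lmulHom_apply, hb.adjoint.apply, Submodule.coe_inner, coe_cornerRep,
      cornerIncl_cornerCompress]
    generalize ContinuousLinearMap.adjoint b (vec _ (cornerUnit hp0 hp)) = ζ
    have h1 : π p.1 (ζ : H) = ζ := (p.map π).mem_space_iff.1 ζ.2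
    have h2 : π p.1 (ξ : H) = ξ := (p.map π).mem_space_iff.1 ξ.2
    rw [map_mul, map_mul, mul_apply_eq_comp, mul_apply_eq_comp, h1]
    have h3 := inner_rep_left π p.1 (ξ : H) (π (PreL2.val τ a) ζ)
    rw [p.star_eq, h2] at h3
    rw [h3]
  refine ⟨ContinuousLinearMap.adjoint T, hT.adjoint, ?_, fun ξ hξ => ?_, fun ξ η => ?_⟩
  · rw [ContinuousLinearMap.adjoint_adjoint, htr]
  · refine eq_of_inner_vec fun a => ?_
    rw [hc, inner_zero_left, (Submodule.mem_orthogonal' _ _).1 hξ _ (rep_coe_mem_cyclicSpace _ _),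
      mul_zero]
  · rw [hcU, hcU, U.inner_map_map]

end Lift

theorem IsFrame.hasSum_inner {ι : Type*} {v : ι → H →L[ℂ] τ.L2} (hv : IsFrame v) (ξ η : H) :
    HasSum (fun i => inner ℂ (v i ξ) (v i η)) (inner ℂ ξ η) := by
  obtain ⟨V, hV⟩ := exists_isometry_of_isFrame hv
  have h := lp.hasSum_inner (𝕜 := ℂ) (V ξ) (V η)
  rw [V.inner_map_map] at h
  have hv' : ∀ i ζ, v i ζ = V ζ i := fun i ζ => by rw [← hV, ← coord_apply]; rfl
  simpa only [hv'] using h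

theorem IsFaithful.proj_eq_zero (h : τ.IsFaithful) {p : Proj N} (hp : τ p.1 = 0) : p.1 = 0 :=
  h _ p.nonneg hp

/-- The dimension of the corner module `π(p)H` is the trace of the central support of `p`. -/
theorem IsFNS.mul_dim_cornerRep (h : τ.IsFNS) (hπ : IsNormalRep π) {κ : Type*}
    {v : κ → H →L[ℂ] τ.L2} (hv : ∀ j, Intertwines π τ.lmulHom (v j)) (hfr : IsFrame v)
    (p : Proj N) (hp : τ p.1 < ∞) :
    τ p.1 * (τ.cornerWeight p).dim (cornerRep π p) =
      ∑' j, comTrace ((v j).comp ((cyclicProj π p).comp (ContinuousLinearMap.adjoint (v j)))) := by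
  by_cases hp0 : τ p.1 = 0
  -- If τ(p) = 0 the normalisation of τ_p degenerates, but then p = 0 and both sides vanish.
  · have hle : cyclicSpace π p ≤ ⊥ := by
      refine Submodule.topologicalClosure_minimal _ (Submodule.span_le.2 ?_) isClosed_singleton
      rintro _ ⟨q, rfl⟩
      simp [h.faithful.proj_eq_zero hp0]
    have hc : cyclicProj π p = 0 := ContinuousLinearMap.ext fun ξ =>
      (Submodule.mem_bot ℂ).1 (hle ((cyclicSpace π p).starProjection_apply_mem ξ))
    rw [hp0, zero_mul, hc]
    simp [h.comTrace_zero]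
  have hσ := h.cornerWeight p hp0 hp
  obtain ⟨ι, b, hb, hbf⟩ := exists_frame hσ.isNormalRep hσ.injective (hπ.cornerRep p)
  obtain ⟨c, hc⟩ := Classical.skolem.1 fun i => exists_lift hp0 hp h (hb i)
  rw [hσ.dim_eq (hπ.cornerRep p) hb hbf, ← ENNReal.tsum_mul_left]
  -- The exchange identity with Z = z_p: the lifted corner frame is Parseval on [π(N)π(p)H] and
  -- vanishes on its complement.
  rw [← h.tsum_comTrace_eq hv hfr (fun i => (hc i).1) (intertwines_cyclicProj p)
    (cyclicProj_nonneg p) (hasSum_norm_sq_cyclicProj p (fun i => (hc i).1)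
      (fun i => (hc i).2.2.1) fun ξ η => ?_)]
  · exact tsum_congr fun i => (hc i).2.1.symm
  · have h1 := IsFrame.hasSum_inner hbf (⟨π p.1 ξ, ⟨ξ, rfl⟩⟩ : (p.map π).space) ⟨π p.1 η, ⟨η, rfl⟩⟩
    simp only [← (hc _).2.2.2] at h1
    exact h1

end TracialWeight

end VNDim

namespace VNDim

variable {H₀ : Type u₀} [NormedAddCommGroup H₀] [InnerProductSpace ℂ H₀] [CompleteSpace H₀]
  {N : VonNeumannAlgebra H₀}
  {H : Type u} [NormedAddCommGroup H] [InnerProductSpace ℂ H] [CompleteSpace H]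
  {π : Elem N →⋆ₐ[ℂ] (H →L[ℂ] H)}

/-! ### Projections of finite trace -/

theorem continuous_qf (T : H →L[ℂ] H) : Continuous fun ξ => qf ξ T := by
  simp only [qf_apply]
  fun_prop

/-- A non-zero positive operator dominates a positive multiple of a non-zero projection in the von
Neumann algebra it generates. -/
theorem exists_proj_smul_le {y : H →L[ℂ] H} (hy : 0 ≤ y) (hy0 : y ≠ 0) :
    ∃ e : H →L[ℂ] H, IsStarProjection e ∧ e ≠ 0 ∧ (∃ ε : ℝ, 0 < ε ∧ ∀ ξ, ε * qf ξ e ≤ qf ξ y) ∧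
      ∀ t, Commute y t → ∀ ξ, t (e ξ) ∈ e.range := by
  have hn : 0 < ‖y‖ := norm_pos_iff.2 hy0
  -- Any positive threshold below ‖y‖ makes the positive part f of y - ε non-zero. The closure of
  -- the range of f serves as a spectral subspace on which y ≥ ε.
  set ε := ‖y‖ / 2 with hε
  have hε0 : 0 < ε := by positivity
  set f := (y - (ε : ℂ) • 1)⁺ with hf
  have hsa : IsSelfAdjoint (y - (ε : ℂ) • (1 : H →L[ℂ] H)) := by
    refine hy.isSelfAdjoint.sub ?_
    rw [IsSelfAdjoint, star_smul, star_one]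
    simp
  have hf0 : 0 ≤ f := CFC.posPart_nonneg _
  have hff : (y - (ε : ℂ) • 1) * f = f * f := by
    conv_lhs => rw [← CFC.posPart_sub_negPart _ hsa]
    rw [sub_mul, CFC.negPart_mul_posPart, sub_zero]
  have hfne : f ≠ 0 := fun h => by
    rw [hf, CFC.posPart_eq_zero_iff _ hsa, sub_nonpos] at h
    have h1 := CStarAlgebra.norm_le_norm_of_nonneg_of_le hy h
    have h2 : ‖(ε : ℂ) • (1 : H →L[ℂ] H)‖ ≤ ε := by
      rw [norm_smul, Complex.norm_real, Real.norm_of_nonneg hε0.le]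
      exact mul_le_of_le_one_right hε0.le ContinuousLinearMap.norm_id_le
    linarith
  have hfc : ∀ t, Commute y t → Commute f t := fun t ht => by
    rw [hf, CFC.posPart_def]
    exact Commute.cfcₙ_real (ht.sub_left ((Commute.one_left t).smul_left _)) _
  set K := (LinearMap.range (f : H →ₗ[ℂ] H)).topologicalClosure with hK
  have hKc : CompleteSpace K := (Submodule.isClosed_topologicalClosure _).completeSpace_coe
  have hmem : ∀ ξ, f ξ ∈ K := fun ξ => Submodule.le_topologicalClosure _ ⟨ξ, rfl⟩
  have hinv : ∀ t, Commute y t → ∀ ξ ∈ K, t ξ ∈ K := fun t ht ξ hξ => by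
    have hle : K ≤ K.comap (t : H →ₗ[ℂ] H) := by
      refine Submodule.topologicalClosure_minimal _ ?_ ?_
      · rintro _ ⟨η, rfl⟩
        have := congrArg (fun S : H →L[ℂ] H => S η) (hfc t ht).eq
        simp only [mul_apply_eq_comp] at this
        change t (f η) ∈ K
        rw [← this]
        exact hmem _
      · exact IsClosed.preimage t.continuous (Submodule.isClosed_topologicalClosure
          (LinearMap.range (f : H →ₗ[ℂ] H)))
    exact hle hξ
  have hKy : ∀ k ∈ K, ε * ‖k‖ ^ 2 ≤ qf k y := by
    have hcl : IsClosed {k | ε * ‖k‖ ^ 2 ≤ qf k y} :=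
      isClosed_le (by fun_prop) (continuous_qf y)
    refine fun k hk => closure_minimal ?_ hcl hk
    rintro _ ⟨η, rfl⟩
    have h1 : qf (f η) (y - (ε : ℂ) • 1) = qf (f η) f := by
      rw [qf_apply, qf_apply, ← mul_apply_eq_comp, hff]; rfl
    have h2 := qf_nonneg hf0 (f η)
    rw [← h1, map_sub, qf_complex_smul, qf_one] at h2
    change ε * ‖f η‖ ^ 2 ≤ qf (f η) y
    linarith
  refine ⟨K.starProjection, isStarProjection_starProjection, fun h => hfne ?_,
    ⟨ε, hε0, fun ξ => ?_⟩,
    fun t ht ξ => ?_⟩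
  · ext ξ
    have h1 := Submodule.starProjection_eq_self_iff.2 (hmem ξ)
    rw [h] at h1
    exact h1.symm
  · have hk := K.starProjection_apply_mem ξ
    have hk' := K.sub_starProjection_mem_orthogonal ξ
    have hq : qf ξ K.starProjection = ‖K.starProjection ξ‖ ^ 2 := by
      have h := isStarProjection_starProjection (U := K)
      rw [← qf_star_mul_self, h.isSelfAdjoint.star_eq, h.isIdempotentElem.eq]
    rw [hq]
    refine (hKy _ hk).trans ?_
    -- y leaves K invariant, so the cross terms between K and its complement vanish; the part on the
    -- complement is non-negative and can be dropped.
    have hyk := hinv y (Commute.refl y) _ hk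
    have h1 : inner ℂ (y (K.starProjection ξ)) (ξ - K.starProjection ξ) = 0 := hk' _ hyk
    have h2 : inner ℂ (y (ξ - K.starProjection ξ)) (K.starProjection ξ) = 0 := by
      rw [← ContinuousLinearMap.adjoint_inner_right, ← ContinuousLinearMap.star_eq_adjoint,
        hy.isSelfAdjoint.star_eq]
      exact (Submodule.mem_orthogonal' _ _).1 hk' _ hyk
    have h3 := qf_nonneg hy (ξ - K.starProjection ξ)
    generalize K.starProjection ξ = k at *
    obtain ⟨k', rfl⟩ : ∃ k', ξ = k + k' := ⟨ξ - k, by abel⟩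
    rw [add_sub_cancel_left] at h1 h2 h3
    rw [qf_apply] at h3 ⊢
    rw [qf_apply, map_add, inner_add_left, inner_add_right, inner_add_right, h1, h2]
    simp only [add_zero, zero_add, Complex.add_re]
    linarith
  · rw [Submodule.range_starProjection]
    exact hinv t ht _ (K.starProjection_apply_mem ξ)

/-- The range of the projection is invariant under everything commuting with y, in particular under
the commutant of N, so the projection lies in N. -/
theorem Elem.exists_proj_smul_le {y : Elem N} (hy : 0 ≤ y) (hy0 : y ≠ 0) :
    ∃ e : Proj N, e.1 ≠ 0 ∧ ∃ C : ℝ≥0, e.1 ≤ ((C : ℝ) : ℂ) • y := by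
  obtain ⟨e, he, he0, ⟨ε, hε, hle⟩, hinv⟩ := VNDim.exists_proj_smul_le (y := (y : H₀ →L[ℂ] H₀)) hy
    fun h => hy0 (Subtype.ext h)
  have hmem : e ∈ N := by
    rw [VonNeumannAlgebra.IsStarProjection.mem_iff he N]
    rintro t ht _ ⟨ξ, rfl⟩
    exact hinv t (VonNeumannAlgebra.mem_commutant_iff.1 ht _ y.2) ξ
  refine ⟨⟨⟨e, hmem⟩, ⟨Subtype.ext he.isIdempotentElem, Subtype.ext he.isSelfAdjoint⟩⟩,
    fun h => he0 (congrArg Subtype.val h), ⟨ε⁻¹, by positivity⟩, ?_⟩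
  rw [Elem.le_def]
  refine le_of_qf_le he.isSelfAdjoint (IsSelfAdjoint.of_nonneg (smul_nonneg' _ hy)) fun ξ => ?_
  change qf ξ e ≤ qf ξ (((ε⁻¹ : ℝ) : ℂ) • (y : H₀ →L[ℂ] H₀))
  rw [qf_complex_smul, ← div_eq_inv_mul, le_div_iff₀ hε, mul_comm]
  exact hle ξ

theorem cyclicProj_mono_of_mul_eq {p q : Proj N} (h : q.1 * p.1 = p.1) :
    TracialWeight.cyclicProj π p ≤ TracialWeight.cyclicProj π q := by
  refine Submodule.starProjection_le_starProjection_iff.2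
    (Submodule.topologicalClosure_minimal _ (Submodule.span_le.2 ?_)
      (Submodule.isClosed_topologicalClosure _))
  rintro _ ⟨⟨x, ξ⟩, rfl⟩
  change π x (π p.1 ξ) ∈ TracialWeight.cyclicSpace π q
  rw [← h, map_mul, mul_apply_eq_comp]
  exact TracialWeight.mem_cyclicSpace q x _

theorem rep_le_cyclicProj (p : Proj N) : π p.1 ≤ TracialWeight.cyclicProj π p := by
  refine (IsStarProjection.le_iff_mul_eq_right (p.map π).2 isStarProjection_starProjection).2 ?_
  ext ξ
  have := TracialWeight.mem_cyclicSpace (π := π) p 1 ξ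
  rw [map_one] at this
  exact Submodule.starProjection_eq_self_iff.2 this

end VNDim

namespace VNDim

variable {H₀ : Type u₀} [NormedAddCommGroup H₀] [InnerProductSpace ℂ H₀] [CompleteSpace H₀]
  {N : VonNeumannAlgebra H₀}
  {H : Type u} [NormedAddCommGroup H] [InnerProductSpace ℂ H] [CompleteSpace H]
  {π : Elem N →⋆ₐ[ℂ] (H →L[ℂ] H)}

namespace TracialWeight

variable {τ : TracialWeight N}

theorem Proj.le_one (p : Proj N) : p.1 ≤ 1 := by
  have h : IsStarProjection p.op.1 := p.op.2
  exact h.le_one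

/-- There is a maximal family of pairwise orthogonal projections of finite trace. -/
theorem exists_maximal_orthogonal (τ : TracialWeight N) :
    ∃ A : Set (Proj N), (∀ p ∈ A, τ p.1 < ∞) ∧ (∀ p ∈ A, ∀ q ∈ A, p ≠ q → p.1 * q.1 = 0) ∧
      ∀ q : Proj N, τ q.1 < ∞ → (∀ p ∈ A, p.1 * q.1 = 0) → q.1 = 0 := by
  obtain ⟨A, hA⟩ := zorn_subset
    {A : Set (Proj N) | (∀ p ∈ A, τ p.1 < ∞) ∧ ∀ p ∈ A, ∀ q ∈ A, p ≠ q → p.1 * q.1 = 0} (by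
      refine fun c hc hchain => ⟨⋃₀ c, ⟨?_, ?_⟩, fun s hs => Set.subset_sUnion_of_mem hs⟩
      · rintro p ⟨B, hB, hp⟩
        exact (hc hB).1 p hp
      · rintro p ⟨B, hB, hp⟩ q ⟨C, hC, hq⟩ hne
        rcases hchain.total hB hC with h | h
        · exact (hc hC).2 p (h hp) q hq hne
        · exact (hc hB).2 p hp q (h hq) hne)
  refine ⟨A, hA.prop.1, hA.prop.2, fun q hq hort => ?_⟩
  have hort' : ∀ p ∈ A, q.1 * p.1 = 0 := fun p hp => by
    have := congrArg star (hort p hp)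
    rwa [star_mul, p.star_eq, q.star_eq, star_zero] at this
  have hins : insert q A ⊆ A := hA.le_of_ge (y := insert q A) (by
    refine ⟨?_, ?_⟩
    · rintro p (rfl | hp)
      exacts [hq, hA.prop.1 p hp]
    · rintro p (rfl | hp) r (rfl | hr) hne
      exacts [absurd rfl hne, hort' r hr, hort p hp, hA.prop.2 p hp r hr hne])
    (Set.subset_insert q A)
  rw [← q.mul_self]
  exact hort q (hins (Set.mem_insert q A))

/-- In a von Neumann algebra with a faithful normal semifinite tracial weight, the unit is the limit
of an increasing net of projections of finite trace. -/
theorem IsFNS.exists_monotone_proj (h : τ.IsFNS) :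
    ∃ (α : Type u₀) (_ : SemilatticeSup α) (_ : Nonempty α) (P : α → Proj N),
      (∀ i, τ (P i).1 < ∞) ∧ (∀ i j, i ≤ j → (P j).1 * (P i).1 = (P i).1) ∧
      IsLUB (Set.range fun i => (P i).1) 1 := by
  classical
  obtain ⟨A, hAτ, hAo, hmax⟩ := τ.exists_maximal_orthogonal
  have hO : OrthogonalIdempotents fun p : A => p.1.1 :=
    ⟨fun p => p.1.mul_self, fun p q hne => hAo p p.2 q q.2 fun h => hne (Subtype.ext h)⟩
  -- The net consists of the finite partial sums of a maximal orthogonal family, each of finite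
  -- trace.
  let P : Finset A → Proj N := fun F => ⟨∑ p ∈ F, p.1.1, hO.isIdempotentElem_sum, by
    rw [IsSelfAdjoint, star_sum]
    exact Finset.sum_congr rfl fun p _ => p.1.star_eq⟩
  have hPτ : ∀ F, τ (P F).1 < ∞ := fun F => by
    change τ (∑ p ∈ F, p.1.1) < ∞
    induction F using Finset.induction_on with
    | empty =>
      have h0 : τ 0 = 0 := by simpa using τ.smul_of_nonneg 0 0 le_rfl
      rw [Finset.sum_empty, h0]; exact ENNReal.zero_lt_top
    | insert p F hp ih =>
      rw [Finset.sum_insert hp, τ.add_of_nonneg _ _ p.1.nonneg (P F).nonneg]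
      exact ENNReal.add_lt_top.2 ⟨hAτ p p.2, ih⟩
  have hPmul : ∀ F G, F ≤ G → (P G).1 * (P F).1 = (P F).1 := fun F G hFG => by
    have : (P F).1 * (P G).1 = (P F).1 := by
      change (∑ p ∈ F, p.1.1) * ∑ p ∈ G, p.1.1 = ∑ p ∈ F, p.1.1
      rw [Finset.sum_mul]
      exact Finset.sum_congr rfl fun p hp => hO.mul_sum_of_mem (hFG hp)
    have h := congrArg star this
    rwa [star_mul, Proj.star_eq, Proj.star_eq] at h
  have hPmono : Monotone fun F => (P F).1 := fun F G hFG =>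
    Finset.sum_le_sum_of_subset_of_nonneg hFG fun p _ _ => p.1.nonneg
  refine ⟨Finset A, inferInstance, inferInstance, P, hPτ, hPmul, ?_⟩
  obtain ⟨x, hx0, hx, -⟩ := Elem.exists_isLUB (D := Set.range fun F => (P F).1) (u := 1)
    (by rintro _ ⟨F, rfl⟩; exact (P F).nonneg) (Set.range_nonempty _)
    hPmono.directed_le.directedOn_range (by rintro _ ⟨F, rfl⟩; exact Proj.le_one _)
  have hx1 : x ≤ 1 := hx.2 (by rintro _ ⟨F, rfl⟩; exact Proj.le_one _)
  suffices hx' : x = 1 by rwa [hx'] at hx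
  by_contra hne
  obtain ⟨y, hy, hyx, hy0, hyτ⟩ := h.semifinite (1 - x) (sub_nonneg' hx1)
    fun h => hne (sub_eq_zero.1 h).symm
  -- If the supremum x were not 1, a non-zero projection e ≤ Cy with y ≤ 1 - x and τ(y) < ∞ would
  -- have finite trace. For p in the family p ≤ x, so pyp ≤ p(1 - p)p = 0, hence ep = 0, which
  -- contradicts maximality.
  obtain ⟨e, he0, C, heC⟩ := Elem.exists_proj_smul_le hy hy0
  refine he0 (hmax e ?_ fun p hp => ?_)
  · refine (τ.mono e.nonneg heC).trans_lt ?_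
    rw [τ.smul_of_nonneg _ _ hy]
    exact ENNReal.mul_lt_top (by simp) hyτ
  · have hpx : p.1 ≤ x := hx.1 ⟨{⟨p, hp⟩}, by simp [P]⟩
    have h1 : star p.1 * y * p.1 ≤ star p.1 * (1 - p.1) * p.1 :=
      conj_mono (hyx.trans (sub_le_sub_left hpx 1)) p.1
    have h2 : star p.1 * (1 - p.1) * p.1 = 0 := by
      rw [mul_assoc, sub_mul, one_mul, p.mul_self, sub_self, mul_zero]
    have h3 : star p.1 * y * p.1 = 0 := le_antisymm (h1.trans h2.le) (conj_nonneg hy p.1)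
    have h4 : star p.1 * e.1 * p.1 ≤ 0 := by
      refine (conj_mono heC p.1).trans ?_
      rw [mul_smul_comm, smul_mul_assoc, h3, smul_zero]
    have h5 : star (e.1 * p.1) * (e.1 * p.1) = 0 := by
      rw [star_mul, e.star_eq, mul_assoc, ← mul_assoc e.1, e.mul_self, ← mul_assoc]
      exact le_antisymm h4 (conj_nonneg e.nonneg p.1)
    have h6 := congrArg star (Elem.star_mul_self_eq_zero h5)
    rwa [star_mul, e.star_eq, p.star_eq, star_zero] at h6

/-! ### Comparison of the two dimensions. -/

/-- The trace of `v Z v*`, for an operator `Z` commuting with a module and an intertwiner `v` of the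
module into `L²(N,τ)`. -/
def conjTrace (v : H →L[ℂ] τ.L2) (Z : H →L[ℂ] H) : ℝ≥0∞ :=
  comTrace (v.comp (Z.comp (ContinuousLinearMap.adjoint v)))

theorem conjTrace_one (v : H →L[ℂ] τ.L2) :
    conjTrace v 1 = comTrace (v.comp (ContinuousLinearMap.adjoint v)) := by
  rw [conjTrace, ContinuousLinearMap.one_def, ContinuousLinearMap.id_comp]

theorem conj_comp_mono {K : Type*} [NormedAddCommGroup K] [InnerProductSpace ℂ K]
    [CompleteSpace K] (v : H →L[ℂ] K) {Z Z' : H →L[ℂ] H} (hZ : 0 ≤ Z) (hle : Z ≤ Z') :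
    v.comp (Z.comp (ContinuousLinearMap.adjoint v)) ≤
      v.comp (Z'.comp (ContinuousLinearMap.adjoint v)) := by
  have h1 := (conj_comp_nonneg v hZ).isSelfAdjoint
  have h2 := (conj_comp_nonneg v (hZ.trans hle)).isSelfAdjoint
  refine le_of_qf_le h1 h2 fun ξ => ?_
  rw [qf_conj, qf_conj]
  exact qf_mono hle _

theorem Intertwines.commL_conj {v : H →L[ℂ] τ.L2} (hv : Intertwines π τ.lmulHom v)
    {Z : H →L[ℂ] H} (hZ : Intertwines π π Z) :
    CommL (v.comp (Z.comp (ContinuousLinearMap.adjoint v))) :=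
  Intertwines.comp hv (Intertwines.comp hZ (Intertwines.adjoint hv))

theorem IsFNS.conjTrace_mono (h : τ.IsFNS) {v : H →L[ℂ] τ.L2} (hv : Intertwines π τ.lmulHom v)
    {Z Z' : H →L[ℂ] H} (hZ : Intertwines π π Z) (hZ' : Intertwines π π Z') (hZ0 : 0 ≤ Z)
    (hle : Z ≤ Z') : conjTrace v Z ≤ conjTrace v Z' :=
  h.comTrace_mono (Intertwines.commL_conj hv hZ) (conj_comp_nonneg v hZ0)
    (Intertwines.commL_conj hv hZ') (conj_comp_mono v hZ0 hle)

theorem IsFNS.conjTrace_iSup (h : τ.IsFNS) {v : H →L[ℂ] τ.L2} (hv : Intertwines π τ.lmulHom v)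
    {α : Type*} [Preorder α] [IsDirectedOrder α] [Nonempty α] {Z : α → H →L[ℂ] H}
    {Z' : H →L[ℂ] H} (hmono : Monotone Z) (hZ : ∀ i, Intertwines π π (Z i)) (hZ0 : ∀ i, 0 ≤ Z i)
    (hZ' : Intertwines π π Z') (hZ0' : 0 ≤ Z')
    (hlub : ∀ ξ, IsLUB (Set.range fun i => qf ξ (Z i)) (qf ξ Z')) :
    conjTrace v Z' = ⨆ i, conjTrace v (Z i) :=
  h.comTrace_iSup (T := fun i => v.comp ((Z i).comp (ContinuousLinearMap.adjoint v)))
    (fun i k hik => conj_comp_mono v (hZ0 i) (hmono hik))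
    (fun i => Intertwines.commL_conj hv (hZ i)) (fun i => conj_comp_nonneg v (hZ0 i))
    (Intertwines.commL_conj hv hZ') (conj_comp_nonneg v hZ0') fun ξ => by
      simp only [qf_conj]
      exact hlub _

/-- The central supports of the members of an increasing net of projections with limit `1` tend
to `1`. -/
theorem isLUB_qf_cyclicProj (hπ : IsNormalRep π) {α : Type*} [Preorder α] [IsDirectedOrder α]
    [Nonempty α] {P : α → Proj N} (hPmul : ∀ i j, i ≤ j → (P j).1 * (P i).1 = (P i).1)
    (hP : IsLUB (Set.range fun i => (P i).1) 1) (ξ : H) :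
    IsLUB (Set.range fun i => qf ξ (cyclicProj π (P i))) (qf ξ 1) := by
  have hPle : Monotone fun i => (P i).1 := fun i k hik => by
    have h1 : IsStarProjection (P i).op.1 := (P i).op.2
    exact (h1.le_iff_mul_eq_right (P k).op.2).2 (congrArg Subtype.val (hPmul i k hik))
  have hl := hπ.isLUB_qf (D := Set.range fun i => (P i).1)
    (by rintro _ ⟨i, rfl⟩; exact (P i).nonneg) (Set.range_nonempty _)
    hPle.directed_le.directedOn_range hP ξ
  rw [map_one] at hl
  refine ⟨?_, fun b hb => hl.2 ?_⟩
  · rintro _ ⟨i, rfl⟩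
    exact qf_mono (cyclicProj_le_one _) ξ
  -- Normality of π sends the π(P_i) up to 1, and they lie below the cyclic projections.
  · rintro _ ⟨_, ⟨i, rfl⟩, rfl⟩
    exact (qf_mono (rep_le_cyclicProj (P i)) ξ).trans (hb ⟨i, rfl⟩)

/-- Petersen's dimension agrees with the Murray-von Neumann dimension. -/
theorem IsFNS.petersenDim_eq_dim (h : τ.IsFNS) (hπ : IsNormalRep π) :
    τ.petersenDim π = τ.dim π := by
  obtain ⟨ι, v, hv, hfr⟩ := exists_frame h.isNormalRep h.injective hπ
  have hone : (0 : H →L[ℂ] H) ≤ 1 := by simp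
  have hdim : τ.dim π = ∑' j, conjTrace (v j) 1 := by
    simp only [conjTrace_one]
    exact h.dim_eq hπ hv hfr
  have hcorner : ∀ p : Proj N, τ p.1 < ∞ → τ p.1 * (τ.cornerWeight p).dim (cornerRep π p) =
      ∑' j, conjTrace (v j) (cyclicProj π p) := h.mul_dim_cornerRep hπ hv hfr
  rw [hdim]
  refine le_antisymm (iSup₂_le fun p hp => ?_) ?_
  · rw [hcorner p hp]
    exact ENNReal.tsum_le_tsum fun j => h.conjTrace_mono (hv j) (intertwines_cyclicProj p)
      intertwines_one (cyclicProj_nonneg p) (cyclicProj_le_one p)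
  obtain ⟨α, _, _, P, hPτ, hPmul, hP⟩ := h.exists_monotone_proj
  have hmono : Monotone fun i => cyclicProj π (P i) := fun i k hik =>
    cyclicProj_mono_of_mul_eq (hPmul i k hik)
  have hsup : ∀ j, conjTrace (v j) 1 = ⨆ i, conjTrace (v j) (cyclicProj π (P i)) := fun j =>
    h.conjTrace_iSup (hv j) hmono (fun i => intertwines_cyclicProj (P i))
      (fun i => cyclicProj_nonneg (P i)) intertwines_one hone (isLUB_qf_cyclicProj hπ hPmul hP)
  -- On a finite set of frame indices the supremum over the increasing net may be taken outside the
  -- sum; each such partial sum is bounded by a single term of Petersen's supremum.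
  rw [ENNReal.tsum_eq_iSup_sum]
  refine iSup_le fun s => ?_
  simp only [hsup]
  rw [ENNReal.finsetSum_iSup_of_monotone fun j i k hik =>
    h.conjTrace_mono (hv j) (intertwines_cyclicProj (P i)) (intertwines_cyclicProj (P k))
      (cyclicProj_nonneg _) (hmono hik)]
  refine iSup_le fun i => le_iSup₂_of_le (P i) (hPτ i) ?_
  rw [hcorner _ (hPτ i)]
  exact ENNReal.sum_le_tsum s

end TracialWeight

end VNDim

end

theorem mainTheorem12
    {H₀ : Type u₀} [NormedAddCommGroup H₀] [InnerProductSpace ℂ H₀] [CompleteSpace H₀]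
    (N : VonNeumannAlgebra H₀) (τ : VNDim.TracialWeight N)
    (hfaithful : τ.IsFaithful) (hnormal : τ.IsNormal) (hsemifinite : τ.IsSemifinite)
    {H : Type u} [NormedAddCommGroup H] [InnerProductSpace ℂ H] [CompleteSpace H]
    (π : VNDim.Elem N →⋆ₐ[ℂ] (H →L[ℂ] H)) (hπ : VNDim.IsNormalRep π) :
    (∃ (ι : Type u) (v : H →ₗᵢ[ℂ] τ.Amp ι), τ.IsStandardIntertwiner π v) ∧
    (∀ (ι : Type w) (v : H →ₗᵢ[ℂ] τ.Amp ι), τ.IsStandardIntertwiner π v →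
      τ.MemTensor (τ.conjRangeProj v) ∧
      τ.dim π = τ.tensorTrace (τ.conjRangeProj v)) ∧
    τ.petersenDim π = τ.dim π := by
  have h : τ.IsFNS := ⟨hfaithful, hnormal, hsemifinite⟩
  exact ⟨h.exists_isStandardIntertwiner hπ,
    fun ι v hv => ⟨h.memTensor_conjRangeProj hv, h.dim_eq_tensorTrace hπ hv⟩,
    h.petersenDim_eq_dim hπ⟩
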